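/- Let $d\in\mathbb N$, let $\mathbb T^d=(\mathbb R/\mathbb Z)^d$, and let $F(\rho,q)=h(\rho)+\tfrac12 C_\kappa|q|^2$ with a constant $C_\kappa>0$, where $h\in C^0([0,\infty))\cap C^2((0,\infty))$. Let $p\in C^2((0,\infty))$ be the pressure, $\rho h'(\rho)=p(\rho)+h(\rho)$ for $\rho>0$. Assume that $p'(\rho)>0$ for $\rho>0$ and that, for some $\gamma>1$, $k>0$, $A>0$, $$(A_1)\quad h(\rho)=\tfrac{k}{\gamma-1}\rho^\gamma+o(\rho^\gamma)\ \ (\rho\to+\infty),\qquad (A_2)\quad |p''(\rho)|\le A\,\tfrac{p'(\rho)}{\rho}\ \ (\rho>0).$$ Consider the Euler–Korteweg system $$\partial_t\rho+\operatorname{div}m=0,\qquad \partial_t m+\operatorname{div}\Big(\frac{m\otimes m}{\rho}\Big)=-\rho\nabla\big(F_\rho-\operatorname{div}F_q\big)=\operatorname{div}S,\qquad m=\rho u,$$ $$S=\big[F-\rho F_\rho-\nabla\rho\cdot F_q+\operatorname{div}(\rho F_q)\big]\mathbb I-\nabla\rho\otimes F_q ,$$ where $F$, $F_\rho$, $F_q$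 are evaluated at $(\rho,\nabla\rho)$. Let $T>0$. **(H1), weak solutions.** $(\rho,m)$ satisfies: $\rho,m\in C([0,\infty);L^1(\mathbb T^d))$; $\rho\ge0$; $m=0$ a.e. on $\{\rho=0\}$ (so $m=\rho u$, and the quotients below are read as $0$ there); $\rho(t)\in W^{1,1}(\mathbb T^d)$ for every $t\ge 0$, with weak gradient $\nabla\rho$; $\rho F_q(\rho,\nabla\rho)$, its weak divergence, $\frac{m\otimes m}\rho$ and $S$ are in $L^1_{loc}([0,\infty)\times\mathbb T^d)$; for all $\psi,\varphi_i\in C^1_c([0,\infty);C^1(\mathbb T^d))$ $$-\iint\rho\,\psi_t+m\cdot\nabla\psi\,dx\,dt=\int\rho(x,0)\psi(x,0)\,dx,$$ $$-\iint m\cdot\varphi_t+\frac{m\otimes m}{\rho}:\nabla\varphi-S:\nabla\varphi\,dx\,dt=\int m(x,0)\cdot\varphi(x,0)\,dx;$$ the energy $e=\frac12\frac{|m|^2}{\rho}+F(\rho,\nabla\rho)$ is in $C([0,\infty);L^1(\mathbb T^d))$ and, for all non-negative compactly supported $\theta\in W^{1,\infty}[0,\infty)$, $-\iint e\,\dot\theta\,dx\,dt\le\theta(0)\int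 e|_{t=0}\,dx$ (dissipative solution), or this holds for all such $\theta$ with equality (conservative solution); and $\sup_{(0,T)}\int\rho\,dx<\infty$, $\sup_{(0,T)}\int e\,dx<\infty$. **(H2), strong solutions.** $(\bar\rho,\bar u)$ on $(0,T)\times\mathbb T^d$, $\bar\rho\ge0$, $\bar m=\bar\rho\bar u$, satisfies: $\bar\rho$, $\bar u$ and the (weak) derivatives $\partial_t\bar\rho$, $\partial_t\partial_i\bar\rho$, $\partial_i\bar\rho$, $\partial_{ij}\bar\rho$, $\partial_{ijk}\bar\rho$, $\partial_t\bar u_i$, $\partial_j\bar u_i$, $\partial_{jk}\bar u_i$ are in $L^\infty((0,T)\times\mathbb T^d)$, as are $\operatorname{div}F_q$ and $\nabla(F_\rho-\operatorname{div}F_q)$ at $(\bar\rho,\nabla\bar\rho)$; the system holds a.e. in $(0,T)\times\mathbb T^d$; and the total energy is conserved, i.e. the energy relation above holds on $[0,T)$ with equality. The functions $\bar\rho,\nabla\bar\rho,\bar u$ are identified with their continuous representatives on $[0,T]\times\mathbb T^d$. Let $$\varphi(t)=\int_{\mathbb T^d}\Big(\tfrac12\rho\Big|\frac m\rho-\frac{\bar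 m}{\bar\rho}\Big|^2+F(\rho,\nabla\rho\,|\,\bar\rho,\nabla\bar\rho)\Big)(x,t)\,dx,$$ $$F(\rho,q|\bar\rho,\bar q)=F(\rho,q)-F(\bar\rho,\bar q)-F_\rho(\bar\rho,\bar q)(\rho-\bar\rho)-F_q(\bar\rho,\bar q)\cdot(q-\bar q).$$ **Theorem.** For every $\delta>0$, $R$ and $L$ there is a constant $C>0$, depending only on $d,h,C_\kappa,\gamma,k,A,T,\delta,R,L$, such that the following holds for every $(\bar\rho,\bar u)$ as in (H2) with $\delta\le\bar\rho\le R$ on $[0,T]\times\mathbb T^d$ whose components $\bar u_i$ and derivatives $\partial_t\bar u_i,\partial_j\bar u_i,\partial_{jk}\bar u_i$ are bounded by $L$ in absolute value a.e., and for every $(\rho,m)$ as in (H1). 1. For every $t\in[0,T]$ the integrand of $\varphi(t)$ is integrable. 2. If $\gamma\ge2$, or if $1<\gamma<2$ and $\int_{\mathbb T^d}(\rho-\bar\rho)(x,0)\,dx=0$, then $\varphi(t)\le C\varphi(0)$ for all $t\in[0,T]$. 3. If $\varphi(0)=0$, then $\sup_{t\in[0,T]}\varphi(t)=0$, and $\rho=\bar\rho$,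 $m=\bar m$ a.e. in $\mathbb T^d$ for every $t\in[0,T]$. In particular (weak–strong uniqueness), if $\rho=\bar\rho$ and $m=\bar m$ a.e. at $t=0$, then $\rho=\bar\rho$ and $m=\bar m$ a.e. at every $t\in[0,T]$. -/

import Mathlib

open MeasureTheory Set Filter Topology
open scoped ContDiff

noncomputable section

namespace EulerKorteweg

/-- The `d`-dimensional torus `(ℝ / ℤ)^d`. -/
abbrev Torus (d : ℕ) : Type := UnitAddTorus (Fin d)

/-- Vectors of `ℝ^d`, with the Euclidean norm. -/
abbrev Vec (d : ℕ) : Type := EuclideanSpace ℝ (Fin d)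

/-- Lebesgue (normalised Haar) measure `dx` on the torus. -/
def dx (d : ℕ) : Measure (Torus d) := Measure.pi fun _ => AddCircle.haarAddCircle

/-- The measure `dt dx` on `I × 𝕋^d`, for a set of times `I`. -/
def dtdx (d : ℕ) (I : Set ℝ) : Measure (ℝ × Torus d) := (volume.restrict I).prod (dx d)

/-- The (classical) partial derivative `∂f/∂x_i` on the torus. -/
def pd {d : ℕ} (i : Fin d) (f : Torus d → ℝ) (x : Torus d) : ℝ :=
  deriv (fun s : ℝ => f (x + Pi.single i (s : UnitAddCircle))) 0

/-- The (classical) time derivative. -/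
def dt {d : ℕ} (ψ : ℝ → Torus d → ℝ) (t : ℝ) (x : Torus d) : ℝ :=
  deriv (fun s : ℝ => ψ s x) t

/-- A function on `ℝ × 𝕋^d`, seen as a function on `ℝ × ℝ^d` that is periodic in space. -/
def periodicLift {d : ℕ} (ψ : ℝ → Torus d → ℝ) (z : ℝ × (Fin d → ℝ)) : ℝ :=
  ψ z.1 (fun i => (z.2 i : UnitAddCircle))

/-- The test functions `C^1_c([0,∞); C^1(𝕋^d))`: the function `ψ` is `C^1`, its spatial derivatives
have a continuous time derivative, and `ψ` vanishes for large times. (Values at negative times are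
never used; they only serve to extend `ψ` beyond `t = 0`.) -/
structure IsTestC1 {d : ℕ} (ψ : ℝ → Torus d → ℝ) : Prop where
  contDiff : ContDiff ℝ 1 (periodicLift ψ)
  differentiable_grad : ∀ i x, Differentiable ℝ fun t => pd i (ψ t) x
  continuous_dt_grad : ∀ i, Continuous fun z : ℝ × Torus d => dt (fun t => pd i (ψ t)) z.1 z.2
  compactSupport : ∃ R : ℝ, ∀ t, R ≤ t → ∀ x, ψ t x = 0

/-- The test functions `C^∞_c((0,T) × 𝕋^d)`. -/
structure IsTestSmooth {d : ℕ} (T : ℝ) (ψ : ℝ → Torus d → ℝ) : Prop where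
  contDiff : ContDiff ℝ ∞ (periodicLift ψ)
  compactSupport : ∃ a b : ℝ, 0 < a ∧ b < T ∧ ∀ t, t ∉ Icc a b → ∀ x, ψ t x = 0

/-- The non-negative, compactly supported elements of `W^{1,∞}([0,τ))`, where `τ ∈ (0,∞]`. -/
structure IsTimeTest (τ : EReal) (θ : ℝ → ℝ) : Prop where
  lipschitz : ∃ K : NNReal, LipschitzWith K θ
  nonneg : ∀ t, 0 ≤ t → 0 ≤ θ t
  compactSupport : ∃ R : ℝ, (R : EReal) < τ ∧ ∀ t, R ≤ t → θ t = 0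

/-- `f ∈ C([0,∞); L^1(𝕋^d))`. -/
structure IsContL1 {d : ℕ} (f : ℝ → Torus d → ℝ) : Prop where
  measurable : AEStronglyMeasurable (Function.uncurry f) (dtdx d (Ici 0))
  integrable : ∀ t, 0 ≤ t → Integrable (f t) (dx d)
  continuous : ∀ t, 0 ≤ t →
    Tendsto (fun s => ∫ x, |f s x - f t x| ∂(dx d)) (𝓝[Ici 0] t) (𝓝 0)

/-- `f ∈ L^1_loc([0,∞) × 𝕋^d)`. -/
def IsLocL1 {d : ℕ} (f : ℝ → Torus d → ℝ) : Prop :=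
  ∀ R : ℝ, Integrable (Function.uncurry f) (dtdx d (Icc 0 R))

/-- `f ∈ L^∞((0,T) × 𝕋^d)`. -/
def IsLinf {d : ℕ} (T : ℝ) (f : ℝ → Torus d → ℝ) : Prop :=
  MemLp (Function.uncurry f) ⊤ (dtdx d (Ioo 0 T))

/-- `f ∈ W^{1,1}(𝕋^d)` with weak gradient `g`. -/
structure IsWeakGrad {d : ℕ} (f : Torus d → ℝ) (g : Torus d → Vec d) : Prop where
  integrable : Integrable f (dx d)
  integrable_grad : ∀ i, Integrable (fun x => g x i) (dx d)
  eq : ∀ i, ∀ χ : Torus d → ℝ, ContDiff ℝ ∞ (periodicLift fun _ => χ) →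
    ∫ x, f x * pd i χ x ∂(dx d) = - ∫ x, g x i * χ x ∂(dx d)

/-- `g` is the weak derivative `∂f/∂x_i` in `(0,T) × 𝕋^d`. -/
def HasWeakDx {d : ℕ} (T : ℝ) (i : Fin d) (f g : ℝ → Torus d → ℝ) : Prop :=
  ∀ ψ, IsTestSmooth T ψ →
    ∫ z, f z.1 z.2 * pd i (ψ z.1) z.2 ∂(dtdx d (Ioo 0 T))
      = - ∫ z, g z.1 z.2 * ψ z.1 z.2 ∂(dtdx d (Ioo 0 T))

/-- `g` is the weak derivative `∂f/∂t` in `(0,T) × 𝕋^d`. -/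
def HasWeakDt {d : ℕ} (T : ℝ) (f g : ℝ → Torus d → ℝ) : Prop :=
  ∀ ψ, IsTestSmooth T ψ →
    ∫ z, f z.1 z.2 * dt ψ z.1 z.2 ∂(dtdx d (Ioo 0 T))
      = - ∫ z, g z.1 z.2 * ψ z.1 z.2 ∂(dtdx d (Ioo 0 T))

/-- `g` is the weak spatial divergence of the vector field `v` in `(0,T) × 𝕋^d`. -/
def HasWeakDiv {d : ℕ} (T : ℝ) (v : ℝ → Torus d → Vec d) (g : ℝ → Torus d → ℝ) : Prop :=
  ∀ ψ, IsTestSmooth T ψ →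
    ∫ z, ∑ i, v z.1 z.2 i * pd i (ψ z.1) z.2 ∂(dtdx d (Ioo 0 T))
      = - ∫ z, g z.1 z.2 * ψ z.1 z.2 ∂(dtdx d (Ioo 0 T))

/-! ### The energy and the stress -/

/-- The potential energy density `F(ρ,q) = h(ρ) + ½ C_κ |q|²` with constant capillarity. -/
def constCapillarity (d : ℕ) (h : ℝ → ℝ) (Cκ : ℝ) (ρ : ℝ) (q : Vec d) : ℝ :=
  h ρ + 1 / 2 * Cκ * ‖q‖ ^ 2

/-- `F_ρ`. -/
def Fρ {d : ℕ} (F : ℝ → Vec d → ℝ) (ρ : ℝ) (q : Vec d) : ℝ := deriv (fun r => F r q) ρ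

/-- `F_q`. -/
def Fq {d : ℕ} (F : ℝ → Vec d → ℝ) (ρ : ℝ) (q : Vec d) : Vec d := gradient (F ρ) q

/-- The Korteweg stress
`S = [(F - ρ F_ρ - q · F_q) + div (ρ F_q)] 𝕀 - q ⊗ F_q`, where `q = ∇ρ` and `D = div (ρ F_q)`. -/
def stress {d : ℕ} (F : ℝ → Vec d → ℝ) (ρ : ℝ) (q : Vec d) (D : ℝ) (i j : Fin d) : ℝ :=
  (if i = j then F ρ q - ρ * Fρ F ρ q - inner ℝ q (Fq F ρ q) + D else 0) - q i * Fq F ρ q j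

/-- The total energy density `½ |m|²/ρ + F(ρ,q)`. -/
def energyDensity {d : ℕ} (F : ℝ → Vec d → ℝ) (ρ : ℝ) (m q : Vec d) : ℝ :=
  1 / 2 * (‖m‖ ^ 2 / ρ) + F ρ q

/-- The relative potential energy density `F(ρ,q | ρ',q')`. -/
def relF {d : ℕ} (F : ℝ → Vec d → ℝ) (ρ : ℝ) (q : Vec d) (ρ' : ℝ) (q' : Vec d) : ℝ :=
  F ρ q - F ρ' q' - Fρ F ρ' q' * (ρ - ρ') - inner ℝ (Fq F ρ' q') (q - q')

/-- The relative energy density `½ ρ |m/ρ - m'/ρ'|² + F(ρ,q | ρ',q')`. -/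
def relEnergyDensity {d : ℕ} (F : ℝ → Vec d → ℝ)
    (ρ : ℝ) (m q : Vec d) (ρ' : ℝ) (m' q' : Vec d) : ℝ :=
  1 / 2 * ρ * ‖ρ⁻¹ • m - ρ'⁻¹ • m'‖ ^ 2 + relF F ρ q ρ' q'

/-! ### Weak solutions -/

/-- The functions that occur in a weak solution: density `ρ`, momentum `m`, the gradient
`gradρ = ∇ρ` and `divr = div (ρ F_q(ρ,∇ρ))`. The last two are tied to `ρ` by
`IsWeakSolution`. -/
structure WeakFields (d : ℕ) where
  ρ : ℝ → Torus d → ℝ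
  m : ℝ → Torus d → Vec d
  gradρ : ℝ → Torus d → Vec d
  divr : ℝ → Torus d → ℝ

namespace WeakFields

variable {d : ℕ}

/-- The field `r = ρ F_q(ρ,∇ρ)`. -/
def r (F : ℝ → Vec d → ℝ) (W : WeakFields d) (t : ℝ) (x : Torus d) : Vec d :=
  W.ρ t x • Fq F (W.ρ t x) (W.gradρ t x)

/-- The stress of the weak solution. -/
def S (F : ℝ → Vec d → ℝ) (W : WeakFields d) (i j : Fin d) (t : ℝ) (x : Torus d) : ℝ :=
  stress F (W.ρ t x) (W.gradρ t x) (W.divr t x) i j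

/-- The total energy density of the weak solution. -/
def e (F : ℝ → Vec d → ℝ) (W : WeakFields d) (t : ℝ) (x : Torus d) : ℝ :=
  energyDensity F (W.ρ t x) (W.m t x) (W.gradρ t x)

end WeakFields

/-- Weak solutions of the Euler-Korteweg system on `[0,∞) × 𝕋^d` with energy `F`. The momentum
vanishes on the vacuum set, `m = ρ u`; this is the usual meaning of `m ⊗ m / ρ` there. -/
structure IsWeakSolution {d : ℕ} (F : ℝ → Vec d → ℝ) (W : WeakFields d) : Prop where
  cont_ρ : IsContL1 W.ρ
  cont_m : ∀ i, IsContL1 fun t x => W.m t x i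
  nonneg : ∀ t, 0 ≤ t → ∀ᵐ x ∂(dx d), 0 ≤ W.ρ t x
  vacuum : ∀ t, 0 ≤ t → ∀ᵐ x ∂(dx d), W.ρ t x = 0 → W.m t x = 0
  measurable_grad : ∀ i,
    AEStronglyMeasurable (fun z : ℝ × Torus d => W.gradρ z.1 z.2 i) (dtdx d (Ici 0))
  grad : ∀ t, 0 ≤ t → IsWeakGrad (W.ρ t) (W.gradρ t)
  loc_r : ∀ i, IsLocL1 fun t x => W.r F t x i
  loc_divr : IsLocL1 W.divr
  divr : ∀ T, 0 < T → HasWeakDiv T (W.r F) W.divr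
  loc_flux : ∀ i j, IsLocL1 fun t x => W.m t x i * W.m t x j / W.ρ t x
  loc_stress : ∀ i j, IsLocL1 (W.S F i j)
  mass : ∀ ψ, IsTestC1 ψ →
    - ∫ z, (W.ρ z.1 z.2 * dt ψ z.1 z.2 + ∑ i, W.m z.1 z.2 i * pd i (ψ z.1) z.2)
        ∂(dtdx d (Ioi 0))
      = ∫ x, W.ρ 0 x * ψ 0 x ∂(dx d)
  momentum : ∀ φ : Fin d → ℝ → Torus d → ℝ, (∀ i, IsTestC1 (φ i)) →
    - ∫ z, ((∑ i, W.m z.1 z.2 i * dt (φ i) z.1 z.2)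
          + (∑ i, ∑ j, W.m z.1 z.2 i * W.m z.1 z.2 j / W.ρ z.1 z.2 * pd j (φ i z.1) z.2)
          - ∑ i, ∑ j, W.S F i j z.1 z.2 * pd j (φ i z.1) z.2)
        ∂(dtdx d (Ioi 0))
      = ∫ x, ∑ i, W.m 0 x i * φ i 0 x ∂(dx d)

/-- Dissipative weak solutions: the total energy is in `C([0,∞); L^1)` and is weakly dissipated. -/
structure IsDissipative {d : ℕ} (F : ℝ → Vec d → ℝ) (W : WeakFields d) : Prop
    extends IsWeakSolution F W where
  cont_energy : IsContL1 (W.e F)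
  energy_le : ∀ θ, IsTimeTest ⊤ θ →
    - ∫ t in Ioi 0, (∫ x, W.e F t x ∂(dx d)) * deriv θ t ≤ (∫ x, W.e F 0 x ∂(dx d)) * θ 0

/-- Conservative weak solutions: the same with equality in the energy balance. -/
structure IsConservative {d : ℕ} (F : ℝ → Vec d → ℝ) (W : WeakFields d) : Prop
    extends IsWeakSolution F W where
  cont_energy : IsContL1 (W.e F)
  energy_eq : ∀ θ, IsTimeTest ⊤ θ →
    - ∫ t in Ioi 0, (∫ x, W.e F t x ∂(dx d)) * deriv θ t = (∫ x, W.e F 0 x ∂(dx d)) * θ 0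

/-- Hypothesis (H1). -/
structure HypWeak {d : ℕ} (F : ℝ → Vec d → ℝ) (T : ℝ) (W : WeakFields d) : Prop where
  solution : IsDissipative F W ∨ IsConservative F W
  mass_bound : ∃ K₁ : ℝ, ∀ t ∈ Ioo 0 T, ∫ x, W.ρ t x ∂(dx d) ≤ K₁
  energy_bound : ∃ K₂ : ℝ, ∀ t ∈ Ioo 0 T, ∫ x, W.e F t x ∂(dx d) ≤ K₂

/-! ### Strong solutions -/

/-- The functions that occur in a strong solution: density `ρ`, velocity `u`, their derivatives, the
divergence `divFq = div F_q(ρ,∇ρ)`, and `gradμ = ∇ (F_ρ - div F_q)`. `HypStrong` ties all of them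
to `ρ` and `u`. -/
structure StrongFields (d : ℕ) where
  ρ : ℝ → Torus d → ℝ
  u : ℝ → Torus d → Vec d
  gradρ : ℝ → Torus d → Vec d
  dtρ : ℝ → Torus d → ℝ
  dtgradρ : Fin d → ℝ → Torus d → ℝ
  ddρ : Fin d → Fin d → ℝ → Torus d → ℝ
  dddρ : Fin d → Fin d → Fin d → ℝ → Torus d → ℝ
  dtu : Fin d → ℝ → Torus d → ℝ
  du : Fin d → Fin d → ℝ → Torus d → ℝ
  ddu : Fin d → Fin d → Fin d → ℝ → Torus d → ℝ
  divFq : ℝ → Torus d → ℝ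
  gradμ : Fin d → ℝ → Torus d → ℝ

namespace StrongFields

variable {d : ℕ}

/-- The momentum `m = ρ u`. -/
def m (V : StrongFields d) (t : ℝ) (x : Torus d) : Vec d := V.ρ t x • V.u t x

/-- The total energy density of the strong solution. -/
def e (F : ℝ → Vec d → ℝ) (V : StrongFields d) (t : ℝ) (x : Torus d) : ℝ :=
  energyDensity F (V.ρ t x) (V.m t x) (V.gradρ t x)

end StrongFields

/-- Hypothesis (H2): `(ρ,u)` is a strong conservative solution on `(0,T) × 𝕋^d`. All derivatives are
weak derivatives in `L^∞`, and the equations hold almost everywhere. The functions `ρ`, `∇ρ` and `u`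
are then Lipschitz; they stand for their continuous representatives on `[0,T] × 𝕋^d`. -/
structure HypStrong {d : ℕ} (F : ℝ → Vec d → ℝ) (T : ℝ) (V : StrongFields d) : Prop where
  cont_ρ : ContinuousOn (Function.uncurry V.ρ) (Icc 0 T ×ˢ univ)
  cont_u : ContinuousOn (Function.uncurry V.u) (Icc 0 T ×ˢ univ)
  cont_gradρ : ContinuousOn (Function.uncurry V.gradρ) (Icc 0 T ×ˢ univ)
  nonneg : ∀ t ∈ Icc 0 T, ∀ x, 0 ≤ V.ρ t x
  gradρ : ∀ i, HasWeakDx T i V.ρ (fun t x => V.gradρ t x i)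
  dtρ : HasWeakDt T V.ρ V.dtρ
  dtgradρ : ∀ i, HasWeakDt T (fun t x => V.gradρ t x i) (V.dtgradρ i)
  /-- `ddρ i j = ∂_j ∂_i ρ` -/
  ddρ : ∀ i j, HasWeakDx T j (fun t x => V.gradρ t x i) (V.ddρ i j)
  /-- `dddρ i j k = ∂_k ∂_j ∂_i ρ` -/
  dddρ : ∀ i j k, HasWeakDx T k (V.ddρ i j) (V.dddρ i j k)
  dtu : ∀ i, HasWeakDt T (fun t x => V.u t x i) (V.dtu i)
  /-- `du i j = ∂_j u_i` -/
  du : ∀ i j, HasWeakDx T j (fun t x => V.u t x i) (V.du i j)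
  /-- `ddu i j k = ∂_k ∂_j u_i` -/
  ddu : ∀ i j k, HasWeakDx T k (V.du i j) (V.ddu i j k)
  linf_dtρ : IsLinf T V.dtρ
  linf_dtgradρ : ∀ i, IsLinf T (V.dtgradρ i)
  linf_ddρ : ∀ i j, IsLinf T (V.ddρ i j)
  linf_dddρ : ∀ i j k, IsLinf T (V.dddρ i j k)
  linf_dtu : ∀ i, IsLinf T (V.dtu i)
  linf_du : ∀ i j, IsLinf T (V.du i j)
  linf_ddu : ∀ i j k, IsLinf T (V.ddu i j k)
  linf_divFq : IsLinf T V.divFq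
  divFq : HasWeakDiv T (fun t x => Fq F (V.ρ t x) (V.gradρ t x)) V.divFq
  linf_gradμ : ∀ i, IsLinf T (V.gradμ i)
  gradμ : ∀ i, HasWeakDx T i (fun t x => Fρ F (V.ρ t x) (V.gradρ t x) - V.divFq t x) (V.gradμ i)
  /-- `ρ_t + div (ρ u) = 0` -/
  mass : ∀ᵐ z ∂(dtdx d (Ioo 0 T)),
    V.dtρ z.1 z.2
      + ∑ j, (V.gradρ z.1 z.2 j * V.u z.1 z.2 j + V.ρ z.1 z.2 * V.du j j z.1 z.2) = 0
  /-- `(ρ u)_t + div (ρ u ⊗ u) = - ρ ∇ (F_ρ - div F_q)`, with the products differentiated -/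
  momentum : ∀ i, ∀ᵐ z ∂(dtdx d (Ioo 0 T)),
    V.dtρ z.1 z.2 * V.u z.1 z.2 i + V.ρ z.1 z.2 * V.dtu i z.1 z.2
      + ∑ j, (V.gradρ z.1 z.2 j * V.u z.1 z.2 j * V.u z.1 z.2 i
          + V.ρ z.1 z.2 * V.du j j z.1 z.2 * V.u z.1 z.2 i
          + V.ρ z.1 z.2 * V.u z.1 z.2 j * V.du i j z.1 z.2)
      = - V.ρ z.1 z.2 * V.gradμ i z.1 z.2
  /-- conservation of energy -/
  energy_eq : ∀ θ, IsTimeTest (T : EReal) θ →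
    - ∫ t in Ioo 0 T, (∫ x, V.e F t x ∂(dx d)) * deriv θ t = (∫ x, V.e F 0 x ∂(dx d)) * θ 0

/-- The components of `u` and of its derivatives `∂_t u`, `∇u`, `∇²u` are bounded by `L` almost
everywhere in `(0,T) × 𝕋^d`. -/
def VelocityBound {d : ℕ} (T L : ℝ) (V : StrongFields d) : Prop :=
  ∀ᵐ z ∂(dtdx d (Ioo 0 T)), ∀ i,
    |V.u z.1 z.2 i| ≤ L ∧ |V.dtu i z.1 z.2| ≤ L ∧
      ∀ j, |V.du i j z.1 z.2| ≤ L ∧ ∀ k, |V.ddu i j k z.1 z.2| ≤ L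

/-! ### The relative energy -/

/-- The relative energy density of a weak solution with respect to a strong one. -/
def relDensity {d : ℕ} (F : ℝ → Vec d → ℝ) (W : WeakFields d) (V : StrongFields d)
    (t : ℝ) (x : Torus d) : ℝ :=
  relEnergyDensity F (W.ρ t x) (W.m t x) (W.gradρ t x) (V.ρ t x) (V.m t x) (V.gradρ t x)

/-- The relative energy `φ(t)`. -/
def relEnergy {d : ℕ} (F : ℝ → Vec d → ℝ) (W : WeakFields d) (V : StrongFields d) (t : ℝ) : ℝ :=
  ∫ x, relDensity F W V t x ∂(dx d)

/-- The two solutions coincide (almost everywhere) at time `t`. -/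
def Coincide {d : ℕ} (W : WeakFields d) (V : StrongFields d) (t : ℝ) : Prop :=
  ∀ᵐ x ∂(dx d), W.ρ t x = V.ρ t x ∧ W.m t x = V.m t x

end EulerKorteweg

end

open EulerKorteweg

/-! The proof is the relative energy method. Expanding the squares, the relative energy density is
the energy density of the weak solution plus terms affine in ρ, m, ∇ρ whose coefficients come from
the strong solution (`relDensity_expand`). The energy is dissipated. The affine terms are followed
in time by testing the weak equations with quantities built from the strong solution: momentum with
ū, continuity with ½|ū|² - h'(ρ̄) + Cκ Δρ̄, and the divergence of ρ F_q with div ū. Once the strong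
equations are inserted, everything of first order in the differences cancels
(`relative_energy_algebra`), and what is left is dφ/dt ≤ quadratic remainder, tested against
non-negative time cutoffs (`relative_energy_inequality`).

The remainder has four kinds of terms. The convective one and those quadratic in ∇(ρ - ρ̄) are
controlled by φ directly. The relative pressure times div ū is controlled because p' = ρ h'' turns
(A₂) into |p''| ≤ A h'': hence A h ± p is convex, and the relative pressure is at most A times the
relative potential (`Thermo.abs_rel_press_le`). The product (ρ - ρ̄) ∇(ρ - ρ̄) · ∇ div ū requires ∫
(ρ - ρ̄)² ≤ M φ. For γ ≥ 2 this is pointwise coercivity of the relative potential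
(`Thermo.relh_coercive`); for γ < 2 it is the Poincaré inequality (`IsWeakGrad.poincare`), since
both masses are conserved and agree initially. Gronwall's inequality in weak form (`weak_gronwall`)
concludes. When φ(0) = 0 the initial densities coincide, so the condition on the masses holds by
itself and uniqueness follows for every γ > 1.

Two points need care. The strong solution has only bounded weak derivatives, so it is not an
admissible test function. It is mollified (`exists_approx`); all derivatives that occur converge
almost everywhere and boundedly, and the weak fields act as integrable weights in dominated
convergence. The derivative ∂_t Δρ̄ has no such limit, and one spatial derivative is moved onto ∇ρ
before the limit is taken (`Approx.laplacian_identity`). Secondly, cutoffs supported inside (0,T)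
say nothing about individual times, so φ has to be continuous on [0,T] (`relEnergy_formula`). For
this, ∇ρ needs to be continuous in time only weakly, which follows from the L¹ continuity of ρ and a
uniform bound. -/

noncomputable section

namespace EulerKorteweg

variable {d : ℕ}

/-! ### The measures -/

instance instProbDx : IsProbabilityMeasure (dx d) := by
  unfold dx; infer_instance

instance instHaarDx : (dx d).IsAddHaarMeasure := by
  unfold dx; infer_instance

/-- Lebesgue measure on `ℝ × 𝕋^d`. -/
def spaceTime (d : ℕ) : Measure (ℝ × Torus d) := (volume : Measure ℝ).prod (dx d)

instance instHaarSpaceTime : (spaceTime d).IsAddHaarMeasure := by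
  unfold spaceTime; infer_instance

instance instSFiniteSpaceTime : SFinite (spaceTime d) := by
  unfold spaceTime; infer_instance

lemma dtdx_eq (I : Set ℝ) : dtdx d I = (spaceTime d).restrict (I ×ˢ univ) := by
  unfold dtdx spaceTime
  rw [← Measure.prod_restrict, Measure.restrict_univ]

instance instFiniteDtdxIoo (a b : ℝ) : IsFiniteMeasure (dtdx d (Ioo a b)) := by
  unfold dtdx; infer_instance

lemma dtdx_mono {I J : Set ℝ} (h : I ⊆ J) : dtdx d I ≤ dtdx d J := by
  rw [dtdx_eq, dtdx_eq]
  exact Measure.restrict_mono (prod_mono h le_rfl) le_rfl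

/-! ### Lifting to `ℝ × ℝ^d` -/

/-- The covering map `ℝ^d → 𝕋^d`. -/
def toTorus (y : Fin d → ℝ) : Torus d := fun i => (y i : UnitAddCircle)

lemma isOpenQuotientMap_toTorus : IsOpenQuotientMap (toTorus (d := d)) :=
  IsOpenQuotientMap.piMap (f := fun (_ : Fin d) (s : ℝ) => (s : UnitAddCircle))
    fun _ => QuotientAddGroup.isOpenQuotientMap_mk

lemma toTorus_add (y z : Fin d → ℝ) : toTorus (y + z) = toTorus y + toTorus z := by
  ext i; simp [toTorus]

lemma toTorus_sub (y z : Fin d → ℝ) : toTorus (y - z) = toTorus y - toTorus z := by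
  ext i; simp [toTorus]

lemma toTorus_single (i : Fin d) (s : ℝ) :
    toTorus (Pi.single i s) = Pi.single i (s : UnitAddCircle) := by
  ext j
  by_cases h : j = i
  · subst h; simp [toTorus]
  · simp [toTorus, h]

/-- Continuity on ℝ × 𝕋^d can be tested after lifting; this carries the lifted notion of smoothness
down to the torus. -/
lemma isOpenQuotientMap_quot :
    IsOpenQuotientMap (Prod.map id toTorus : ℝ × (Fin d → ℝ) → ℝ × Torus d) :=
  IsOpenQuotientMap.id.prodMap isOpenQuotientMap_toTorus

lemma exists_toTorus (x : Torus d) : ∃ y, toTorus y = x := isOpenQuotientMap_toTorus.surjective x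

/-- `f` is of class `C^n` on `ℝ × 𝕋^d`. -/
def PCD (n : WithTop ℕ∞) (f : ℝ → Torus d → ℝ) : Prop := ContDiff ℝ n (periodicLift f)

namespace PCD

variable {n m : WithTop ℕ∞} {f g : ℝ → Torus d → ℝ}

lemma continuous (hf : PCD n f) : Continuous (Function.uncurry f) :=
  isOpenQuotientMap_quot.continuous_comp_iff.1 (ContDiff.continuous hf)

lemma continuous_slice (hf : PCD n f) (t : ℝ) : Continuous (f t) :=
  hf.continuous.comp (by fun_prop : Continuous fun x : Torus d => (t, x))

lemma of_le (hf : PCD n f) (h : m ≤ n) : PCD m f := ContDiff.of_le hf h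

lemma const (c : ℝ) : PCD n (fun _ (_ : Torus d) => c) := by
  unfold PCD periodicLift; exact contDiff_const

lemma time {θ : ℝ → ℝ} (hθ : ContDiff ℝ n θ) : PCD n (fun t (_ : Torus d) => θ t) := by
  unfold PCD periodicLift; exact hθ.comp contDiff_fst

lemma add (hf : PCD n f) (hg : PCD n g) : PCD n (fun t x => f t x + g t x) :=
  ContDiff.add hf hg

lemma sub (hf : PCD n f) (hg : PCD n g) : PCD n (fun t x => f t x - g t x) :=
  ContDiff.sub hf hg

lemma mul (hf : PCD n f) (hg : PCD n g) : PCD n (fun t x => f t x * g t x) :=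
  ContDiff.mul hf hg

lemma const_mul (c : ℝ) (hf : PCD n f) : PCD n (fun t x => c * f t x) :=
  (PCD.const c).mul hf

lemma pow (hf : PCD n f) (k : ℕ) : PCD n (fun t x => f t x ^ k) :=
  ContDiff.pow hf k

lemma sum {ι : Type*} {s : Finset ι} {F : ι → ℝ → Torus d → ℝ} (h : ∀ i ∈ s, PCD n (F i)) :
    PCD n (fun t x => ∑ i ∈ s, F i t x) :=
  ContDiff.sum (f := fun i => periodicLift (F i)) h

lemma comp {G : ℝ → ℝ} {s : Set ℝ} (hG : ContDiffOn ℝ n G s) (hs : IsOpen s) (hf : PCD n f)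
    (hfs : ∀ t x, f t x ∈ s) : PCD n (fun t x => G (f t x)) := by
  refine contDiff_iff_contDiffAt.2 fun z => ?_
  have h1 : ContDiffAt ℝ n G (periodicLift f z) := hG.contDiffAt (hs.mem_nhds (hfs _ _))
  exact h1.comp z (ContDiff.contDiffAt hf)

/-- Freezing the time variable. -/
lemma slice (hf : PCD n f) (t : ℝ) : PCD n (fun _ => f t) := by
  have : ContDiff ℝ n ((periodicLift f) ∘ fun z : ℝ × (Fin d → ℝ) => (t, z.2)) :=
    ContDiff.comp hf (contDiff_const.prodMk contDiff_snd)
  exact this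

lemma hasFDerivAt (hf : PCD n f) (hn : 1 ≤ n) (z : ℝ × (Fin d → ℝ)) :
    HasFDerivAt (periodicLift f) (fderiv ℝ (periodicLift f) z) z :=
  ((ContDiff.differentiable hf (fun h => by simp [h] at hn)) z).hasFDerivAt

end PCD

/-! ### Partial derivatives -/

lemma hasDerivAt_shift {n : WithTop ℕ∞} {f : ℝ → Torus d → ℝ} (hf : PCD n f) (hn : 1 ≤ n)
    (t : ℝ) (y v : Fin d → ℝ) (s : ℝ) :
    HasDerivAt (fun s : ℝ => f t (toTorus (y + s • v)))
      (fderiv ℝ (periodicLift f) (t, y + s • v) (0, v)) s := by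
  have h1 : HasDerivAt (fun s : ℝ => ((t, y + s • v) : ℝ × (Fin d → ℝ))) (0, v) s := by
    have : HasDerivAt (fun s : ℝ => y + s • v) v s := by
      simpa using ((hasDerivAt_id s).smul_const v).const_add y
    exact (hasDerivAt_const s t).prodMk this
  exact (hf.hasFDerivAt hn (t, y + s • v)).comp_hasDerivAt s h1

lemma toTorus_shift (y : Fin d → ℝ) (i : Fin d) (s : ℝ) :
    toTorus (y + s • Pi.single i (1 : ℝ)) = toTorus y + Pi.single i (s : UnitAddCircle) := by
  rw [toTorus_add, ← Pi.single_smul, toTorus_single]; simp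

/-- The bridge between `pd`, defined by translation on the circle, and the Fréchet derivative of the
lift. Smoothness of partial derivatives and their commutation are all read off from the lift. -/
lemma pd_toTorus {n : WithTop ℕ∞} {f : ℝ → Torus d → ℝ} (hf : PCD n f) (hn : 1 ≤ n)
    (i : Fin d) (t : ℝ) (y : Fin d → ℝ) :
    pd i (f t) (toTorus y) = fderiv ℝ (periodicLift f) (t, y) (0, Pi.single i 1) := by
  have := (hasDerivAt_shift hf hn t y (Pi.single i 1) 0).deriv
  simp only [toTorus_shift, zero_smul, add_zero] at this
  exact this

lemma hasDerivAt_pd {n : WithTop ℕ∞} {f : ℝ → Torus d → ℝ} (hf : PCD n f) (hn : 1 ≤ n)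
    (i : Fin d) (t : ℝ) (x : Torus d) (s : ℝ) :
    HasDerivAt (fun s : ℝ => f t (x + Pi.single i (s : UnitAddCircle)))
      (pd i (f t) (x + Pi.single i (s : UnitAddCircle))) s := by
  obtain ⟨y, rfl⟩ := exists_toTorus x
  rw [← toTorus_shift, pd_toTorus hf hn]
  simpa only [toTorus_shift] using hasDerivAt_shift hf hn t y (Pi.single i 1) s

lemma hasDerivAt_pd_zero {n : WithTop ℕ∞} {f : ℝ → Torus d → ℝ} (hf : PCD n f) (hn : 1 ≤ n)
    (i : Fin d) (t : ℝ) (x : Torus d) :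
    HasDerivAt (fun s : ℝ => f t (x + Pi.single i (s : UnitAddCircle))) (pd i (f t) x) 0 := by
  simpa using hasDerivAt_pd hf hn i t x 0

lemma dt_toTorus_hasDerivAt {n : WithTop ℕ∞} {f : ℝ → Torus d → ℝ} (hf : PCD n f) (hn : 1 ≤ n)
    (t : ℝ) (y : Fin d → ℝ) :
    HasDerivAt (fun s => f s (toTorus y)) (fderiv ℝ (periodicLift f) (t, y) (1, 0)) t := by
  have h1 : HasDerivAt (fun s : ℝ => ((s, y) : ℝ × (Fin d → ℝ))) (1, 0) t :=
    (hasDerivAt_id t).prodMk (hasDerivAt_const t y)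
  exact (hf.hasFDerivAt hn (t, y)).comp_hasDerivAt t h1

lemma dt_toTorus {n : WithTop ℕ∞} {f : ℝ → Torus d → ℝ} (hf : PCD n f) (hn : 1 ≤ n)
    (t : ℝ) (y : Fin d → ℝ) :
    dt f t (toTorus y) = fderiv ℝ (periodicLift f) (t, y) (1, 0) :=
  (dt_toTorus_hasDerivAt hf hn t y).deriv

lemma hasDerivAt_dt {n : WithTop ℕ∞} {f : ℝ → Torus d → ℝ} (hf : PCD n f) (hn : 1 ≤ n)
    (t : ℝ) (x : Torus d) : HasDerivAt (fun s => f s x) (dt f t x) t := by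
  obtain ⟨y, rfl⟩ := exists_toTorus x
  rw [dt_toTorus hf hn]
  exact dt_toTorus_hasDerivAt hf hn t y

lemma periodicLift_pd {n : WithTop ℕ∞} {f : ℝ → Torus d → ℝ} (hf : PCD n f) (hn : 1 ≤ n)
    (i : Fin d) : periodicLift (fun t => pd i (f t)) =
      fun z => fderiv ℝ (periodicLift f) z (0, Pi.single i 1) := by
  funext z
  exact pd_toTorus hf hn i z.1 z.2

lemma periodicLift_dt {n : WithTop ℕ∞} {f : ℝ → Torus d → ℝ} (hf : PCD n f) (hn : 1 ≤ n) :
    periodicLift (dt f) = fun z => fderiv ℝ (periodicLift f) z (1, 0) := by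
  funext z
  exact dt_toTorus hf hn z.1 z.2

lemma one_le_of_add_one_le {n m : WithTop ℕ∞} (h : m + 1 ≤ n) : 1 ≤ n :=
  le_trans (by simp) h

lemma PCD.pd {n m : WithTop ℕ∞} {f : ℝ → Torus d → ℝ} (hf : PCD n f) (h : m + 1 ≤ n)
    (i : Fin d) : PCD m (fun t => pd i (f t)) := by
  unfold PCD
  rw [periodicLift_pd hf (one_le_of_add_one_le h)]
  exact (ContDiff.fderiv_right hf h).clm_apply contDiff_const

lemma PCD.dt {n m : WithTop ℕ∞} {f : ℝ → Torus d → ℝ} (hf : PCD n f) (h : m + 1 ≤ n) :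
    PCD m (dt f) := by
  unfold PCD
  rw [periodicLift_dt hf (one_le_of_add_one_le h)]
  exact (ContDiff.fderiv_right hf h).clm_apply contDiff_const

lemma PCD.pd_top {f : ℝ → Torus d → ℝ} (hf : PCD ∞ f) (i : Fin d) :
    PCD ∞ (fun t => EulerKorteweg.pd i (f t)) := hf.pd (by norm_cast) i

lemma PCD.dt_top {f : ℝ → Torus d → ℝ} (hf : PCD ∞ f) : PCD ∞ (EulerKorteweg.dt f) :=
  hf.dt (by norm_cast)

lemma fderiv_dir {n : WithTop ℕ∞} {f : ℝ → Torus d → ℝ} (hf : PCD n f) (hn : 2 ≤ n)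
    (z v w : ℝ × (Fin d → ℝ)) :
    fderiv ℝ (fun z => fderiv ℝ (periodicLift f) z v) z w
      = fderiv ℝ (fderiv ℝ (periodicLift f)) z w v := by
  have h1 : DifferentiableAt ℝ (fderiv ℝ (periodicLift f)) z :=
    ((ContDiff.fderiv_right (m := 1) hf (by simpa [one_add_one_eq_two] using hn)).differentiable
      (by simp)) z
  rw [fderiv_clm_apply h1 (differentiableAt_const v)]
  simp

/-- Schwarz's theorem for the lift. Taking coordinate directions gives `pd_comm` and `pd_dt_comm`.
-/
lemma fderiv_dir_comm {n : WithTop ℕ∞} {f : ℝ → Torus d → ℝ} (hf : PCD n f) (hn : 2 ≤ n)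
    (z v w : ℝ × (Fin d → ℝ)) :
    fderiv ℝ (fun z => fderiv ℝ (periodicLift f) z v) z w
      = fderiv ℝ (fun z => fderiv ℝ (periodicLift f) z w) z v := by
  rw [fderiv_dir hf hn, fderiv_dir hf hn]
  have h : IsSymmSndFDerivAt ℝ (periodicLift f) z :=
    (ContDiff.contDiffAt hf).isSymmSndFDerivAt (by simpa using hn)
  exact h w v

lemma pd_comm {n : WithTop ℕ∞} {f : ℝ → Torus d → ℝ} (hf : PCD n f) (hn : 2 ≤ n)
    (i j : Fin d) (t : ℝ) (x : Torus d) : pd i (pd j (f t)) x = pd j (pd i (f t)) x := by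
  obtain ⟨y, rfl⟩ := exists_toTorus x
  have h2 : (1 : WithTop ℕ∞) + 1 ≤ n := by simpa [one_add_one_eq_two] using hn
  have h1 := one_le_of_add_one_le h2
  rw [pd_toTorus (hf.pd h2 j) le_rfl, pd_toTorus (hf.pd h2 i) le_rfl, periodicLift_pd hf h1,
    periodicLift_pd hf h1, fderiv_dir_comm hf hn]

lemma pd_dt_comm {n : WithTop ℕ∞} {f : ℝ → Torus d → ℝ} (hf : PCD n f) (hn : 2 ≤ n)
    (i : Fin d) (t : ℝ) (x : Torus d) :
    pd i (dt f t) x = dt (fun t => pd i (f t)) t x := by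
  obtain ⟨y, rfl⟩ := exists_toTorus x
  have h2 : (1 : WithTop ℕ∞) + 1 ≤ n := by simpa [one_add_one_eq_two] using hn
  have h1 := one_le_of_add_one_le h2
  rw [pd_toTorus (hf.dt h2) le_rfl, dt_toTorus (hf.pd h2 i) le_rfl, periodicLift_pd hf h1,
    periodicLift_dt hf h1, fderiv_dir_comm hf hn]

/-! ### Rules of calculus for `pd` and `dt`. -/

section Rules

variable {n : WithTop ℕ∞} {f g : ℝ → Torus d → ℝ}

lemma pd_add (hf : PCD n f) (hg : PCD n g) (hn : 1 ≤ n) (i : Fin d) (t : ℝ) (x : Torus d) :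
    pd i (fun x => f t x + g t x) x = pd i (f t) x + pd i (g t) x :=
  ((hasDerivAt_pd_zero hf hn i t x).add (hasDerivAt_pd_zero hg hn i t x)).deriv

lemma pd_sub (hf : PCD n f) (hg : PCD n g) (hn : 1 ≤ n) (i : Fin d) (t : ℝ) (x : Torus d) :
    pd i (fun x => f t x - g t x) x = pd i (f t) x - pd i (g t) x :=
  ((hasDerivAt_pd_zero hf hn i t x).sub (hasDerivAt_pd_zero hg hn i t x)).deriv

lemma pd_mul (hf : PCD n f) (hg : PCD n g) (hn : 1 ≤ n) (i : Fin d) (t : ℝ) (x : Torus d) :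
    pd i (fun x => f t x * g t x) x = pd i (f t) x * g t x + f t x * pd i (g t) x := by
  refine ((hasDerivAt_pd_zero hf hn i t x).mul (hasDerivAt_pd_zero hg hn i t x)).deriv.trans ?_
  simp

lemma pd_const_mul (hf : PCD n f) (hn : 1 ≤ n) (c : ℝ) (i : Fin d) (t : ℝ) (x : Torus d) :
    pd i (fun x => c * f t x) x = c * pd i (f t) x :=
  ((hasDerivAt_pd_zero hf hn i t x).const_mul c).deriv

lemma pd_const (c : ℝ) (i : Fin d) (x : Torus d) : pd i (fun _ => c) x = 0 := by
  simp [pd]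

lemma pd_sum {ι : Type*} {s : Finset ι} {F : ι → ℝ → Torus d → ℝ} (h : ∀ k ∈ s, PCD n (F k))
    (hn : 1 ≤ n) (i : Fin d) (t : ℝ) (x : Torus d) :
    pd i (fun x => ∑ k ∈ s, F k t x) x = ∑ k ∈ s, pd i (F k t) x :=
  (HasDerivAt.fun_sum fun k hk => hasDerivAt_pd_zero (h k hk) hn i t x).deriv

lemma pd_comp {G : ℝ → ℝ} (hf : PCD n f) (hn : 1 ≤ n) (i : Fin d) (t : ℝ) (x : Torus d)
    (hG : DifferentiableAt ℝ G (f t x)) :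
    pd i (fun x => G (f t x)) x = deriv G (f t x) * pd i (f t) x := by
  have h1 : HasDerivAt G (deriv G (f t x))
      (f t (x + Pi.single i ((0 : ℝ) : UnitAddCircle))) := by simpa using hG.hasDerivAt
  exact (h1.comp (0 : ℝ) (hasDerivAt_pd_zero hf hn i t x)).deriv

lemma dt_add (hf : PCD n f) (hg : PCD n g) (hn : 1 ≤ n) (t : ℝ) (x : Torus d) :
    dt (fun t x => f t x + g t x) t x = dt f t x + dt g t x :=
  ((hasDerivAt_dt hf hn t x).add (hasDerivAt_dt hg hn t x)).deriv

lemma dt_mul (hf : PCD n f) (hg : PCD n g) (hn : 1 ≤ n) (t : ℝ) (x : Torus d) :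
    dt (fun t x => f t x * g t x) t x = dt f t x * g t x + f t x * dt g t x :=
  ((hasDerivAt_dt hf hn t x).mul (hasDerivAt_dt hg hn t x)).deriv

lemma dt_const_mul (hf : PCD n f) (hn : 1 ≤ n) (c : ℝ) (t : ℝ) (x : Torus d) :
    dt (fun t x => c * f t x) t x = c * dt f t x :=
  ((hasDerivAt_dt hf hn t x).const_mul c).deriv

lemma dt_time_mul {θ : ℝ → ℝ} (hθ : Differentiable ℝ θ) (hf : PCD n f) (hn : 1 ≤ n)
    (t : ℝ) (x : Torus d) :
    dt (fun t x => θ t * f t x) t x = deriv θ t * f t x + θ t * dt f t x :=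
  ((hθ t).hasDerivAt.mul (hasDerivAt_dt hf hn t x)).deriv

lemma dt_sum {ι : Type*} {s : Finset ι} {F : ι → ℝ → Torus d → ℝ} (h : ∀ k ∈ s, PCD n (F k))
    (hn : 1 ≤ n) (t : ℝ) (x : Torus d) :
    dt (fun t x => ∑ k ∈ s, F k t x) t x = ∑ k ∈ s, dt (F k) t x :=
  (HasDerivAt.fun_sum fun k hk => hasDerivAt_dt (h k hk) hn t x).deriv

lemma dt_comp {G : ℝ → ℝ} (hf : PCD n f) (hn : 1 ≤ n) (t : ℝ) (x : Torus d)
    (hG : DifferentiableAt ℝ G (f t x)) :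
    dt (fun t x => G (f t x)) t x = deriv G (f t x) * dt f t x :=
  (hG.hasDerivAt.comp t (hasDerivAt_dt hf hn t x)).deriv

end Rules

/-! ### Test functions -/

/-- Two derivatives are enough because the test class asks for a continuous mixed derivative ∂_t ∂_i
ψ in addition to C¹. -/
lemma PCD.isTestC1 {ψ : ℝ → Torus d → ℝ} (hψ : PCD 2 ψ)
    (hc : ∃ R : ℝ, ∀ t, R ≤ t → ∀ x, ψ t x = 0) : IsTestC1 ψ where
  contDiff := hψ.of_le (by norm_num)
  differentiable_grad i x t :=
    (hasDerivAt_dt (hψ.pd (m := 1) (by norm_num) i) le_rfl t x).differentiableAt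
  continuous_dt_grad i :=
    ((hψ.pd (m := 1) (by norm_num) i).dt (m := 0) (by norm_num)).continuous
  compactSupport := hc

/-! ### Integrals of derivatives -/

lemma integrable_of_continuous {f : Torus d → ℝ} (hf : Continuous f) : Integrable f (dx d) :=
  hf.integrable_of_hasCompactSupport (HasCompactSupport.of_compactSpace f)

lemma integrable_dtdx_of_continuousOn {f : ℝ × Torus d → ℝ} {a b : ℝ}
    (hf : ContinuousOn f (Icc a b ×ˢ univ)) : Integrable f (dtdx d (Ioo a b)) := by
  have h1 : Integrable f (dtdx d (Icc a b)) := by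
    rw [dtdx_eq]
    exact hf.integrableOn_compact (isCompact_Icc.prod isCompact_univ)
  exact h1.mono_measure (dtdx_mono Ioo_subset_Icc_self)

/-- By translation invariance, ∫ f(x + s e_i) dx does not depend on s; differentiate under the
integral at s = 0. -/
lemma integral_pd_eq_zero {f : ℝ → Torus d → ℝ} (hf : PCD 1 f) (i : Fin d) (t : ℝ) :
    ∫ x, pd i (f t) x ∂(dx d) = 0 := by
  have hcont : Continuous (pd i (f t)) :=
    (hf.pd (m := 0) (by norm_num) i).continuous_slice t
  obtain ⟨M, hM⟩ : ∃ M, ∀ x, ‖pd i (f t) x‖ ≤ M := by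
    obtain ⟨M, hM⟩ := isCompact_univ.exists_bound_of_continuousOn hcont.continuousOn
    exact ⟨M, fun x => hM x (mem_univ x)⟩
  have hsc : ∀ s : ℝ, Continuous fun x : Torus d => x + Pi.single i (s : UnitAddCircle) :=
    fun s => by fun_prop
  let F : ℝ → Torus d → ℝ := fun s x => f t (x + Pi.single i (s : UnitAddCircle))
  let F' : ℝ → Torus d → ℝ := fun s x => pd i (f t) (x + Pi.single i (s : UnitAddCircle))
  have hF : ∀ s, Continuous (F s) := fun s => (hf.continuous_slice t).comp (hsc s)
  have hF' : ∀ s, Continuous (F' s) := fun s => hcont.comp (hsc s)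
  have hderiv : ∀ s x, HasDerivAt (fun s => F s x) (F' s x) s :=
    fun s x => hasDerivAt_pd hf le_rfl i t x s
  have hbd : ∀ s x, ‖F' s x‖ ≤ M := fun s x => hM _
  have h0 : ∀ x, F' 0 x = pd i (f t) x := fun x => by simp [F']
  have h1 : ∀ s, ∫ x, F s x ∂(dx d) = ∫ x, f t x ∂(dx d) := fun s =>
    integral_add_right_eq_self (μ := dx d) (f t) _
  clear_value F F'
  have key := hasDerivAt_integral_of_dominated_loc_of_deriv_le (𝕜 := ℝ) (μ := dx d) (x₀ := 0)
    (F := F) (F' := F') (bound := fun _ => M) (s := univ) univ_mem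
    (Eventually.of_forall fun s => (hF s).aestronglyMeasurable)
    (integrable_of_continuous (hF 0)) (hF' 0).aestronglyMeasurable
    (Eventually.of_forall fun x s _ => hbd s x) (integrable_const M)
    (Eventually.of_forall fun x s _ => hderiv s x)
  have h2 := key.2
  simp only [h1, h0] at h2
  exact h2.unique (hasDerivAt_const _ _)

lemma integral_dtdx_pd_eq_zero {f : ℝ → Torus d → ℝ} (hf : PCD 1 f) (i : Fin d) (a b : ℝ) :
    ∫ z, pd i (f z.1) z.2 ∂(dtdx d (Ioo a b)) = 0 := by
  have hcont := (hf.pd (m := 0) (by norm_num) i).continuous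
  have hint : Integrable (fun z : ℝ × Torus d => pd i (f z.1) z.2) (dtdx d (Ioo a b)) :=
    integrable_dtdx_of_continuousOn (f := fun z : ℝ × Torus d => pd i (f z.1) z.2)
      hcont.continuousOn
  unfold dtdx at hint ⊢
  rw [integral_prod _ hint]
  simp [integral_pd_eq_zero hf]

lemma integral_dtdx_dt_eq_zero {f : ℝ → Torus d → ℝ} (hf : PCD 1 f) {a b : ℝ} (hab : a ≤ b)
    (ha : ∀ x, f a x = 0) (hb : ∀ x, f b x = 0) :
    ∫ z, dt f z.1 z.2 ∂(dtdx d (Ioo a b)) = 0 := by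
  have hcont := (hf.dt (m := 0) (by norm_num)).continuous
  have hint : Integrable (fun z : ℝ × Torus d => dt f z.1 z.2) (dtdx d (Ioo a b)) :=
    integrable_dtdx_of_continuousOn (f := fun z : ℝ × Torus d => dt f z.1 z.2) hcont.continuousOn
  unfold dtdx at hint ⊢
  rw [integral_prod_symm _ hint]
  have : ∀ x, ∫ t in Ioo a b, dt f t x = 0 := by
    intro x
    rw [← integral_Ioc_eq_integral_Ioo, ← intervalIntegral.integral_of_le hab,
      intervalIntegral.integral_eq_sub_of_hasDerivAt
        (fun t _ => hasDerivAt_dt hf le_rfl t x)]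
    · simp [ha, hb]
    · have : Continuous fun t => dt f t x :=
        hcont.comp (by fun_prop : Continuous fun t : ℝ => (t, x))
      exact this.intervalIntegrable _ _
  simp [this]

/-! ### Mollification on `(0,T) × 𝕋^d` -/

/-- Smooth kernels on `ℝ × 𝕋^d` that vanish for `|t| > ε`. -/
structure IsKernel (ε : ℝ) (K : ℝ → Torus d → ℝ) : Prop where
  smooth : PCD ∞ K
  support : ∀ t, ε < |t| → ∀ x, K t x = 0

namespace IsKernel

variable {ε : ℝ} {K : ℝ → Torus d → ℝ}

lemma pd (hK : IsKernel ε K) (i : Fin d) : IsKernel ε (fun t => EulerKorteweg.pd i (K t)) where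
  smooth := hK.smooth.pd_top i
  support t ht x := by
    have : K t = fun _ => 0 := funext (hK.support t ht)
    rw [this, pd_const]

lemma dt (hK : IsKernel ε K) : IsKernel ε (EulerKorteweg.dt K) where
  smooth := hK.smooth.dt_top
  support t ht x := by
    have h1 : ∀ᶠ s in 𝓝 t, ε < |s| := (continuous_abs.tendsto t).eventually (lt_mem_nhds ht)
    have h2 : (fun s => K s x) =ᶠ[𝓝 t] fun _ => 0 := h1.mono fun s hs => hK.support s hs x
    simpa [EulerKorteweg.dt] using h2.deriv_eq

lemma exists_bound (hK : IsKernel ε K) : ∃ M, ∀ t x, |K t x| ≤ M := by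
  obtain ⟨M, hM⟩ := (isCompact_Icc (a := -ε) (b := ε)).prod (isCompact_univ (X := Torus d))
    |>.exists_bound_of_continuousOn hK.smooth.continuous.continuousOn
  refine ⟨max M 0, fun t x => ?_⟩
  by_cases h : ε < |t|
  · rw [hK.support t h x]; simp
  · exact (hM (t, x) ⟨abs_le.1 (not_lt.1 h), mem_univ x⟩).trans (le_max_left _ _)

lemma integrable (hK : IsKernel ε K) : Integrable (Function.uncurry K) (spaceTime d) := by
  refine hK.smooth.continuous.integrable_of_hasCompactSupport ?_
  refine HasCompactSupport.intro
    ((isCompact_Icc (a := -ε) (b := ε)).prod (isCompact_univ (X := Torus d))) ?_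
  rintro ⟨t, x⟩ h
  refine hK.support t ?_ x
  by_contra h'
  exact h ⟨abs_le.1 (not_lt.1 h'), mem_univ x⟩

end IsKernel

/-- The reflected and translated kernel `(s,y) ↦ K (t - s, x - y)`. -/
def reflect (K : ℝ → Torus d → ℝ) (t : ℝ) (x : Torus d) : ℝ → Torus d → ℝ :=
  fun s y => K (t - s) (x - y)

section Reflect

variable {n : WithTop ℕ∞} {K : ℝ → Torus d → ℝ}

lemma PCD.reflect (hK : PCD n K) (t : ℝ) (x : Torus d) : PCD n (reflect K t x) := by
  obtain ⟨y, rfl⟩ := exists_toTorus x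
  have h : periodicLift (EulerKorteweg.reflect K t (toTorus y))
      = periodicLift K ∘ fun z => (t, y) - z := by
    funext z
    simp only [periodicLift, EulerKorteweg.reflect, Function.comp]
    exact congrArg (K (t - z.1)) (toTorus_sub y z.2).symm
  unfold PCD
  rw [h]
  exact ContDiff.comp hK (contDiff_const.sub contDiff_id)

lemma pd_reflect (hK : PCD n K) (hn : 1 ≤ n) (t : ℝ) (x : Torus d) (i : Fin d) (s : ℝ)
    (y : Torus d) : pd i (reflect K t x s) y = - pd i (K (t - s)) (x - y) := by
  have h := (hasDerivAt_pd hK hn i (t - s) (x - y) (-0)).comp (0 : ℝ) (hasDerivAt_neg (0 : ℝ))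
  have h2 := h.deriv
  simp only [neg_zero, mul_neg, mul_one] at h2
  rw [show (x - y : Torus d) + Pi.single i ((0 : ℝ) : UnitAddCircle) = x - y by simp] at h2
  rw [← h2]
  simp only [pd, reflect]
  congr 1
  funext r
  simp only [Function.comp]
  congr 1
  rw [AddCircle.coe_neg, Pi.single_neg]
  abel

lemma dt_reflect (hK : PCD n K) (hn : 1 ≤ n) (t : ℝ) (x : Torus d) (s : ℝ)
    (y : Torus d) : dt (reflect K t x) s y = - dt K (t - s) (x - y) := by
  have h := (hasDerivAt_dt hK hn (t - s) (x - y)).comp s ((hasDerivAt_id s).const_sub t)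
  refine h.deriv.trans ?_
  simp

/-- The condition ε < t < T - ε keeps the support of the reflected kernel inside (0,T). This is why
mollification commutes with weak derivatives only at interior times. -/
lemma IsKernel.isTestSmooth_reflect {ε T : ℝ} (hK : IsKernel ε K) {t : ℝ} (h1 : ε < t)
    (h2 : t + ε < T) (x : Torus d) : IsTestSmooth T (EulerKorteweg.reflect K t x) where
  contDiff := hK.smooth.reflect t x
  compactSupport := by
    refine ⟨t - ε, t + ε, by linarith, h2, fun s hs y => hK.support _ ?_ _⟩
    by_contra h
    have := abs_le.1 (not_lt.1 h)
    exact hs ⟨by linarith [this.2], by linarith [this.1]⟩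

end Reflect

/-- Mollification of `g` on `(0,T) × 𝕋^d` (extended by zero) with the kernel `K`. -/
def moll (T : ℝ) (K g : ℝ → Torus d → ℝ) (t : ℝ) (x : Torus d) : ℝ :=
  ∫ w, g w.1 w.2 * K (t - w.1) (x - w.2) ∂(dtdx d (Ioo 0 T))

section Moll

variable {ε T : ℝ} {K g : ℝ → Torus d → ℝ}

lemma IsKernel.integrable_moll (hK : IsKernel ε K)
    (hg : Integrable (Function.uncurry g) (dtdx d (Ioo 0 T))) (t : ℝ) (x : Torus d) :
    Integrable (fun w : ℝ × Torus d => g w.1 w.2 * K (t - w.1) (x - w.2)) (dtdx d (Ioo 0 T)) := by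
  obtain ⟨M, hM⟩ := hK.exists_bound
  have hc := (hK.smooth.reflect t x).continuous
  exact Integrable.mul_bdd (c := M) hg hc.aestronglyMeasurable
    (Eventually.of_forall fun w => hM _ _)

/-- The full derivative of the lift, in terms of `∂_t` and `∂_i`. -/
def jetCLM (K : ℝ → Torus d → ℝ) (t : ℝ) (x : Torus d) : ℝ × (Fin d → ℝ) →L[ℝ] ℝ :=
  dt K t x • ContinuousLinearMap.fst ℝ ℝ (Fin d → ℝ) +
    ∑ i, pd i (K t) x • (ContinuousLinearMap.proj i).comp (ContinuousLinearMap.snd ℝ ℝ (Fin d → ℝ))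

lemma fderiv_eq_jetCLM {n : WithTop ℕ∞} (hK : PCD n K) (hn : 1 ≤ n) (t : ℝ) (y : Fin d → ℝ) :
    fderiv ℝ (periodicLift K) (t, y) = jetCLM K t (toTorus y) := by
  ext
  · simp [jetCLM, dt_toTorus hK hn]
  · rename_i v
    have h : ((0, v) : ℝ × (Fin d → ℝ)) = ∑ i, v i • ((0, Pi.single i 1) : ℝ × (Fin d → ℝ)) := by
      ext j
      · simp [Prod.fst_sum]
      · simp [Prod.snd_sum, Finset.sum_apply, Pi.single_apply]
    simp only [ContinuousLinearMap.comp_apply, ContinuousLinearMap.inr_apply]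
    rw [h, map_sum]
    simp only [map_smul]
    simp [jetCLM, pd_toTorus hK hn, mul_comm, Pi.single_apply]

/-- Differentiation under the integral, dominated by |g| times a bound on the jet of the kernel. The
derivative is written through mollifications with the kernels ∂_t K and ∂_i K, so that the statement
can be iterated. -/
lemma IsKernel.hasFDerivAt_moll (hK : IsKernel ε K)
    (hg : Integrable (Function.uncurry g) (dtdx d (Ioo 0 T))) (z : ℝ × (Fin d → ℝ)) :
    HasFDerivAt (periodicLift (moll T K g))
      (moll T (EulerKorteweg.dt K) g z.1 (toTorus z.2) • ContinuousLinearMap.fst ℝ ℝ (Fin d → ℝ) +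
        ∑ i, moll T (fun t => EulerKorteweg.pd i (K t)) g z.1 (toTorus z.2) •
          (ContinuousLinearMap.proj i).comp (ContinuousLinearMap.snd ℝ ℝ (Fin d → ℝ))) z := by
  have hKt := hK.dt
  have hKp := hK.pd
  obtain ⟨M0, hM0⟩ := hKt.exists_bound
  choose Mi hMi using fun i => (hKp i).exists_bound
  let F' : (ℝ × (Fin d → ℝ)) → (ℝ × Torus d) → (ℝ × (Fin d → ℝ) →L[ℝ] ℝ) := fun z w =>
    (g w.1 w.2 * EulerKorteweg.dt K (z.1 - w.1) (toTorus z.2 - w.2)) • ContinuousLinearMap.fst ℝ ℝ (Fin d → ℝ) +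
    ∑ i, (g w.1 w.2 * EulerKorteweg.pd i (K (z.1 - w.1)) (toTorus z.2 - w.2)) •
      (ContinuousLinearMap.proj i).comp (ContinuousLinearMap.snd ℝ ℝ (Fin d → ℝ))
  have hint0 := fun z : ℝ × (Fin d → ℝ) => hKt.integrable_moll hg z.1 (toTorus z.2)
  have hinti := fun (z : ℝ × (Fin d → ℝ)) i => (hKp i).integrable_moll hg z.1 (toTorus z.2)
  have hF'int : ∀ z, Integrable (F' z) (dtdx d (Ioo 0 T)) := by
    intro z
    have h1 := (hint0 z).smul_const (ContinuousLinearMap.fst ℝ ℝ (Fin d → ℝ))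
    have h2 := integrable_finsetSum Finset.univ fun i _ => (hinti z i).smul_const
      ((ContinuousLinearMap.proj (R := ℝ) (φ := fun _ : Fin d => ℝ) i).comp
        (ContinuousLinearMap.snd ℝ ℝ (Fin d → ℝ)))
    exact h1.add h2
  have hF'eq : ∀ z w, F' z w = g w.1 w.2 • jetCLM K (z.1 - w.1) (toTorus z.2 - w.2) := by
    intro z w
    simp only [F', jetCLM, smul_add, Finset.smul_sum, mul_smul]
  obtain ⟨C1, hC1⟩ : ∃ C, ∀ t x, ‖jetCLM K t x‖ ≤ C := by
    refine ⟨M0 * ‖ContinuousLinearMap.fst ℝ ℝ (Fin d → ℝ)‖ + ∑ i, Mi i *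
      ‖(ContinuousLinearMap.proj (R := ℝ) (φ := fun _ : Fin d => ℝ) i).comp
        (ContinuousLinearMap.snd ℝ ℝ (Fin d → ℝ))‖, fun t x => ?_⟩
    refine (norm_add_le _ _).trans (add_le_add ?_ ((norm_sum_le _ _).trans
      (Finset.sum_le_sum fun i _ => ?_)))
    · rw [norm_smul]; exact mul_le_mul_of_nonneg_right (hM0 t x) (norm_nonneg _)
    · rw [norm_smul]; exact mul_le_mul_of_nonneg_right (hMi i t x) (norm_nonneg _)
  have key := hasFDerivAt_integral_of_dominated_of_fderiv_le (𝕜 := ℝ) (μ := dtdx d (Ioo 0 T))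
    (F := fun z w => g w.1 w.2 * K (z.1 - w.1) (toTorus z.2 - w.2)) (F' := F') (x₀ := z)
    (bound := fun w => |g w.1 w.2| * C1) (s := univ) univ_mem
    (Eventually.of_forall fun z => (hK.integrable_moll hg z.1 (toTorus z.2)).aestronglyMeasurable)
    (hK.integrable_moll hg z.1 (toTorus z.2)) (hF'int z).aestronglyMeasurable
    (Eventually.of_forall fun w z _ => by
      rw [hF'eq, norm_smul, Real.norm_eq_abs]
      exact mul_le_mul_of_nonneg_left (hC1 _ _) (abs_nonneg _))
    (hg.abs.mul_const C1)
    (Eventually.of_forall fun w z _ => by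
      rw [hF'eq]
      obtain ⟨y, hy⟩ := exists_toTorus w.2
      have h1 := hK.smooth.hasFDerivAt (by simp) (z - (w.1, y))
      have h2 : HasFDerivAt (fun z : ℝ × (Fin d → ℝ) => z - (w.1, y))
        (ContinuousLinearMap.id ℝ _) z := (hasFDerivAt_id z).sub_const _
      have h3 := (h1.comp z h2).const_mul (g w.1 w.2)
      rw [show z - (w.1, y) = (z.1 - w.1, z.2 - y) from rfl,
        fderiv_eq_jetCLM hK.smooth (by simp), toTorus_sub, hy] at h3
      refine HasFDerivAt.congr_fderiv (f := fun z : ℝ × (Fin d → ℝ) =>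
        g w.1 w.2 * K (z.1 - w.1) (toTorus z.2 - w.2)) ?_ rfl
      convert! h3 using 1
      funext u
      simp only [Function.comp, periodicLift, Prod.fst_sub, Prod.snd_sub]
      congr 2
      rw [← hy, ← toTorus_sub]; rfl)
  have h5 : ∫ w, F' z w ∂(dtdx d (Ioo 0 T)) =
      moll T (EulerKorteweg.dt K) g z.1 (toTorus z.2) • ContinuousLinearMap.fst ℝ ℝ (Fin d → ℝ) +
        ∑ i, moll T (fun t => EulerKorteweg.pd i (K t)) g z.1 (toTorus z.2) •
          (ContinuousLinearMap.proj i).comp (ContinuousLinearMap.snd ℝ ℝ (Fin d → ℝ)) := by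
    simp only [F']
    rw [integral_add ((hint0 z).smul_const _)
      (integrable_finsetSum _ fun i _ => (hinti z i).smul_const _),
      integral_finsetSum _ fun i _ => (hinti z i).smul_const _, integral_smul_const]
    simp only [integral_smul_const]
    rfl
  rw [← h5]
  exact key

/-- Induction on the order. The kernel must vary in the induction, since each derivative replaces it
by one of its own derivatives. -/
lemma IsKernel.pcd_moll_nat (n : ℕ) : ∀ K : ℝ → Torus d → ℝ, IsKernel ε K →
    Integrable (Function.uncurry g) (dtdx d (Ioo 0 T)) → PCD n (moll T K g) := by
  induction n with
  | zero =>
    intro K hK hg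
    refine contDiff_zero.2 ?_
    exact continuous_iff_continuousAt.2 fun z => (hK.hasFDerivAt_moll hg z).continuousAt
  | succ n ih =>
    intro K hK hg
    refine contDiff_succ_iff_hasFDerivAt.2 ⟨_, ?_, fun z => hK.hasFDerivAt_moll hg z⟩
    refine ContDiff.add ?_ (ContDiff.sum fun i _ => ?_)
    · exact ContDiff.smul (ih _ hK.dt hg) contDiff_const
    · exact ContDiff.smul (ih _ (hK.pd i) hg) contDiff_const

lemma IsKernel.pcd_moll (hK : IsKernel ε K)
    (hg : Integrable (Function.uncurry g) (dtdx d (Ioo 0 T))) : PCD ∞ (moll T K g) :=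
  contDiff_infty.2 fun n => IsKernel.pcd_moll_nat n K hK hg

lemma IsKernel.pd_moll (hK : IsKernel ε K)
    (hg : Integrable (Function.uncurry g) (dtdx d (Ioo 0 T))) (i : Fin d) (t : ℝ) (x : Torus d) :
    EulerKorteweg.pd i (moll T K g t) x
      = moll T (fun t => EulerKorteweg.pd i (K t)) g t x := by
  obtain ⟨y, rfl⟩ := exists_toTorus x
  rw [pd_toTorus (hK.pcd_moll hg) (by simp), (hK.hasFDerivAt_moll hg (t, y)).fderiv]
  simp [Pi.single_apply]

lemma IsKernel.dt_moll (hK : IsKernel ε K)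
    (hg : Integrable (Function.uncurry g) (dtdx d (Ioo 0 T))) (t : ℝ) (x : Torus d) :
    EulerKorteweg.dt (moll T K g) t x = moll T (EulerKorteweg.dt K) g t x := by
  obtain ⟨y, rfl⟩ := exists_toTorus x
  rw [dt_toTorus (hK.pcd_moll hg) (by simp), (hK.hasFDerivAt_moll hg (t, y)).fderiv]
  simp

/-- Test the weak derivative with the reflected kernel: the sign from integration by parts cancels
the sign from the reflection. -/
lemma IsKernel.pd_moll_weak (hK : IsKernel ε K) {f g : ℝ → Torus d → ℝ}
    (hf : Integrable (Function.uncurry f) (dtdx d (Ioo 0 T))) {i : Fin d}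
    (h : HasWeakDx T i f g) {t : ℝ} (h1 : ε < t) (h2 : t + ε < T) (x : Torus d) :
    EulerKorteweg.pd i (moll T K f t) x = moll T K g t x := by
  rw [hK.pd_moll hf]
  have := h _ (hK.isTestSmooth_reflect h1 h2 x)
  simp only [pd_reflect hK.smooth (by simp : (1 : WithTop ℕ∞) ≤ ∞), mul_neg, integral_neg,
    neg_inj] at this
  exact this

lemma IsKernel.dt_moll_weak (hK : IsKernel ε K) {f g : ℝ → Torus d → ℝ}
    (hf : Integrable (Function.uncurry f) (dtdx d (Ioo 0 T)))
    (h : HasWeakDt T f g) {t : ℝ} (h1 : ε < t) (h2 : t + ε < T) (x : Torus d) :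
    EulerKorteweg.dt (moll T K f) t x = moll T K g t x := by
  rw [hK.dt_moll hf]
  have := h _ (hK.isTestSmooth_reflect h1 h2 x)
  simp only [dt_reflect hK.smooth (by simp : (1 : WithTop ℕ∞) ≤ ∞), mul_neg, integral_neg,
    neg_inj] at this
  exact this

end Moll

/-! ### An approximate identity -/

instance instRegularSpaceTime : (spaceTime d).Regular :=
  Measure.Regular.of_sigmaCompactSpace_of_isLocallyFiniteMeasure _

instance instNegInvariantSpaceTime : (spaceTime d).IsNegInvariant :=
  Measure.IsAddHaarMeasure.isNegInvariant_of_regular _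

/-- The cosine on the circle `ℝ / ℤ`. -/
def cosT (x : UnitAddCircle) : ℝ := (AddCircle.toCircle x : ℂ).re

lemma cosT_coe (s : ℝ) : cosT (s : UnitAddCircle) = Real.cos (2 * Real.pi * s) := by
  rw [cosT, AddCircle.toCircle_apply_mk, Circle.coe_exp, Complex.exp_ofReal_mul_I_re]
  simp

lemma abs_cosT_le (x : UnitAddCircle) : |cosT x| ≤ 1 :=
  (Complex.abs_re_le_norm _).trans (Circle.norm_coe _).le

lemma cosT_zero : cosT 0 = 1 := by simp [cosT]

/-- A point of the unit circle with real part 1 is 1, and the map to the circle is injective. -/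
lemma eq_zero_of_cosT_eq_one {x : UnitAddCircle} (h : cosT x = 1) : x = 0 := by
  have h1 : (AddCircle.toCircle x : ℂ) = 1 := by
    have hn : Complex.normSq (AddCircle.toCircle x : ℂ) = 1 := by simp
    rw [Complex.normSq_apply] at hn
    unfold cosT at h
    rw [h] at hn
    apply Complex.ext
    · simpa using h
    · have : (AddCircle.toCircle x : ℂ).im * (AddCircle.toCircle x : ℂ).im = 0 := by linarith
      simpa using this
  apply AddCircle.injective_toCircle one_ne_zero
  rw [AddCircle.toCircle_zero]
  exact Circle.coe_injective (by simpa using h1)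

/-- The profile whose powers give the approximate identity. -/
def profile (ε : ℝ) (t : ℝ) (x : Torus d) : ℝ :=
  expNegInvGlue (ε ^ 2 - t ^ 2) * ∏ i, ((1 + cosT (x i)) / 2)

lemma profile_nonneg (ε t : ℝ) (x : Torus d) : 0 ≤ profile ε t x :=
  mul_nonneg (expNegInvGlue.nonneg _) (Finset.prod_nonneg fun i _ => by
    have := (abs_le.1 (abs_cosT_le (x i))).1
    linarith)

lemma pcd_profile (ε : ℝ) : PCD ∞ (profile (d := d) ε) := by
  refine PCD.mul (PCD.time ?_) ?_
  · exact expNegInvGlue.contDiff.comp (contDiff_const.sub (contDiff_id.pow 2))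
  · unfold PCD periodicLift
    refine contDiff_prod fun i _ => ?_
    simp only [cosT_coe]
    have h1 : ContDiff ℝ ∞ fun z : ℝ × (Fin d → ℝ) => 2 * Real.pi * z.2 i :=
      contDiff_const.mul ((contDiff_apply ℝ ℝ i).comp contDiff_snd)
    exact (contDiff_const.add (Real.contDiff_cos.comp h1)).div_const 2

lemma profile_zero_of_le {ε t : ℝ} (hε : 0 < ε) (h : ε ≤ |t|) (x : Torus d) :
    profile ε t x = 0 := by
  have h2 : ε ^ 2 ≤ t ^ 2 := by rw [← sq_abs t]; gcongr
  rw [profile, expNegInvGlue.zero_of_nonpos (by linarith), zero_mul]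

/-- The origin is the strict unique maximum, in time by monotonicity of exp(-1/s) and in each space
variable by the cosine. Hence normalised powers of the profile concentrate at the origin. -/
lemma profile_lt {ε : ℝ} (hε : 0 < ε) (z : ℝ × Torus d) (hz : z ≠ 0) :
    profile ε z.1 z.2 < profile ε 0 (0 : Torus d) := by
  obtain ⟨t, x⟩ := z
  have hfac : ∀ i, (1 + cosT (x i)) / 2 ≤ 1 := fun i => by
    have := (abs_le.1 (abs_cosT_le (x i))).2
    linarith
  have hfac0 : ∀ i, 0 ≤ (1 + cosT (x i)) / 2 := fun i => by
    have := (abs_le.1 (abs_cosT_le (x i))).1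
    linarith
  have hprod : ∏ i, ((1 + cosT (x i)) / 2) ≤ 1 :=
    Finset.prod_le_one (fun i _ => hfac0 i) fun i _ => hfac i
  have hprod0 : 0 ≤ ∏ i, ((1 + cosT (x i)) / 2) := Finset.prod_nonneg fun i _ => hfac0 i
  have hpos : 0 < expNegInvGlue (ε ^ 2 - 0 ^ 2) := expNegInvGlue.pos_of_pos (by nlinarith)
  have h0 : profile ε 0 (0 : Torus d) = expNegInvGlue (ε ^ 2 - 0 ^ 2) := by
    simp [profile, cosT_zero]
  rw [h0]
  by_cases ht : t = 0
  · subst ht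
    have hx : x ≠ 0 := fun h => hz (by simp [h])
    obtain ⟨i, hi⟩ : ∃ i, x i ≠ 0 := by
      by_contra! h; exact hx (funext h)
    have h1 : (1 + cosT (x i)) / 2 < 1 := by
      refine lt_of_le_of_ne (hfac i) fun h => hi (eq_zero_of_cosT_eq_one (by linarith))
    have h2 : ∏ i, ((1 + cosT (x i)) / 2) < 1 := by
      rw [← Finset.mul_prod_erase _ _ (Finset.mem_univ i)]
      calc _ ≤ (1 + cosT (x i)) / 2 * 1 := by
            refine mul_le_mul_of_nonneg_left ?_ (hfac0 i)
            exact Finset.prod_le_one (fun i _ => hfac0 i) fun i _ => hfac i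
        _ < 1 := by linarith
    exact mul_lt_of_lt_one_right hpos h2
  · have h3 : expNegInvGlue (ε ^ 2 - t ^ 2) < expNegInvGlue (ε ^ 2 - 0 ^ 2) := by
      have ht2 : 0 < t ^ 2 := by positivity
      by_cases hle : ε ^ 2 - t ^ 2 ≤ 0
      · rw [expNegInvGlue.zero_of_nonpos hle]; exact hpos
      · push Not at hle
        unfold expNegInvGlue
        rw [if_neg hle.not_ge, if_neg (by simp; positivity)]
        apply Real.exp_lt_exp.2
        rw [neg_lt_neg_iff]
        exact inv_strictAnti₀ hle (by linarith)
    exact (mul_le_of_le_one_right (expNegInvGlue.nonneg _) hprod).trans_lt h3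

/-- The support of the approximate identity. -/
def strip (d : ℕ) (ε : ℝ) : Set (ℝ × Torus d) := Icc (-ε) ε ×ˢ univ

lemma isCompact_strip (ε : ℝ) : IsCompact (strip d ε) := isCompact_Icc.prod isCompact_univ

/-- The approximate identity. -/
def bump (ε : ℝ) (n : ℕ) (t : ℝ) (x : Torus d) : ℝ :=
  (∫ z in strip d ε, profile ε z.1 z.2 ^ (n + 1) ∂(spaceTime d))⁻¹ * profile ε t x ^ (n + 1)

lemma continuous_profile (ε : ℝ) : Continuous fun z : ℝ × Torus d => profile ε z.1 z.2 :=
  (pcd_profile ε).continuous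

lemma zero_mem_closure_strip {ε : ℝ} (hε : 0 < ε) :
    (0 : ℝ × Torus d) ∈ closure (interior (strip d ε)) := by
  apply subset_closure
  rw [strip, interior_prod_eq, interior_Icc, interior_univ]
  exact ⟨⟨by simpa using hε, by simpa using hε⟩, mem_univ _⟩

/-- Normalised powers of a continuous function with a unique maximum form an approximate identity
there. The width ε of the support stays fixed while the power grows. -/
lemma tendsto_bump_smul {ε : ℝ} (hε : 0 < ε) {g : ℝ × Torus d → ℝ} (hg : Continuous g) :
    Tendsto (fun n => ∫ z in strip d ε, bump ε n z.1 z.2 * g z ∂(spaceTime d)) atTop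
      (𝓝 (g 0)) := by
  have h := tendsto_setIntegral_pow_smul_of_unique_maximum_of_isCompact_of_continuousOn
    (μ := spaceTime d) (isCompact_strip (d := d) ε) (c := fun z => profile ε z.1 z.2)
    (continuous_profile ε).continuousOn (x₀ := 0) (fun z _ hz => profile_lt hε z hz)
    (fun _ _ => profile_nonneg _ _ _)
    (by simp [profile, cosT_zero]; exact expNegInvGlue.pos_of_pos (by positivity))
    (zero_mem_closure_strip hε) hg.continuousOn
  -- The exponent in `bump` is n + 1 and not n, so that the kernel vanishes off the strip for n = 0
  -- as well, where a zeroth power would be 1.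
  have h2 := h.comp (tendsto_add_atTop_nat 1)
  refine h2.congr fun n => ?_
  simp only [Function.comp, smul_eq_mul, bump, mul_assoc]
  rw [integral_const_mul]

lemma integral_profile_pos {ε : ℝ} (hε : 0 < ε) (n : ℕ) :
    0 < ∫ z in strip d ε, profile ε z.1 z.2 ^ (n + 1) ∂(spaceTime d) := by
  have hc : Continuous fun z : ℝ × Torus d => profile ε z.1 z.2 ^ (n + 1) :=
    (continuous_profile ε).pow _
  refine (setIntegral_pos_iff_support_of_nonneg_ae
    (Eventually.of_forall fun _ => pow_nonneg (profile_nonneg _ _ _) _)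
    (hc.continuousOn.integrableOn_compact (isCompact_strip ε))).2 ?_
  have ho : IsOpen (Function.support (fun z : ℝ × Torus d => profile ε z.1 z.2 ^ (n + 1))) :=
    hc.isOpen_support
  have h0 : (0 : ℝ × Torus d) ∈
      Function.support (fun z : ℝ × Torus d => profile ε z.1 z.2 ^ (n + 1)) ∩
        interior (strip d ε) := by
    refine ⟨?_, ?_⟩
    · simp [profile, cosT_zero, (expNegInvGlue.pos_of_pos (show 0 < ε ^ 2 by positivity)).ne']
    · rw [strip, interior_prod_eq, interior_Icc, interior_univ]
      exact ⟨⟨by simpa using hε, by simpa using hε⟩, mem_univ _⟩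
  calc 0 < spaceTime d (Function.support _ ∩ interior (strip d ε)) :=
        (ho.inter isOpen_interior).measure_pos _ ⟨0, h0⟩
    _ ≤ _ := by gcongr; exact interior_subset

lemma isKernel_bump {ε : ℝ} (hε : 0 < ε) (n : ℕ) : IsKernel ε (bump (d := d) ε n) where
  smooth := ((pcd_profile ε).pow (n + 1)).const_mul _
  support t ht x := by simp [bump, profile_zero_of_le hε ht.le]

lemma bump_nonneg {ε : ℝ} (n : ℕ) (t : ℝ) (x : Torus d) :
    0 ≤ bump ε n t x :=
  mul_nonneg (inv_nonneg.2 (integral_nonneg fun _ => pow_nonneg (profile_nonneg _ _ _) _))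
    (pow_nonneg (profile_nonneg _ _ _) _)

lemma setIntegral_strip_bump {ε : ℝ} (hε : 0 < ε) (n : ℕ) (g : ℝ × Torus d → ℝ) :
    ∫ z in strip d ε, bump ε n z.1 z.2 * g z ∂(spaceTime d)
      = ∫ z, bump ε n z.1 z.2 * g z ∂(spaceTime d) := by
  refine setIntegral_eq_integral_of_forall_compl_eq_zero fun z hz => ?_
  rw [(isKernel_bump hε n).support, zero_mul]
  by_contra h
  exact hz ⟨abs_le.1 (not_lt.1 h), mem_univ _⟩

lemma integral_bump {ε : ℝ} (hε : 0 < ε) (n : ℕ) :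
    ∫ z : ℝ × Torus d, bump ε n z.1 z.2 ∂(spaceTime d) = 1 := by
  have h := setIntegral_strip_bump hε n (fun _ : ℝ × Torus d => 1)
  simp only [mul_one] at h
  rw [← h]
  simp only [bump]
  rw [integral_const_mul, inv_mul_cancel₀ (integral_profile_pos hε n).ne']

lemma integral_bump_reflect {ε : ℝ} (hε : 0 < ε) (n : ℕ) (t : ℝ) (x : Torus d) :
    ∫ w : ℝ × Torus d, bump ε n (t - w.1) (x - w.2) ∂(spaceTime d) = 1 := by
  refine Eq.trans ?_ (integral_bump (d := d) hε n)
  exact integral_sub_left_eq_self (fun z : ℝ × Torus d => bump ε n z.1 z.2) (spaceTime d) (t, x)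

lemma integrable_bump_reflect {ε : ℝ} (hε : 0 < ε) (n : ℕ) (t : ℝ) (x : Torus d) :
    Integrable (fun w : ℝ × Torus d => bump ε n (t - w.1) (x - w.2)) (spaceTime d) :=
  ((isKernel_bump hε n).integrable).comp_sub_left (t, x)

/-- Restriction to (0,T) may lose mass near the ends, so only an inequality remains. It is enough
for the uniform bound `abs_moll_le`. -/
lemma integral_bump_le {ε : ℝ} (hε : 0 < ε) (n : ℕ) (T t : ℝ) (x : Torus d) :
    ∫ w : ℝ × Torus d, bump ε n (t - w.1) (x - w.2) ∂(dtdx d (Ioo 0 T)) ≤ 1 := by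
  refine le_trans ?_ (integral_bump_reflect (d := d) hε n t x).le
  rw [dtdx_eq]
  exact setIntegral_le_integral (integrable_bump_reflect hε n t x)
    (Eventually.of_forall fun w => bump_nonneg _ _ _)

lemma abs_moll_le {ε T M : ℝ} (hε : 0 < ε) (n : ℕ) {g : ℝ → Torus d → ℝ}
    (hM : ∀ᵐ w ∂(dtdx d (Ioo 0 T)), |g w.1 w.2| ≤ M) (hM0 : 0 ≤ M) (t : ℝ) (x : Torus d) :
    |moll T (bump ε n) g t x| ≤ M := by
  have hint : Integrable (fun w : ℝ × Torus d => bump ε n (t - w.1) (x - w.2))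
      (dtdx d (Ioo 0 T)) := by
    rw [dtdx_eq]; exact (integrable_bump_reflect hε n t x).restrict
  calc |moll T (bump ε n) g t x|
      ≤ ∫ w : ℝ × Torus d, M * bump ε n (t - w.1) (x - w.2) ∂(dtdx d (Ioo 0 T)) := by
        rw [← Real.norm_eq_abs]
        refine norm_integral_le_of_norm_le (hint.const_mul M) ?_
        filter_upwards [hM] with w hw
        rw [Real.norm_eq_abs, abs_mul, abs_of_nonneg (bump_nonneg _ _ _)]
        exact mul_le_mul_of_nonneg_right hw (bump_nonneg _ _ _)
    _ = M * ∫ w : ℝ × Torus d, bump ε n (t - w.1) (x - w.2) ∂(dtdx d (Ioo 0 T)) :=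
        integral_const_mul _ _
    _ ≤ M * 1 := by gcongr; exact integral_bump_le hε n T t x
    _ = M := mul_one M

lemma moll_nonneg {ε T : ℝ} (n : ℕ) {g : ℝ → Torus d → ℝ}
    (hg : ∀ᵐ w ∂(dtdx d (Ioo 0 T)), 0 ≤ g w.1 w.2) (t : ℝ) (x : Torus d) :
    0 ≤ moll T (bump ε n) g t x := by
  refine integral_nonneg_of_ae ?_
  filter_upwards [hg] with w hw
  exact mul_nonneg hw (bump_nonneg _ _ _)

/-! ### Convergence in `L^1` -/

section Translation

variable {f : ℝ × Torus d → ℝ}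

/-- Continuity of translations in L¹, as continuity of composition with a continuous family of
measure preserving maps. -/
lemma continuous_integral_translate (hf : Integrable f (spaceTime d)) :
    Continuous fun y => ∫ z, |f (z - y) - f z| ∂(spaceTime d) := by
  let F : Lp ℝ 1 (spaceTime d) := hf.toL1 f
  have hmp : ∀ y : ℝ × Torus d, MeasurePreserving (fun z => z - y) (spaceTime d) (spaceTime d) :=
    fun y => measurePreserving_sub_right _ y
  let τ : ℝ × Torus d → C(ℝ × Torus d, ℝ × Torus d) := fun y => ⟨fun z => z - y, by fun_prop⟩
  have hτ : Continuous τ :=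
    ContinuousMap.continuous_of_continuous_uncurry _ (by
      simp only [τ, Function.uncurry_def, ContinuousMap.coe_mk]; fun_prop)
  have hc : Continuous fun y => Lp.compMeasurePreserving (τ y) (hmp y) F :=
    Continuous.compMeasurePreservingLp continuous_const hτ hmp (by simp)
  have hn : Continuous fun y => ‖Lp.compMeasurePreserving (τ y) (hmp y) F - F‖ :=
    (hc.sub continuous_const).norm
  refine hn.congr fun y => ?_
  rw [L1.norm_eq_integral_norm]
  refine integral_congr_ae ?_
  have h1 := Lp.coeFn_sub (Lp.compMeasurePreserving (τ y) (hmp y) F) F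
  have h2 := Lp.coeFn_compMeasurePreserving F (hmp y)
  have h3 : (F : ℝ × Torus d → ℝ) =ᵐ[spaceTime d] f := Integrable.coeFn_toL1 hf
  have h4 := (hmp y).quasiMeasurePreserving.ae_eq_comp h3
  filter_upwards [h1, h2, h3, h4] with z h1 h2 h3 h4
  rw [h1, Pi.sub_apply, h3, Real.norm_eq_abs]
  congr 2
  exact h2.trans h4

/-- Since the kernel has mass one, the difference at z is ∫ K(y) (f(z - y) - f(z)) dy; take absolute
values and exchange the integrals. -/
lemma integral_abs_conv_sub_le {ε : ℝ} (hε : 0 < ε) (n : ℕ) (hf : Integrable f (spaceTime d)) :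
    Integrable (fun z => |∫ w, f w * bump ε n (z.1 - w.1) (z.2 - w.2) ∂(spaceTime d) - f z|)
      (spaceTime d) ∧
    ∫ z, |∫ w, f w * bump ε n (z.1 - w.1) (z.2 - w.2) ∂(spaceTime d) - f z| ∂(spaceTime d)
      ≤ ∫ y, bump ε n y.1 y.2 * ∫ z, |f (z - y) - f z| ∂(spaceTime d) ∂(spaceTime d) := by
  have hK := isKernel_bump (d := d) hε n
  have hKi : Integrable (fun y : ℝ × Torus d => bump ε n y.1 y.2) (spaceTime d) := hK.integrable
  have hI1 : Integrable (fun p : (ℝ × Torus d) × (ℝ × Torus d) =>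
      bump ε n p.2.1 p.2.2 * f (p.1 - p.2)) ((spaceTime d).prod (spaceTime d)) :=
    Integrable.convolution_integrand (ContinuousLinearMap.mul ℝ ℝ) hKi hf
  have hI2 : Integrable (fun p : (ℝ × Torus d) × (ℝ × Torus d) =>
      bump ε n p.2.1 p.2.2 * f p.1) ((spaceTime d).prod (spaceTime d)) := by
    simpa only [mul_comm] using hf.mul_prod hKi
  have hI : Integrable (fun p : (ℝ × Torus d) × (ℝ × Torus d) =>
      bump ε n p.2.1 p.2.2 * (f (p.1 - p.2) - f p.1)) ((spaceTime d).prod (spaceTime d)) := by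
    simp only [mul_sub]
    exact hI1.sub hI2
  have hpt : ∀ᵐ z ∂(spaceTime d), ∫ w, f w * bump ε n (z.1 - w.1) (z.2 - w.2) ∂(spaceTime d) - f z
      = ∫ y, bump ε n y.1 y.2 * (f (z - y) - f z) ∂(spaceTime d) := by
    filter_upwards [hI1.prod_right_ae] with z hz
    have e1 : ∫ w, f w * bump ε n (z.1 - w.1) (z.2 - w.2) ∂(spaceTime d)
        = ∫ y, bump ε n y.1 y.2 * f (z - y) ∂(spaceTime d) := by
      rw [← integral_sub_left_eq_self (fun y : ℝ × Torus d => bump ε n y.1 y.2 * f (z - y))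
        (spaceTime d) z]
      refine integral_congr_ae (Eventually.of_forall fun w => ?_)
      simp [mul_comm]
    rw [e1]
    simp only [mul_sub]
    rw [integral_sub hz (hKi.mul_const _), integral_mul_const, integral_bump hε, one_mul]
  have hInorm := hI.norm
  have hle : ∀ᵐ z ∂(spaceTime d),
      ‖|∫ w, f w * bump ε n (z.1 - w.1) (z.2 - w.2) ∂(spaceTime d) - f z|‖
      ≤ ∫ y, ‖bump ε n y.1 y.2 * (f (z - y) - f z)‖ ∂(spaceTime d) := by
    filter_upwards [hpt] with z hz
    rw [Real.norm_eq_abs, abs_abs, hz, ← Real.norm_eq_abs]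
    exact norm_integral_le_integral_norm _
  have hmeas : AEStronglyMeasurable
      (fun z => |∫ w, f w * bump ε n (z.1 - w.1) (z.2 - w.2) ∂(spaceTime d) - f z|)
      (spaceTime d) := by
    have h1 : AEStronglyMeasurable
        (fun z => ‖∫ y, bump ε n y.1 y.2 * (f (z - y) - f z) ∂(spaceTime d)‖) (spaceTime d) :=
      hI.integral_prod_left.aestronglyMeasurable.norm
    refine h1.congr ?_
    filter_upwards [hpt] with z hz
    rw [hz]; rfl
  refine ⟨Integrable.mono' hInorm.integral_prod_left hmeas hle, ?_⟩
  calc _ ≤ ∫ z, ∫ y, ‖bump ε n y.1 y.2 * (f (z - y) - f z)‖ ∂(spaceTime d) ∂(spaceTime d) := by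
        refine integral_mono_ae (Integrable.mono' hInorm.integral_prod_left hmeas hle)
          hInorm.integral_prod_left ?_
        filter_upwards [hle] with z hz
        exact (le_abs_self _).trans hz
    _ = ∫ y, ∫ z, ‖bump ε n y.1 y.2 * (f (z - y) - f z)‖ ∂(spaceTime d) ∂(spaceTime d) :=
        integral_integral_swap hInorm
    _ = _ := by
        refine integral_congr_ae (Eventually.of_forall fun y => ?_)
        simp only [norm_mul, Real.norm_eq_abs, abs_of_nonneg (bump_nonneg n y.1 y.2)]
        rw [integral_const_mul]

end Translation

lemma moll_eq_integral_indicator (T : ℝ) (K g : ℝ → Torus d → ℝ) (t : ℝ) (x : Torus d) :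
    moll T K g t x = ∫ w, (Ioo 0 T ×ˢ univ).indicator (Function.uncurry g) w
      * K (t - w.1) (x - w.2) ∂(spaceTime d) := by
  rw [moll, dtdx_eq, ← integral_indicator (measurableSet_Ioo.prod MeasurableSet.univ)]
  refine integral_congr_ae (Eventually.of_forall fun w => ?_)
  by_cases hw : w ∈ (Ioo 0 T ×ˢ univ : Set (ℝ × Torus d))
  · simp [hw, Function.uncurry]
  · simp [hw]

/-- The zero extension of g is integrable on all of ℝ × 𝕋^d. Its L¹ modulus of translation is
continuous and vanishes at 0, so its averages against the concentrating kernel tend to 0. -/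
lemma tendsto_moll_L1 {ε T : ℝ} (hε : 0 < ε) {g : ℝ → Torus d → ℝ}
    (hg : Integrable (Function.uncurry g) (dtdx d (Ioo 0 T))) :
    Tendsto (fun n => ∫ z, |moll T (bump ε n) g z.1 z.2 - g z.1 z.2| ∂(dtdx d (Ioo 0 T)))
      atTop (𝓝 0) := by
  set f : ℝ × Torus d → ℝ := (Ioo 0 T ×ˢ univ).indicator (Function.uncurry g) with hfdef
  have hms : MeasurableSet (Ioo 0 T ×ˢ univ : Set (ℝ × Torus d)) :=
    measurableSet_Ioo.prod MeasurableSet.univ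
  have hf : Integrable f (spaceTime d) := by
    rw [hfdef, integrable_indicator_iff hms]
    rw [dtdx_eq] at hg
    exact hg
  have hlim : Tendsto (fun n => ∫ y, bump ε n y.1 y.2 * ∫ z, |f (z - y) - f z| ∂(spaceTime d)
      ∂(spaceTime d)) atTop (𝓝 0) := by
    have := tendsto_bump_smul hε (continuous_integral_translate hf)
    simp only [sub_zero, sub_self, abs_zero, integral_zero] at this
    refine this.congr fun n => setIntegral_strip_bump hε n _
  refine squeeze_zero (fun n => integral_nonneg fun z => abs_nonneg _) (fun n => ?_) hlim
  obtain ⟨h1, h2⟩ := integral_abs_conv_sub_le hε n hf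
  refine le_trans ?_ h2
  rw [dtdx_eq]
  calc _ = ∫ z in Ioo 0 T ×ˢ univ,
      |∫ w, f w * bump ε n (z.1 - w.1) (z.2 - w.2) ∂(spaceTime d) - f z| ∂(spaceTime d) := by
        refine setIntegral_congr_fun hms fun z hz => ?_
        simp only [moll_eq_integral_indicator]
        rw [hfdef, indicator_of_mem hz]
        rfl
    _ ≤ _ := setIntegral_le_integral h1 (Eventually.of_forall fun z => abs_nonneg _)

/-! ### Bounded almost everywhere convergence -/

/-- Uniformly bounded almost everywhere convergence of a sequence of functions. -/
structure BTend {α : Type*} [MeasurableSpace α] (μ : Measure α) (Φ : ℕ → α → ℝ) (Φ₀ : α → ℝ) :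
    Prop where
  meas : ∀ n, AEStronglyMeasurable (Φ n) μ
  bdd : ∃ M, ∀ n, ∀ᵐ z ∂μ, |Φ n z| ≤ M
  tend : ∀ᵐ z ∂μ, Tendsto (fun n => Φ n z) atTop (𝓝 (Φ₀ z))

namespace BTend

variable {α : Type*} [MeasurableSpace α] {μ : Measure α} {Φ Ψ : ℕ → α → ℝ} {Φ₀ Ψ₀ : α → ℝ}

lemma add (h : BTend μ Φ Φ₀) (k : BTend μ Ψ Ψ₀) :
    BTend μ (fun n z => Φ n z + Ψ n z) (fun z => Φ₀ z + Ψ₀ z) where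
  meas n := (h.meas n).add (k.meas n)
  bdd := by
    obtain ⟨M, hM⟩ := h.bdd
    obtain ⟨N, hN⟩ := k.bdd
    refine ⟨M + N, fun n => ?_⟩
    filter_upwards [hM n, hN n] with z h1 h2
    exact (abs_add_le _ _).trans (add_le_add h1 h2)
  tend := by
    filter_upwards [h.tend, k.tend] with z h1 h2 using h1.add h2

lemma mul (h : BTend μ Φ Φ₀) (k : BTend μ Ψ Ψ₀) :
    BTend μ (fun n z => Φ n z * Ψ n z) (fun z => Φ₀ z * Ψ₀ z) where
  meas n := (h.meas n).mul (k.meas n)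
  bdd := by
    obtain ⟨M, hM⟩ := h.bdd
    obtain ⟨N, hN⟩ := k.bdd
    refine ⟨M * N, fun n => ?_⟩
    filter_upwards [hM n, hN n] with z h1 h2
    rw [abs_mul]
    exact mul_le_mul h1 h2 (abs_nonneg _) ((abs_nonneg _).trans h1)
  tend := by
    filter_upwards [h.tend, k.tend] with z h1 h2 using h1.mul h2

lemma const {g : α → ℝ} (hg : AEStronglyMeasurable g μ) {M : ℝ} (hM : ∀ z, |g z| ≤ M) :
    BTend μ (fun _ => g) g where
  meas _ := hg
  bdd := ⟨M, fun _ => Eventually.of_forall hM⟩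
  tend := Eventually.of_forall fun _ => tendsto_const_nhds

lemma number (c : ℝ) : BTend μ (fun _ _ => c) (fun _ => c) :=
  const aestronglyMeasurable_const (M := |c|) fun _ => le_rfl

lemma const_mul (c : ℝ) (h : BTend μ Φ Φ₀) :
    BTend μ (fun n z => c * Φ n z) (fun z => c * Φ₀ z) :=
  (number c).mul h

lemma neg (h : BTend μ Φ Φ₀) : BTend μ (fun n z => - Φ n z) (fun z => - Φ₀ z) := by
  simpa using h.const_mul (-1)

lemma sub (h : BTend μ Φ Φ₀) (k : BTend μ Ψ Ψ₀) :
    BTend μ (fun n z => Φ n z - Ψ n z) (fun z => Φ₀ z - Ψ₀ z) := by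
  simpa [sub_eq_add_neg] using h.add k.neg

lemma sum {ι : Type*} {s : Finset ι} {F : ι → ℕ → α → ℝ} {F₀ : ι → α → ℝ}
    (h : ∀ i ∈ s, BTend μ (F i) (F₀ i)) :
    BTend μ (fun n z => ∑ i ∈ s, F i n z) (fun z => ∑ i ∈ s, F₀ i z) := by
  classical
  induction s using Finset.induction_on with
  | empty => simpa using number (μ := μ) 0
  | insert a s ha ih =>
    simp only [Finset.sum_insert ha]
    exact (h a (Finset.mem_insert_self a s)).add
      (ih fun i hi => h i (Finset.mem_insert_of_mem hi))

lemma congr (h : BTend μ Φ Φ₀) (hΨ : ∀ n, Φ n =ᵐ[μ] Ψ n) : BTend μ Ψ Φ₀ where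
  meas n := (h.meas n).congr (hΨ n)
  bdd := by
    obtain ⟨M, hM⟩ := h.bdd
    refine ⟨M, fun n => ?_⟩
    filter_upwards [hM n, hΨ n] with z h1 h2
    rwa [← h2]
  tend := by
    filter_upwards [h.tend, ae_all_iff.2 hΨ] with z h1 h2
    exact h1.congr h2

lemma comp {G : ℝ → ℝ} {a b : ℝ} (hab : a ≤ b) (hG : ContinuousOn G (Icc a b)) (h : BTend μ Φ Φ₀)
    (hmem : ∀ n z, Φ n z ∈ Icc a b) :
    BTend μ (fun n z => G (Φ n z)) (fun z => G (Φ₀ z)) where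
  meas n := by
    -- G is continuous only on the interval. Its constant extension beyond the endpoints is
    -- continuous everywhere, which gives measurability of the composition.
    have h1 : ∀ z, G (Φ n z) = IccExtend hab (Set.domRestrict (Icc a b) G) (Φ n z) := fun z => by
      rw [IccExtend_of_mem _ _ (hmem n z)]; rfl
    have h2 : Continuous (IccExtend hab (Set.domRestrict (Icc a b) G)) :=
      (continuousOn_iff_continuous_domRestrict.1 hG).Icc_extend'
    exact (h2.comp_aestronglyMeasurable (h.meas n)).congr
      (Eventually.of_forall fun z => (h1 z).symm)
  bdd := by
    obtain ⟨M, hM⟩ := isCompact_Icc.exists_bound_of_continuousOn hG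
    exact ⟨M, fun n => Eventually.of_forall fun z => hM _ (hmem n z)⟩
  tend := by
    filter_upwards [h.tend] with z hz
    have hmem0 : Φ₀ z ∈ Icc a b := isClosed_Icc.mem_of_tendsto hz
      (Eventually.of_forall fun n => hmem n z)
    have h1 : Tendsto (fun n => Φ n z) atTop (𝓝[Icc a b] (Φ₀ z)) :=
      tendsto_nhdsWithin_iff.2 ⟨hz, Eventually.of_forall fun n => hmem n z⟩
    exact (hG _ hmem0).tendsto.comp h1

lemma ae_bound (h : BTend μ Φ Φ₀) : ∃ M, ∀ᵐ z ∂μ, |Φ₀ z| ≤ M := by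
  obtain ⟨M, hM⟩ := h.bdd
  refine ⟨M, ?_⟩
  filter_upwards [h.tend, ae_all_iff.2 hM] with z h1 h2
  exact le_of_tendsto h1.abs (Eventually.of_forall h2)

lemma aestronglyMeasurable (h : BTend μ Φ Φ₀) : AEStronglyMeasurable Φ₀ μ :=
  aestronglyMeasurable_of_tendsto_ae atTop h.meas h.tend

lemma integrable_mul (h : BTend μ Φ Φ₀) {w : α → ℝ} (hw : Integrable w μ) :
    Integrable (fun z => w z * Φ₀ z) μ := by
  obtain ⟨M, hM⟩ := h.ae_bound
  exact hw.mul_bdd h.aestronglyMeasurable hM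

lemma integrable_mul_seq (h : BTend μ Φ Φ₀) {w : α → ℝ} (hw : Integrable w μ) (n : ℕ) :
    Integrable (fun z => w z * Φ n z) μ := by
  obtain ⟨M, hM⟩ := h.bdd
  exact hw.mul_bdd (h.meas n) (hM n)

/-- Dominated convergence with an integrable weight. Below, the weight is a field of the weak
solution and the sequence comes from the strong one. -/
lemma tendsto_integral (h : BTend μ Φ Φ₀) {w : α → ℝ} (hw : Integrable w μ) :
    Tendsto (fun n => ∫ z, w z * Φ n z ∂μ) atTop (𝓝 (∫ z, w z * Φ₀ z ∂μ)) := by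
  obtain ⟨M, hM⟩ := h.bdd
  refine tendsto_integral_of_dominated_convergence (fun z => |w z| * M)
    (fun n => (h.integrable_mul_seq hw n).aestronglyMeasurable) (hw.abs.mul_const M)
    (fun n => ?_) ?_
  · filter_upwards [hM n] with z hz
    rw [norm_mul, Real.norm_eq_abs, Real.norm_eq_abs]
    exact mul_le_mul_of_nonneg_left hz (abs_nonneg _)
  · filter_upwards [h.tend] with z hz using hz.const_mul _

end BTend

/-! ### Almost everywhere convergence of mollifications -/

/-- One subsequence serves all functions of a finite set: the sum of their errors tends to 0 in L¹,
hence in measure, hence almost everywhere along a subsequence. -/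
lemma exists_subseq_moll {ε T : ℝ} (hε : 0 < ε) {S : Set (ℝ → Torus d → ℝ)} (hS : S.Finite)
    (hint : ∀ g ∈ S, Integrable (Function.uncurry g) (dtdx d (Ioo 0 T))) :
    ∃ ns : ℕ → ℕ, ∀ g ∈ S, ∀ᵐ z ∂(dtdx d (Ioo 0 T)),
      Tendsto (fun n => moll T (bump ε (ns n)) g z.1 z.2) atTop (𝓝 (g z.1 z.2)) := by
  let D : ℕ → (ℝ → Torus d → ℝ) → ℝ × Torus d → ℝ := fun n g z =>
    moll T (bump ε n) g z.1 z.2 - g z.1 z.2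
  have hD : ∀ n, ∀ g ∈ S, Integrable (D n g) (dtdx d (Ioo 0 T)) := fun n g hg => by
    have h1 : Integrable (Function.uncurry (moll T (bump ε n) g)) (dtdx d (Ioo 0 T)) :=
      integrable_dtdx_of_continuousOn
        ((isKernel_bump hε n).pcd_moll (hint g hg)).continuous.continuousOn
    exact h1.sub (hint g hg)
  let F : ℕ → ℝ × Torus d → ℝ := fun n z => ∑ g ∈ hS.toFinset, |D n g z|
  have hF : ∀ n, Integrable (F n) (dtdx d (Ioo 0 T)) := fun n =>
    integrable_finsetSum _ fun g hg => (hD n g (hS.mem_toFinset.1 hg)).abs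
  have hlim : Tendsto (fun n => ∫ z, F n z ∂(dtdx d (Ioo 0 T))) atTop (𝓝 0) := by
    have h1 : ∀ n, ∫ z, F n z ∂(dtdx d (Ioo 0 T))
        = ∑ g ∈ hS.toFinset, ∫ z, |D n g z| ∂(dtdx d (Ioo 0 T)) := fun n =>
      integral_finsetSum _ fun g hg => (hD n g (hS.mem_toFinset.1 hg)).abs
    simp only [h1]
    have h2 : (0 : ℝ) = ∑ _g ∈ hS.toFinset, (0 : ℝ) := Finset.sum_const_zero.symm
    refine (tendsto_finsetSum hS.toFinset fun g hg =>
      tendsto_moll_L1 hε (hint g (hS.mem_toFinset.1 hg))).trans (le_of_eq (congrArg _ h2.symm))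
  have hnn : ∀ n z, 0 ≤ F n z := fun n z => Finset.sum_nonneg fun g _ => abs_nonneg _
  have hmeas : TendstoInMeasure (dtdx d (Ioo 0 T)) F atTop (fun _ => 0) := by
    refine tendstoInMeasure_of_tendsto_eLpNorm (p := 1) one_ne_zero
      (fun n => (hF n).aestronglyMeasurable) aestronglyMeasurable_const ?_
    have h2 : ∀ n, eLpNorm (F n - fun _ => 0) 1 (dtdx d (Ioo 0 T))
        = ENNReal.ofReal (∫ z, F n z ∂(dtdx d (Ioo 0 T))) := fun n => by
      rw [eLpNorm_one_eq_lintegral_enorm, ofReal_integral_eq_lintegral_ofReal (hF n)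
        (Eventually.of_forall (hnn n))]
      refine lintegral_congr fun z => ?_
      simp [Real.enorm_eq_ofReal (hnn n z)]
    simp only [h2]
    simpa using ENNReal.tendsto_ofReal hlim
  obtain ⟨ns, _, hns⟩ := hmeas.exists_seq_tendsto_ae
  refine ⟨ns, fun g hg => ?_⟩
  filter_upwards [hns] with z hz
  have h3 : Tendsto (fun n => D (ns n) g z) atTop (𝓝 0) := by
    refine squeeze_zero_norm (fun n => ?_) hz
    exact Finset.single_le_sum (f := fun g => |D (ns n) g z|) (fun g _ => abs_nonneg _)
      (hS.mem_toFinset.2 hg)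
  simpa [D] using h3.add_const (g z.1 z.2)

/-- The fundamental lemma of the calculus of variations on `(0,T) × 𝕋^d`. -/
lemma ae_eq_zero_of_forall_test {T : ℝ} {g : ℝ → Torus d → ℝ}
    (hg : Integrable (Function.uncurry g) (dtdx d (Ioo 0 T)))
    (h : ∀ ψ, IsTestSmooth T ψ → ∫ z, g z.1 z.2 * ψ z.1 z.2 ∂(dtdx d (Ioo 0 T)) = 0) :
    ∀ᵐ z ∂(dtdx d (Ioo 0 T)), g z.1 z.2 = 0 := by
  -- At an interior point the mollification is an integral of g against a test function, so it
  -- vanishes for every n, while it converges to g almost everywhere. Only countably many widths ε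
  -- are needed afterwards.
  have key : ∀ ε : ℝ, 0 < ε → ∀ᵐ z ∂(dtdx d (Ioo 0 T)), ε < z.1 → z.1 + ε < T → g z.1 z.2 = 0 := by
    intro ε hε
    obtain ⟨ns, hns⟩ := exists_subseq_moll hε (S := {g}) (finite_singleton g)
      (fun k hk => by rw [mem_singleton_iff.1 hk]; exact hg)
    filter_upwards [hns g rfl] with z hz h1 h2
    have h3 : ∀ n, moll T (bump ε (ns n)) g z.1 z.2 = 0 := fun n =>
      h _ ((isKernel_bump hε (ns n)).isTestSmooth_reflect h1 h2 z.2)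
    simp only [h3] at hz
    exact (tendsto_nhds_unique hz tendsto_const_nhds)
  have h1 := ae_all_iff.2 fun n : ℕ => key (1 / (n + 1 : ℝ)) Nat.one_div_pos_of_nat
  have h2 : ∀ᵐ z ∂(dtdx d (Ioo 0 T)), z ∈ (Ioo 0 T ×ˢ univ : Set (ℝ × Torus d)) := by
    rw [dtdx_eq]
    exact ae_restrict_mem (measurableSet_Ioo.prod MeasurableSet.univ)
  filter_upwards [h1, h2] with z h1 h2
  obtain ⟨n, hn⟩ := exists_nat_one_div_lt (lt_min h2.1.1 (sub_pos.2 h2.1.2))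
  exact h1 n (hn.trans_le (min_le_left _ _)) (by
    have := hn.trans_le (min_le_right _ _)
    linarith)

/-! ### Smooth approximations of a strong solution -/

/-- `(r n, v n)` are smooth approximations of the density and the velocity of `V` away from the
times `0` and `T`. -/
structure Approx (T ε δ R : ℝ) (V : StrongFields d) (r : ℕ → ℝ → Torus d → ℝ)
    (v : ℕ → Fin d → ℝ → Torus d → ℝ) : Prop where
  r_smooth : ∀ n, PCD ∞ (r n)
  v_smooth : ∀ n i, PCD ∞ (v n i)
  r_mem : ∀ n t x, r n t x ∈ Icc δ R
  lim_r : BTend (dtdx d (Ioo ε (T - ε))) (fun n z => r n z.1 z.2) (fun z => V.ρ z.1 z.2)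
  lim_dr : ∀ i, BTend (dtdx d (Ioo ε (T - ε))) (fun n z => pd i (r n z.1) z.2)
    (fun z => V.gradρ z.1 z.2 i)
  lim_ddr : ∀ i j, BTend (dtdx d (Ioo ε (T - ε))) (fun n z => pd j (pd i (r n z.1)) z.2)
    (fun z => V.ddρ i j z.1 z.2)
  lim_dddr : ∀ i j k, BTend (dtdx d (Ioo ε (T - ε)))
    (fun n z => pd k (pd j (pd i (r n z.1))) z.2) (fun z => V.dddρ i j k z.1 z.2)
  lim_dtr : BTend (dtdx d (Ioo ε (T - ε))) (fun n z => dt (r n) z.1 z.2)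
    (fun z => V.dtρ z.1 z.2)
  lim_dtdr : ∀ i, BTend (dtdx d (Ioo ε (T - ε))) (fun n z => dt (fun t => pd i (r n t)) z.1 z.2)
    (fun z => V.dtgradρ i z.1 z.2)
  lim_v : ∀ i, BTend (dtdx d (Ioo ε (T - ε))) (fun n z => v n i z.1 z.2)
    (fun z => V.u z.1 z.2 i)
  lim_dv : ∀ i j, BTend (dtdx d (Ioo ε (T - ε))) (fun n z => pd j (v n i z.1) z.2)
    (fun z => V.du i j z.1 z.2)
  lim_ddv : ∀ i j k, BTend (dtdx d (Ioo ε (T - ε))) (fun n z => pd k (pd j (v n i z.1)) z.2)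
    (fun z => V.ddu i j k z.1 z.2)
  lim_dtv : ∀ i, BTend (dtdx d (Ioo ε (T - ε))) (fun n z => dt (v n i) z.1 z.2)
    (fun z => V.dtu i z.1 z.2)

/-! ### Existence of smooth approximations. -/

section Existence

variable {F : ℝ → Vec d → ℝ} {T : ℝ} {V : StrongFields d}

/-- Needed because the density is mollified after its lower bound δ has been subtracted. -/
lemma HasWeakDx.sub_const {i : Fin d} {f g : ℝ → Torus d → ℝ} (h : HasWeakDx T i f g)
    (hf : Integrable (Function.uncurry f) (dtdx d (Ioo 0 T))) (c : ℝ) :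
    HasWeakDx T i (fun t x => f t x - c) g := by
  intro ψ hψ
  have hψ' : PCD ∞ ψ := hψ.contDiff
  have hc := (hψ'.pd_top i).continuous
  have hi : Integrable (fun z : ℝ × Torus d => pd i (ψ z.1) z.2) (dtdx d (Ioo 0 T)) :=
    integrable_dtdx_of_continuousOn hc.continuousOn
  obtain ⟨M, hM⟩ := (isCompact_Icc (a := (0 : ℝ)) (b := T)).prod (isCompact_univ (X := Torus d))
    |>.exists_bound_of_continuousOn hc.continuousOn
  have hi2 : Integrable (fun z : ℝ × Torus d => f z.1 z.2 * pd i (ψ z.1) z.2)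
      (dtdx d (Ioo 0 T)) := by
    refine Integrable.mul_bdd (c := M) hf hi.aestronglyMeasurable ?_
    rw [dtdx_eq]
    filter_upwards [ae_restrict_mem (measurableSet_Ioo.prod MeasurableSet.univ)] with z hz
    exact hM z ⟨Ioo_subset_Icc_self hz.1, mem_univ _⟩
  simp only [sub_mul]
  rw [integral_sub hi2 (hi.const_mul c), h ψ hψ, integral_const_mul,
    integral_dtdx_pd_eq_zero (hψ'.of_le (by simp)) i]
  simp

lemma IsTestSmooth.eq_zero_ends {ψ : ℝ → Torus d → ℝ} (hψ : IsTestSmooth T ψ) :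
    (∀ x, ψ 0 x = 0) ∧ ∀ x, ψ T x = 0 := by
  obtain ⟨a, b, ha, hb, h⟩ := hψ.compactSupport
  exact ⟨fun x => h 0 (fun h => by linarith [h.1]) x, fun x => h T (fun h => by linarith [h.2]) x⟩

lemma HasWeakDt.sub_const {f g : ℝ → Torus d → ℝ} (hT : 0 < T) (h : HasWeakDt T f g)
    (hf : Integrable (Function.uncurry f) (dtdx d (Ioo 0 T))) (c : ℝ) :
    HasWeakDt T (fun t x => f t x - c) g := by
  intro ψ hψ
  have hψ' : PCD ∞ ψ := hψ.contDiff
  have hc := hψ'.dt_top.continuous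
  have hi : Integrable (fun z : ℝ × Torus d => dt ψ z.1 z.2) (dtdx d (Ioo 0 T)) :=
    integrable_dtdx_of_continuousOn hc.continuousOn
  obtain ⟨M, hM⟩ := (isCompact_Icc (a := (0 : ℝ)) (b := T)).prod (isCompact_univ (X := Torus d))
    |>.exists_bound_of_continuousOn hc.continuousOn
  have hi2 : Integrable (fun z : ℝ × Torus d => f z.1 z.2 * dt ψ z.1 z.2)
      (dtdx d (Ioo 0 T)) := by
    refine Integrable.mul_bdd (c := M) hf hi.aestronglyMeasurable ?_
    rw [dtdx_eq]
    filter_upwards [ae_restrict_mem (measurableSet_Ioo.prod MeasurableSet.univ)] with z hz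
    exact hM z ⟨Ioo_subset_Icc_self hz.1, mem_univ _⟩
  simp only [sub_mul]
  rw [integral_sub hi2 (hi.const_mul c), h ψ hψ, integral_const_mul,
    integral_dtdx_dt_eq_zero (hψ'.of_le (by simp)) hT.le hψ.eq_zero_ends.1 hψ.eq_zero_ends.2]
  simp

lemma IsLinf.integrable {g : ℝ → Torus d → ℝ} (h : IsLinf T g) :
    Integrable (Function.uncurry g) (dtdx d (Ioo 0 T)) :=
  MemLp.integrable (q := ⊤) le_top h

lemma IsLinf.exists_bound {g : ℝ → Torus d → ℝ} (h : IsLinf T g) :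
    ∃ M, 0 ≤ M ∧ ∀ᵐ w ∂(dtdx d (Ioo 0 T)), |g w.1 w.2| ≤ M := by
  refine ⟨(eLpNorm (Function.uncurry g) ⊤ (dtdx d (Ioo 0 T))).toReal, ENNReal.toReal_nonneg, ?_⟩
  rw [eLpNorm_exponent_top]
  have hfin : eLpNormEssSup (Function.uncurry g) (dtdx d (Ioo 0 T)) ≠ ⊤ := by
    rw [← eLpNorm_exponent_top]; exact h.2.ne
  filter_upwards [ae_le_eLpNormEssSup (f := Function.uncurry g) (μ := dtdx d (Ioo 0 T))] with w hw
  rw [← Real.norm_eq_abs, ← toReal_enorm]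
  exact ENNReal.toReal_mono hfin hw

lemma isLinf_of_continuousOn {g : ℝ → Torus d → ℝ}
    (hg : ContinuousOn (Function.uncurry g) (Icc 0 T ×ˢ univ)) : IsLinf T g := by
  obtain ⟨M, hM⟩ := (isCompact_Icc (a := (0 : ℝ)) (b := T)).prod (isCompact_univ (X := Torus d))
    |>.exists_bound_of_continuousOn hg
  refine memLp_top_of_bound (integrable_dtdx_of_continuousOn hg).aestronglyMeasurable M ?_
  rw [dtdx_eq]
  filter_upwards [ae_restrict_mem (measurableSet_Ioo.prod MeasurableSet.univ)] with z hz
  exact hM z ⟨Ioo_subset_Icc_self hz.1, mem_univ _⟩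

lemma dtdx_inner_le {ε : ℝ} (hε : 0 < ε) :
    dtdx d (Ioo ε (T - ε)) ≤ dtdx d (Ioo 0 T) :=
  dtdx_mono (Ioo_subset_Ioo hε.le (by linarith))

lemma ae_inner {ε : ℝ} : ∀ᵐ z ∂(dtdx d (Ioo ε (T - ε))), ε < z.1 ∧ z.1 + ε < T := by
  rw [dtdx_eq]
  filter_upwards [ae_restrict_mem (measurableSet_Ioo.prod MeasurableSet.univ)] with z hz
  exact ⟨hz.1.1, by linarith [hz.1.2]⟩

lemma bTend_moll {ε : ℝ} (hε : 0 < ε) {ns : ℕ → ℕ} {g : ℝ → Torus d → ℝ} (hg : IsLinf T g)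
    (h : ∀ᵐ z ∂(dtdx d (Ioo 0 T)),
      Tendsto (fun n => moll T (bump ε (ns n)) g z.1 z.2) atTop (𝓝 (g z.1 z.2))) :
    BTend (dtdx d (Ioo ε (T - ε))) (fun n z => moll T (bump ε (ns n)) g z.1 z.2)
      (fun z => g z.1 z.2) where
  meas n := ((isKernel_bump hε (ns n)).pcd_moll hg.integrable).continuous.aestronglyMeasurable
  bdd := by
    obtain ⟨M, hM0, hM⟩ := hg.exists_bound
    exact ⟨M, fun n => Eventually.of_forall fun z => abs_moll_le hε (ns n) hM hM0 z.1 z.2⟩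
  tend := ae_mono (dtdx_inner_le hε) h

/-- On (ε, T - ε) the derivatives of a mollification are mollifications of the weak derivatives.
They inherit the essential bounds and converge almost everywhere along one subsequence common to all
fields. -/
lemma exists_approx {ε δ R : ℝ} (hT : 0 < T) (hV : HypStrong F T V) (hε : 0 < ε)
    (hmem : ∀ t ∈ Icc 0 T, ∀ x, V.ρ t x ∈ Icc δ R) :
    ∃ r v, Approx T ε δ R V r v := by
  have lρ : IsLinf T V.ρ := isLinf_of_continuousOn hV.cont_ρ
  have lρ' : IsLinf T (fun t x => V.ρ t x - δ) :=
    isLinf_of_continuousOn (hV.cont_ρ.sub continuousOn_const)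
  have lu : ∀ i, IsLinf T (fun t x => V.u t x i) := fun i =>
    isLinf_of_continuousOn (((EuclideanSpace.proj (𝕜 := ℝ) i).continuous).comp_continuousOn
      hV.cont_u)
  have lg : ∀ i, IsLinf T (fun t x => V.gradρ t x i) := fun i =>
    isLinf_of_continuousOn (((EuclideanSpace.proj (𝕜 := ℝ) i).continuous).comp_continuousOn
      hV.cont_gradρ)
  let S : Set (ℝ → Torus d → ℝ) :=
    {fun t x => V.ρ t x - δ} ∪ range (fun i t x => V.gradρ t x i)
    ∪ range (fun p : Fin d × Fin d => V.ddρ p.1 p.2)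
    ∪ range (fun p : Fin d × Fin d × Fin d => V.dddρ p.1 p.2.1 p.2.2)
    ∪ {V.dtρ} ∪ range V.dtgradρ ∪ range (fun i t x => V.u t x i)
    ∪ range (fun p : Fin d × Fin d => V.du p.1 p.2)
    ∪ range (fun p : Fin d × Fin d × Fin d => V.ddu p.1 p.2.1 p.2.2) ∪ range V.dtu
  have hfin : S.Finite := by
    simp only [S]
    refine Set.Finite.union (Set.Finite.union (Set.Finite.union (Set.Finite.union (Set.Finite.union
      (Set.Finite.union (Set.Finite.union (Set.Finite.union (Set.Finite.union ?_ ?_) ?_) ?_) ?_) ?_)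
      ?_) ?_) ?_) ?_ <;> first | exact finite_singleton _ | exact finite_range _
  have hlinf : ∀ g ∈ S, IsLinf T g := by
    intro g hg
    simp only [S, mem_union, mem_singleton_iff, mem_range] at hg
    rcases hg with (((((((((rfl | ⟨i, rfl⟩) | ⟨p, rfl⟩) | ⟨p, rfl⟩) | rfl) | ⟨i, rfl⟩) | ⟨i, rfl⟩)
      | ⟨p, rfl⟩) | ⟨p, rfl⟩) | ⟨i, rfl⟩)
    · exact lρ'
    · exact lg i
    · exact hV.linf_ddρ _ _
    · exact hV.linf_dddρ _ _ _
    · exact hV.linf_dtρ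
    · exact hV.linf_dtgradρ i
    · exact lu i
    · exact hV.linf_du _ _
    · exact hV.linf_ddu _ _ _
    · exact hV.linf_dtu i
  obtain ⟨ns, hns⟩ := exists_subseq_moll hε hfin fun g hg => (hlinf g hg).integrable
  have B : ∀ g ∈ S, BTend (dtdx d (Ioo ε (T - ε)))
      (fun n z => moll T (bump ε (ns n)) g z.1 z.2) (fun z => g z.1 z.2) :=
    fun g hg => bTend_moll hε (hlinf g hg) (hns g hg)
  have K := fun n => isKernel_bump (d := d) hε (ns n)
  -- Mollifying ρ̄ - δ ≥ 0 and adding δ back keeps r in [δ,R] at all times, although the kernel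
  -- loses mass near the ends. Mollifying ρ̄ itself could drop below δ, where functions of the
  -- density need not be defined smoothly.
  let r : ℕ → ℝ → Torus d → ℝ := fun n t x => δ + moll T (bump ε (ns n)) (fun t x => V.ρ t x - δ) t x
  let v : ℕ → Fin d → ℝ → Torus d → ℝ := fun n i => moll T (bump ε (ns n)) (fun t x => V.u t x i)
  have hm0 : ∀ n, PCD ∞ (moll T (bump ε (ns n)) (fun t x => V.ρ t x - δ)) := fun n =>
    (K n).pcd_moll lρ'.integrable
  have hr : ∀ n, PCD ∞ (r n) := fun n => (PCD.const δ).add (hm0 n)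
  have hv : ∀ n i, PCD ∞ (v n i) := fun n i => (K n).pcd_moll (lu i).integrable
  have e1 : ∀ n t, ε < t → t + ε < T → ∀ i x,
      pd i (r n t) x = moll T (bump ε (ns n)) (fun t x => V.gradρ t x i) t x := by
    intro n t h1 h2 i x
    simp only [r]
    rw [pd_add (PCD.const δ) (hm0 n) (by simp), pd_const, zero_add,
      (K n).pd_moll_weak lρ'.integrable ((hV.gradρ i).sub_const lρ.integrable δ) h1 h2]
  have e2 : ∀ n t, ε < t → t + ε < T → ∀ i j x,
      pd j (pd i (r n t)) x = moll T (bump ε (ns n)) (V.ddρ i j) t x := by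
    intro n t h1 h2 i j x
    rw [show pd i (r n t) = moll T (bump ε (ns n)) (fun t x => V.gradρ t x i) t from
      funext (e1 n t h1 h2 i), (K n).pd_moll_weak (lg i).integrable (hV.ddρ i j) h1 h2]
  have e3 : ∀ n t, ε < t → t + ε < T → ∀ i j k x,
      pd k (pd j (pd i (r n t))) x = moll T (bump ε (ns n)) (V.dddρ i j k) t x := by
    intro n t h1 h2 i j k x
    rw [show pd j (pd i (r n t)) = moll T (bump ε (ns n)) (V.ddρ i j) t from
      funext (e2 n t h1 h2 i j),
      (K n).pd_moll_weak (hV.linf_ddρ i j).integrable (hV.dddρ i j k) h1 h2]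
  have e4 : ∀ n t, ε < t → t + ε < T → ∀ x, dt (r n) t x = moll T (bump ε (ns n)) V.dtρ t x := by
    intro n t h1 h2 x
    simp only [r]
    rw [dt_add (PCD.const δ) (hm0 n) (by simp),
      (K n).dt_moll_weak lρ'.integrable (hV.dtρ.sub_const hT lρ.integrable δ) h1 h2]
    simp [dt]
  have e5 : ∀ n t, ε < t → t + ε < T → ∀ i x,
      dt (fun t => pd i (r n t)) t x = moll T (bump ε (ns n)) (V.dtgradρ i) t x := by
    intro n t h1 h2 i x
    rw [← (K n).dt_moll_weak (lg i).integrable (hV.dtgradρ i) h1 h2]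
    -- The formula for the gradient holds at interior times only; a neighbourhood of t consists of
    -- such times, which is enough for the time derivative.
    refine Filter.EventuallyEq.deriv_eq ?_
    filter_upwards [lt_mem_nhds h1, gt_mem_nhds (show t < T - ε by linarith)] with s hs1 hs2
    exact e1 n s hs1 (by linarith) i x
  have e6 : ∀ n t, ε < t → t + ε < T → ∀ i j x,
      pd j (v n i t) x = moll T (bump ε (ns n)) (V.du i j) t x := fun n t h1 h2 i j x =>
    (K n).pd_moll_weak (lu i).integrable (hV.du i j) h1 h2 x
  have e7 : ∀ n t, ε < t → t + ε < T → ∀ i j k x,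
      pd k (pd j (v n i t)) x = moll T (bump ε (ns n)) (V.ddu i j k) t x := by
    intro n t h1 h2 i j k x
    rw [show pd j (v n i t) = moll T (bump ε (ns n)) (V.du i j) t from
      funext (e6 n t h1 h2 i j),
      (K n).pd_moll_weak (hV.linf_du i j).integrable (hV.ddu i j k) h1 h2]
  have e8 : ∀ n t, ε < t → t + ε < T → ∀ i x,
      dt (v n i) t x = moll T (bump ε (ns n)) (V.dtu i) t x := fun n t h1 h2 i x =>
    (K n).dt_moll_weak (lu i).integrable (hV.dtu i) h1 h2 x
  have hlow : ∀ᵐ w ∂(dtdx d (Ioo 0 T)), 0 ≤ V.ρ w.1 w.2 - δ ∧ |V.ρ w.1 w.2 - δ| ≤ R - δ := by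
    rw [dtdx_eq]
    filter_upwards [ae_restrict_mem (measurableSet_Ioo.prod MeasurableSet.univ)] with z hz
    obtain ⟨h1, h2⟩ := hmem z.1 (Ioo_subset_Icc_self hz.1) z.2
    exact ⟨by linarith, by rw [abs_of_nonneg (by linarith)]; linarith⟩
  have hδR : δ ≤ R := by
    obtain ⟨h1, h2⟩ := hmem 0 ⟨le_rfl, hT.le⟩ 0
    linarith
  refine ⟨r, v, hr, hv, fun n t x => ⟨?_, ?_⟩, ?_, fun i => ?_, fun i j => ?_, fun i j k => ?_, ?_,
    fun i => ?_, fun i => ?_, fun i j => ?_, fun i j k => ?_, fun i => ?_⟩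
  · simp only [r]
    linarith [moll_nonneg (ε := ε) (ns n) (g := fun t x => V.ρ t x - δ) (hlow.mono fun _ h => h.1) t x]
  · simp only [r]
    have := abs_moll_le hε (ns n) (g := fun t x => V.ρ t x - δ) (hlow.mono fun _ h => h.2)
      (sub_nonneg.2 hδR) t x
    linarith [(abs_le.1 this).2]
  · simpa [r] using (BTend.number δ).add (B (fun t x => V.ρ t x - δ) (by simp [S]))
  · exact (B (fun t x => V.gradρ t x i) (by simp [S])).congr fun n =>
      ae_inner.mono fun z hz => (e1 n z.1 hz.1 hz.2 i z.2).symm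
  · exact (B (V.ddρ i j) (by simp [S])).congr fun n =>
      ae_inner.mono fun z hz => (e2 n z.1 hz.1 hz.2 i j z.2).symm
  · exact (B (V.dddρ i j k) (by simp [S])).congr fun n =>
      ae_inner.mono fun z hz => (e3 n z.1 hz.1 hz.2 i j k z.2).symm
  · exact (B V.dtρ (by simp [S])).congr fun n =>
      ae_inner.mono fun z hz => (e4 n z.1 hz.1 hz.2 z.2).symm
  · exact (B (V.dtgradρ i) (by simp [S])).congr fun n =>
      ae_inner.mono fun z hz => (e5 n z.1 hz.1 hz.2 i z.2).symm
  · exact B (fun t x => V.u t x i) (by simp [S])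
  · exact (B (V.du i j) (by simp [S])).congr fun n =>
      ae_inner.mono fun z hz => (e6 n z.1 hz.1 hz.2 i j z.2).symm
  · exact (B (V.ddu i j k) (by simp [S])).congr fun n =>
      ae_inner.mono fun z hz => (e7 n z.1 hz.1 hz.2 i j k z.2).symm
  · exact (B (V.dtu i) (by simp [S])).congr fun n =>
      ae_inner.mono fun z hz => (e8 n z.1 hz.1 hz.2 i z.2).symm

end Existence

/-! ### Passing to the limit in integral identities -/

/-- Convergence of integrals, with integrability. -/
structure ITend {α : Type*} [MeasurableSpace α] (μ : Measure α) (G : ℕ → α → ℝ) (G₀ : α → ℝ) :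
    Prop where
  integrable_seq : ∀ n, Integrable (G n) μ
  integrable : Integrable G₀ μ
  tendsto : Tendsto (fun n => ∫ z, G n z ∂μ) atTop (𝓝 (∫ z, G₀ z ∂μ))

section ITend

variable {α : Type*} [MeasurableSpace α] {μ : Measure α} {Φ G H : ℕ → α → ℝ} {Φ₀ G₀ H₀ : α → ℝ}

lemma BTend.iTend (h : BTend μ Φ Φ₀) {w : α → ℝ} (hw : Integrable w μ) :
    ITend μ (fun n z => w z * Φ n z) (fun z => w z * Φ₀ z) :=
  ⟨h.integrable_mul_seq hw, h.integrable_mul hw, h.tendsto_integral hw⟩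

lemma BTend.iTend_self [IsFiniteMeasure μ] (h : BTend μ Φ Φ₀) : ITend μ Φ Φ₀ := by
  simpa using h.iTend (integrable_const 1)

namespace ITend

lemma add (h : ITend μ G G₀) (k : ITend μ H H₀) :
    ITend μ (fun n z => G n z + H n z) (fun z => G₀ z + H₀ z) where
  integrable_seq n := (h.integrable_seq n).add (k.integrable_seq n)
  integrable := h.integrable.add k.integrable
  tendsto := by
    rw [integral_add h.integrable k.integrable]
    refine (h.tendsto.add k.tendsto).congr fun n => ?_
    rw [integral_add (h.integrable_seq n) (k.integrable_seq n)]

lemma neg (h : ITend μ G G₀) : ITend μ (fun n z => - G n z) (fun z => - G₀ z) where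
  integrable_seq n := (h.integrable_seq n).neg
  integrable := h.integrable.neg
  tendsto := by
    rw [integral_neg]
    refine h.tendsto.neg.congr fun n => ?_
    rw [integral_neg]

lemma sub (h : ITend μ G G₀) (k : ITend μ H H₀) :
    ITend μ (fun n z => G n z - H n z) (fun z => G₀ z - H₀ z) := by
  simpa [sub_eq_add_neg] using h.add k.neg

lemma sum {ι : Type*} {s : Finset ι} {F : ι → ℕ → α → ℝ} {F₀ : ι → α → ℝ}
    (h : ∀ i ∈ s, ITend μ (F i) (F₀ i)) :
    ITend μ (fun n z => ∑ i ∈ s, F i n z) (fun z => ∑ i ∈ s, F₀ i z) where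
  integrable_seq n := integrable_finsetSum _ fun i hi => (h i hi).integrable_seq n
  integrable := integrable_finsetSum _ fun i hi => (h i hi).integrable
  tendsto := by
    rw [integral_finsetSum _ fun i hi => (h i hi).integrable]
    refine (tendsto_finsetSum s fun i hi => (h i hi).tendsto).congr fun n => ?_
    rw [integral_finsetSum _ fun i hi => (h i hi).integrable_seq n]

lemma eq_zero (h : ITend μ G G₀) (h0 : ∀ n, ∫ z, G n z ∂μ = 0) : ∫ z, G₀ z ∂μ = 0 := by
  have := h.tendsto
  simp only [h0] at this
  exact tendsto_nhds_unique this tendsto_const_nhds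

end ITend

end ITend

/-! ### Time cutoffs -/

/-- Smooth functions of time supported in a compact subset of `(ε, T - ε)`. -/
structure TimeCutoff (T ε : ℝ) (θ : ℝ → ℝ) : Prop where
  smooth : ContDiff ℝ ∞ θ
  support : ∃ a b : ℝ, ε < a ∧ b < T - ε ∧ ∀ t, t ∉ Icc a b → θ t = 0

namespace TimeCutoff

variable {T ε : ℝ} {θ : ℝ → ℝ}

lemma eq_zero (h : TimeCutoff T ε θ) {t : ℝ} (ht : t ∉ Ioo ε (T - ε)) : θ t = 0 := by
  obtain ⟨a, b, ha, hb, h⟩ := h.support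
  exact h t fun hh => ht ⟨ha.trans_le hh.1, hh.2.trans_lt hb⟩

lemma deriv (h : TimeCutoff T ε θ) : TimeCutoff T ε (deriv θ) where
  smooth := ((contDiff_infty_iff_deriv (𝕜 := ℝ)).1 h.smooth).2
  support := by
    obtain ⟨a, b, ha, hb, h⟩ := h.support
    refine ⟨a, b, ha, hb, fun t ht => ?_⟩
    have h1 : ∀ᶠ s in 𝓝 t, s ∉ Icc a b := isClosed_Icc.isOpen_compl.mem_nhds ht
    have h2 : θ =ᶠ[𝓝 t] fun _ => 0 := h1.mono fun s hs => h s hs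
    simpa using h2.deriv_eq

lemma exists_bound (h : TimeCutoff T ε θ) : ∃ M, ∀ t, |θ t| ≤ M := by
  obtain ⟨a, b, _, _, hs⟩ := h.support
  obtain ⟨M, hM⟩ := (isCompact_Icc (a := a) (b := b)).exists_bound_of_continuousOn
    h.smooth.continuous.continuousOn
  refine ⟨max M 0, fun t => ?_⟩
  by_cases ht : t ∈ Icc a b
  · exact (hM t ht).trans (le_max_left _ _)
  · rw [hs t ht]; simp

lemma bTend (h : TimeCutoff T ε θ) (μ : Measure (ℝ × Torus d)) :
    BTend μ (fun _ z => θ z.1) (fun z => θ z.1) := by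
  obtain ⟨M, hM⟩ := h.exists_bound
  exact BTend.const (g := fun z : ℝ × Torus d => θ z.1)
    (h.smooth.continuous.comp continuous_fst).aestronglyMeasurable fun z => hM z.1

lemma differentiable (h : TimeCutoff T ε θ) : Differentiable ℝ θ :=
  h.smooth.differentiable (by simp)

lemma isTestSmooth (h : TimeCutoff T ε θ) (hε : 0 < ε) {f : ℝ → Torus d → ℝ} (hf : PCD ∞ f) :
    IsTestSmooth T (fun t x => θ t * f t x) where
  contDiff := (PCD.time h.smooth).mul hf
  compactSupport := by
    obtain ⟨a, b, ha, hb, h⟩ := h.support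
    exact ⟨a, b, hε.trans ha, by linarith, fun t ht x => by rw [h t ht, zero_mul]⟩

lemma isTestC1 (h : TimeCutoff T ε θ) (hε : 0 < ε) {f : ℝ → Torus d → ℝ} (hf : PCD 2 f) :
    IsTestC1 (fun t x => θ t * f t x) :=
  PCD.isTestC1 ((PCD.time (by exact_mod_cast contDiff_infty.1 h.smooth 2)).mul hf)
    ⟨T, fun t ht x => by rw [h.eq_zero (fun hh => by linarith [hh.2]), zero_mul]⟩

lemma pd_mul (θ : ℝ → ℝ) {f : ℝ → Torus d → ℝ} (hf : PCD 1 f) (i : Fin d) (t : ℝ) (x : Torus d) :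
    pd i (fun x => θ t * f t x) x = θ t * pd i (f t) x :=
  pd_const_mul hf le_rfl (θ t) i t x

end TimeCutoff

lemma integral_dtdx_eq_of_support {I J : Set ℝ} (hJI : J ⊆ I) (hI : MeasurableSet I)
    {f : ℝ × Torus d → ℝ} (hf : ∀ z : ℝ × Torus d, z.1 ∉ J → f z = 0) :
    ∫ z, f z ∂(dtdx d I) = ∫ z, f z ∂(dtdx d J) := by
  rw [dtdx_eq, dtdx_eq]
  refine (setIntegral_eq_of_subset_of_forall_sdiff_eq_zero (hI.prod MeasurableSet.univ)
    (prod_mono hJI le_rfl) fun z hz => hf z fun h => hz.2 ⟨h, mem_univ _⟩)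

/-! ### Continuous curves in `L^1` -/

lemma IsContL1.continuousOn_integral_abs {f : ℝ → Torus d → ℝ} (hf : IsContL1 f) :
    ContinuousOn (fun t => ∫ x, |f t x| ∂(dx d)) (Ici 0) := by
  intro t ht
  refine tendsto_iff_norm_sub_tendsto_zero.2 ?_
  refine squeeze_zero' (Eventually.of_forall fun s => norm_nonneg _) ?_ (hf.continuous t ht)
  filter_upwards [self_mem_nhdsWithin] with s hs
  have h1 := hf.integrable s hs
  have h2 := hf.integrable t ht
  rw [← integral_sub h1.abs h2.abs]
  refine (norm_integral_le_integral_norm _).trans ?_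
  exact integral_mono (h1.abs.sub h2.abs).norm (h1.sub h2).abs fun x => abs_abs_sub_abs_le _ _

lemma IsContL1.continuousOn_integral {f : ℝ → Torus d → ℝ} (hf : IsContL1 f) :
    ContinuousOn (fun t => ∫ x, f t x ∂(dx d)) (Ici 0) := by
  intro t ht
  refine tendsto_iff_norm_sub_tendsto_zero.2 ?_
  refine squeeze_zero' (Eventually.of_forall fun s => norm_nonneg _) ?_ (hf.continuous t ht)
  filter_upwards [self_mem_nhdsWithin] with s hs
  have h1 := hf.integrable s hs
  have h2 := hf.integrable t ht
  rw [← integral_sub h1 h2]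
  exact norm_integral_le_integral_norm _

/-- The L¹ norm is continuous in time, hence integrable on [0,T], and Tonelli applies. -/
lemma IsContL1.integrable_dtdx {f : ℝ → Torus d → ℝ} (hf : IsContL1 f) (T : ℝ) :
    Integrable (Function.uncurry f) (dtdx d (Ioo 0 T)) := by
  have hm : AEStronglyMeasurable (Function.uncurry f) (dtdx d (Ioo 0 T)) :=
    hf.measurable.mono_measure (dtdx_mono fun t ht => ht.1.le)
  unfold dtdx at hm ⊢
  rw [integrable_prod_iff hm]
  constructor
  · filter_upwards [ae_restrict_mem measurableSet_Ioo] with t ht using hf.integrable t ht.1.le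
  · have h1 : ContinuousOn (fun t => ∫ x, |f t x| ∂(dx d)) (Icc 0 T) :=
      hf.continuousOn_integral_abs.mono fun t ht => ht.1
    exact (h1.integrableOn_compact isCompact_Icc).mono_set Ioo_subset_Icc_self

/-! ### Weak identities for limits of smooth test functions -/

section WeakLimits

variable {F : ℝ → Vec d → ℝ} {W : WeakFields d} {T ε : ℝ} {θ : ℝ → ℝ}

lemma integrable_inner {f : ℝ × Torus d → ℝ} (hε : 0 < ε)
    (hf : Integrable f (dtdx d (Ioo 0 T))) : Integrable f (dtdx d (Ioo ε (T - ε))) :=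
  hf.mono_measure (dtdx_inner_le hε)

lemma IsLocL1.integrable_inner {f : ℝ → Torus d → ℝ} (hε : 0 < ε) (hf : IsLocL1 f) :
    Integrable (Function.uncurry f) (dtdx d (Ioo ε (T - ε))) :=
  (hf T).mono_measure (dtdx_mono fun t ht => ⟨hε.le.trans ht.1.le, by linarith [ht.2]⟩)

lemma inner_subset_Ioi (hε : 0 < ε) : Ioo ε (T - ε) ⊆ Ioi 0 := fun _ ht => hε.trans ht.1

lemma IsWeakSolution.mass_smooth (hW : IsWeakSolution F W) (hε : 0 < ε) (hθ : TimeCutoff T ε θ)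
    {f : ℝ → Torus d → ℝ} (hf : PCD 2 f) :
    ∫ z, (W.ρ z.1 z.2 * (deriv θ z.1 * f z.1 z.2 + θ z.1 * dt f z.1 z.2)
      + ∑ j, W.m z.1 z.2 j * (θ z.1 * pd j (f z.1) z.2)) ∂(dtdx d (Ioo ε (T - ε))) = 0 := by
  have h := hW.mass _ (hθ.isTestC1 hε hf)
  have h1 : PCD 1 f := hf.of_le (by norm_num)
  simp only [dt_time_mul hθ.differentiable h1 le_rfl, TimeCutoff.pd_mul θ h1,
    hθ.eq_zero (t := 0) (fun hh => by linarith [hh.1]), zero_mul, mul_zero, integral_zero,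
    neg_eq_zero] at h
  rw [← h]
  refine (integral_dtdx_eq_of_support (inner_subset_Ioi hε) measurableSet_Ioi fun z hz => ?_).symm
  simp [hθ.eq_zero hz, hθ.deriv.eq_zero hz]

/-- Extends the continuity equation to test functions that are bounded a.e. limits, together with
their first derivatives. Quantities built from the strong solution are of this kind. -/
lemma IsWeakSolution.mass_limit (hW : IsWeakSolution F W) (hε : 0 < ε) (hθ : TimeCutoff T ε θ)
    {f : ℕ → ℝ → Torus d → ℝ} (hf : ∀ n, PCD 2 (f n)) {f₀ f₁ : ℝ × Torus d → ℝ}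
    {f₂ : Fin d → ℝ × Torus d → ℝ}
    (h0 : BTend (dtdx d (Ioo ε (T - ε))) (fun n z => f n z.1 z.2) f₀)
    (h1 : BTend (dtdx d (Ioo ε (T - ε))) (fun n z => dt (f n) z.1 z.2) f₁)
    (h2 : ∀ j, BTend (dtdx d (Ioo ε (T - ε))) (fun n z => pd j (f n z.1) z.2) (f₂ j)) :
    Integrable (fun z => W.ρ z.1 z.2 * (deriv θ z.1 * f₀ z + θ z.1 * f₁ z)
      + ∑ j, W.m z.1 z.2 j * (θ z.1 * f₂ j z)) (dtdx d (Ioo ε (T - ε))) ∧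
    ∫ z, (W.ρ z.1 z.2 * (deriv θ z.1 * f₀ z + θ z.1 * f₁ z)
      + ∑ j, W.m z.1 z.2 j * (θ z.1 * f₂ j z)) ∂(dtdx d (Ioo ε (T - ε))) = 0 := by
  have key := ITend.add
    ((((hθ.deriv.bTend _).mul h0).add ((hθ.bTend _).mul h1)).iTend
      (w := fun z => W.ρ z.1 z.2) (integrable_inner hε (hW.cont_ρ.integrable_dtdx T)))
    (ITend.sum (s := Finset.univ) fun j _ => ((hθ.bTend _).mul (h2 j)).iTend
      (w := fun z => W.m z.1 z.2 j) (integrable_inner hε ((hW.cont_m j).integrable_dtdx T)))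
  exact ⟨key.integrable, key.eq_zero fun n => hW.mass_smooth hε hθ (hf n)⟩

lemma IsWeakSolution.momentum_limit (hW : IsWeakSolution F W) (hε : 0 < ε)
    (hθ : TimeCutoff T ε θ)
    {v : ℕ → Fin d → ℝ → Torus d → ℝ} (hv : ∀ n i, PCD 2 (v n i))
    {v₀ v₁ : Fin d → ℝ × Torus d → ℝ} {v₂ : Fin d → Fin d → ℝ × Torus d → ℝ}
    (h0 : ∀ i, BTend (dtdx d (Ioo ε (T - ε))) (fun n z => v n i z.1 z.2) (v₀ i))
    (h1 : ∀ i, BTend (dtdx d (Ioo ε (T - ε))) (fun n z => dt (v n i) z.1 z.2) (v₁ i))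
    (h2 : ∀ i j, BTend (dtdx d (Ioo ε (T - ε))) (fun n z => pd j (v n i z.1) z.2) (v₂ i j)) :
    Integrable (fun z => ((∑ i, W.m z.1 z.2 i * (deriv θ z.1 * v₀ i z + θ z.1 * v₁ i z))
          + (∑ i, ∑ j, W.m z.1 z.2 i * W.m z.1 z.2 j / W.ρ z.1 z.2 * (θ z.1 * v₂ i j z)))
          - ∑ i, ∑ j, W.S F i j z.1 z.2 * (θ z.1 * v₂ i j z)) (dtdx d (Ioo ε (T - ε))) ∧
    ∫ z, (((∑ i, W.m z.1 z.2 i * (deriv θ z.1 * v₀ i z + θ z.1 * v₁ i z))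
          + (∑ i, ∑ j, W.m z.1 z.2 i * W.m z.1 z.2 j / W.ρ z.1 z.2 * (θ z.1 * v₂ i j z)))
          - ∑ i, ∑ j, W.S F i j z.1 z.2 * (θ z.1 * v₂ i j z))
        ∂(dtdx d (Ioo ε (T - ε))) = 0 := by
  have key := ITend.sub (ITend.add
    (ITend.sum (s := Finset.univ) fun i _ =>
      (((hθ.deriv.bTend _).mul (h0 i)).add ((hθ.bTend _).mul (h1 i))).iTend
      (w := fun z => W.m z.1 z.2 i) (integrable_inner hε ((hW.cont_m i).integrable_dtdx T)))
    (ITend.sum (s := Finset.univ) fun i _ => ITend.sum (s := Finset.univ) fun j _ =>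
      ((hθ.bTend _).mul (h2 i j)).iTend
      (w := fun z => W.m z.1 z.2 i * W.m z.1 z.2 j / W.ρ z.1 z.2)
      ((hW.loc_flux i j).integrable_inner hε)))
    (ITend.sum (s := Finset.univ) fun i _ => ITend.sum (s := Finset.univ) fun j _ =>
      ((hθ.bTend _).mul (h2 i j)).iTend
      (w := fun z => W.S F i j z.1 z.2) ((hW.loc_stress i j).integrable_inner hε))
  refine ⟨key.integrable, key.eq_zero fun n => ?_⟩
  have h := hW.momentum (fun i t x => θ t * v n i t x) fun i => hθ.isTestC1 hε (hv n i)
  have h1 : ∀ i, PCD 1 (v n i) := fun i => (hv n i).of_le (by norm_num)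
  simp only [dt_time_mul hθ.differentiable (h1 _) le_rfl, TimeCutoff.pd_mul θ (h1 _),
    hθ.eq_zero (t := 0) (fun hh => by linarith [hh.1]), zero_mul, mul_zero,
    Finset.sum_const_zero, integral_zero, neg_eq_zero] at h
  rw [← h]
  refine (integral_dtdx_eq_of_support (inner_subset_Ioi hε) measurableSet_Ioi fun z hz => ?_).symm
  simp [hθ.eq_zero hz, hθ.deriv.eq_zero hz]

/-- The weak gradient is given separately at each time; the identity on each slice, with the field
frozen there, is integrated in time. -/
lemma IsWeakSolution.grad_smooth (hW : IsWeakSolution F W) (hε : 0 < ε)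
    (hq : ∀ i, Integrable (fun z : ℝ × Torus d => W.gradρ z.1 z.2 i) (dtdx d (Ioo ε (T - ε))))
    (hθ : TimeCutoff T ε θ) {g : Fin d → ℝ → Torus d → ℝ} (hg : ∀ i, PCD ∞ (g i)) :
    ∫ z, (W.ρ z.1 z.2 * (θ z.1 * ∑ i, pd i (g i z.1) z.2)
      + ∑ i, W.gradρ z.1 z.2 i * (θ z.1 * g i z.1 z.2)) ∂(dtdx d (Ioo ε (T - ε))) = 0 := by
  have hbd : ∀ {f : ℝ → Torus d → ℝ}, PCD ∞ f →
      BTend (dtdx d (Ioo ε (T - ε))) (fun _ z => θ z.1 * f z.1 z.2)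
        (fun z => θ z.1 * f z.1 z.2) := by
    intro f hf
    obtain ⟨a, b, _, _, hs⟩ := hθ.support
    have hc : Continuous fun z : ℝ × Torus d => θ z.1 * f z.1 z.2 :=
      ((PCD.time hθ.smooth).mul hf).continuous
    obtain ⟨M, hM⟩ := (isCompact_Icc (a := a) (b := b)).prod (isCompact_univ (X := Torus d))
      |>.exists_bound_of_continuousOn hc.continuousOn
    refine BTend.const hc.aestronglyMeasurable (M := max M 0) fun z => ?_
    by_cases hz : z.1 ∈ Icc a b
    · exact (hM z ⟨hz, mem_univ _⟩).trans (le_max_left _ _)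
    · rw [hs _ hz]; simp
  have hint : Integrable (fun z : ℝ × Torus d => W.ρ z.1 z.2 * (θ z.1 * ∑ i, pd i (g i z.1) z.2)
      + ∑ i, W.gradρ z.1 z.2 i * (θ z.1 * g i z.1 z.2)) (dtdx d (Ioo ε (T - ε))) := by
    refine Integrable.add ?_ (integrable_finsetSum _ fun i _ => (hbd (hg i)).integrable_mul (hq i))
    exact (hbd (PCD.sum fun i _ => (hg i).pd_top i)).integrable_mul
      (integrable_inner hε (hW.cont_ρ.integrable_dtdx T))
  unfold dtdx at hint ⊢
  rw [integral_prod _ hint]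
  have : ∀ t ∈ Ioo ε (T - ε), ∫ x, (W.ρ t x * (θ t * ∑ i, pd i (g i t) x)
      + ∑ i, W.gradρ t x i * (θ t * g i t x)) ∂(dx d) = 0 := by
    intro t ht
    have hgr := hW.grad t (hε.le.trans ht.1.le)
    have hb : ∀ {k : Torus d → ℝ}, Continuous k → ∀ {w : Torus d → ℝ}, Integrable w (dx d) →
        Integrable (fun x => w x * k x) (dx d) := by
      intro k hk w hw
      obtain ⟨M, hM⟩ := isCompact_univ.exists_bound_of_continuousOn hk.continuousOn
      exact hw.mul_bdd hk.aestronglyMeasurable (Eventually.of_forall fun x => hM x (mem_univ _))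
    have e1 : ∀ x, W.ρ t x * (θ t * ∑ i, pd i (g i t) x) + ∑ i, W.gradρ t x i * (θ t * g i t x)
        = θ t * ∑ i, (W.ρ t x * pd i (g i t) x + W.gradρ t x i * g i t x) := by
      intro x
      rw [Finset.sum_add_distrib, mul_add, Finset.mul_sum, Finset.mul_sum, Finset.mul_sum,
        Finset.mul_sum]
      congr 1 <;> refine Finset.sum_congr rfl fun i _ => by ring
    simp only [e1]
    have i1 := fun i => hb (((hg i).pd_top i).continuous_slice t) hgr.integrable
    have i2 := fun i => hb ((hg i).continuous_slice t) (hgr.integrable_grad i)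
    rw [integral_const_mul, integral_finsetSum (f := fun i x => W.ρ t x * pd i (g i t) x
      + W.gradρ t x i * g i t x) _ fun i _ => (i1 i).add (i2 i)]
    refine mul_eq_zero_of_right _ (Finset.sum_eq_zero fun i _ => ?_)
    rw [integral_add (i1 i) (i2 i), hgr.eq i (g i t) ((hg i).slice t)]
    ring
  exact (setIntegral_congr_fun measurableSet_Ioo this).trans (by simp)

lemma IsWeakSolution.grad_limit (hW : IsWeakSolution F W) (hε : 0 < ε)
    (hq : ∀ i, Integrable (fun z : ℝ × Torus d => W.gradρ z.1 z.2 i) (dtdx d (Ioo ε (T - ε))))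
    (hθ : TimeCutoff T ε θ) {g : ℕ → Fin d → ℝ → Torus d → ℝ} (hg : ∀ n i, PCD ∞ (g n i))
    {g₀ : Fin d → ℝ × Torus d → ℝ} {g₁ : ℝ × Torus d → ℝ}
    (h0 : ∀ i, BTend (dtdx d (Ioo ε (T - ε))) (fun n z => g n i z.1 z.2) (g₀ i))
    (h1 : BTend (dtdx d (Ioo ε (T - ε))) (fun n z => ∑ i, pd i (g n i z.1) z.2) g₁) :
    Integrable (fun z => W.ρ z.1 z.2 * (θ z.1 * g₁ z)
      + ∑ i, W.gradρ z.1 z.2 i * (θ z.1 * g₀ i z)) (dtdx d (Ioo ε (T - ε))) ∧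
    ∫ z, (W.ρ z.1 z.2 * (θ z.1 * g₁ z)
      + ∑ i, W.gradρ z.1 z.2 i * (θ z.1 * g₀ i z)) ∂(dtdx d (Ioo ε (T - ε))) = 0 := by
  have key := ITend.add
    (((hθ.bTend _).mul h1).iTend
      (w := fun z => W.ρ z.1 z.2) (integrable_inner hε (hW.cont_ρ.integrable_dtdx T)))
    (ITend.sum (s := Finset.univ) fun j _ => ((hθ.bTend _).mul (h0 j)).iTend
      (w := fun z => W.gradρ z.1 z.2 j) (hq j))
  exact ⟨key.integrable, key.eq_zero fun n => hW.grad_smooth hε hq hθ (hg n)⟩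

lemma IsWeakSolution.div_limit (hW : IsWeakSolution F W) (hε : 0 < ε) (hT : 0 < T)
    (hθ : TimeCutoff T ε θ) {f : ℕ → ℝ → Torus d → ℝ} (hf : ∀ n, PCD ∞ (f n))
    {f₀ : ℝ × Torus d → ℝ} {f₂ : Fin d → ℝ × Torus d → ℝ}
    (h0 : BTend (dtdx d (Ioo ε (T - ε))) (fun n z => f n z.1 z.2) f₀)
    (h2 : ∀ j, BTend (dtdx d (Ioo ε (T - ε))) (fun n z => pd j (f n z.1) z.2) (f₂ j)) :
    Integrable (fun z => W.divr z.1 z.2 * (θ z.1 * f₀ z)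
      + ∑ i, W.r F z.1 z.2 i * (θ z.1 * f₂ i z)) (dtdx d (Ioo ε (T - ε))) ∧
    ∫ z, (W.divr z.1 z.2 * (θ z.1 * f₀ z)
      + ∑ i, W.r F z.1 z.2 i * (θ z.1 * f₂ i z)) ∂(dtdx d (Ioo ε (T - ε))) = 0 := by
  have key1 := ((hθ.bTend _).mul h0).iTend
      (w := fun z => W.divr z.1 z.2) (hW.loc_divr.integrable_inner hε)
  have key2 := ITend.sum (s := Finset.univ) fun j _ => ((hθ.bTend _).mul (h2 j)).iTend
      (w := fun z => W.r F z.1 z.2 j) ((hW.loc_r j).integrable_inner hε)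
  refine ⟨(key1.add key2).integrable, (key1.add key2).eq_zero fun n => ?_⟩
  rw [integral_add (key1.integrable_seq n) (key2.integrable_seq n)]
  have h := hW.divr T hT _ (hθ.isTestSmooth hε (hf n))
  have h1 : PCD 1 (f n) := (hf n).of_le (by simp)
  simp only [TimeCutoff.pd_mul θ h1] at h
  have hsub : Ioo ε (T - ε) ⊆ Ioo 0 T := Ioo_subset_Ioo hε.le (by linarith)
  rw [integral_dtdx_eq_of_support hsub measurableSet_Ioo (fun z hz => by simp [hθ.eq_zero hz]),
    integral_dtdx_eq_of_support hsub measurableSet_Ioo (fun z hz => by simp [hθ.eq_zero hz])] at h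
  rw [h]
  ring

end WeakLimits

/-- The transport identity for limits of smooth fields. -/
lemma transport_limit {T ε : ℝ} {θ : ℝ → ℝ} (hεT : ε ≤ T - ε) (hθ : TimeCutoff T ε θ)
    {P : ℕ → ℝ → Torus d → ℝ} {v : ℕ → Fin d → ℝ → Torus d → ℝ}
    (hP : ∀ n, PCD 1 (P n)) (hv : ∀ n i, PCD 1 (v n i)) {P₀ P₁ : ℝ × Torus d → ℝ}
    {P₂ v₀ : Fin d → ℝ × Torus d → ℝ} {v₂ : Fin d → ℝ × Torus d → ℝ}
    (h0 : BTend (dtdx d (Ioo ε (T - ε))) (fun n z => P n z.1 z.2) P₀)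
    (h1 : BTend (dtdx d (Ioo ε (T - ε))) (fun n z => dt (P n) z.1 z.2) P₁)
    (h2 : ∀ i, BTend (dtdx d (Ioo ε (T - ε))) (fun n z => pd i (P n z.1) z.2) (P₂ i))
    (k0 : ∀ i, BTend (dtdx d (Ioo ε (T - ε))) (fun n z => v n i z.1 z.2) (v₀ i))
    (k2 : ∀ i, BTend (dtdx d (Ioo ε (T - ε))) (fun n z => pd i (v n i z.1) z.2) (v₂ i)) :
    Integrable (fun z => deriv θ z.1 * P₀ z
      + θ z.1 * (P₁ z + ∑ i, (P₂ i z * v₀ i z + P₀ z * v₂ i z))) (dtdx d (Ioo ε (T - ε))) ∧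
    ∫ z, (deriv θ z.1 * P₀ z + θ z.1 * (P₁ z + ∑ i, (P₂ i z * v₀ i z + P₀ z * v₂ i z)))
      ∂(dtdx d (Ioo ε (T - ε))) = 0 := by
  have key := (((hθ.deriv.bTend _).mul h0).add ((hθ.bTend _).mul (h1.add
    (BTend.sum (s := Finset.univ) fun i _ =>
      ((h2 i).mul (k0 i)).add (h0.mul (k2 i)))))).iTend_self
  refine ⟨key.integrable, key.eq_zero fun n => ?_⟩
  have hθ1 : PCD 1 (fun t (_ : Torus d) => θ t) :=
    PCD.time (hθ.smooth.of_le (by exact_mod_cast le_top))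
  have e : ∀ z : ℝ × Torus d, deriv θ z.1 * P n z.1 z.2 + θ z.1 * (dt (P n) z.1 z.2
      + ∑ i, (pd i (P n z.1) z.2 * v n i z.1 z.2 + P n z.1 z.2 * pd i (v n i z.1) z.2))
      = dt (fun t x => θ t * P n t x) z.1 z.2
        + ∑ i, pd i (fun x => θ z.1 * (P n z.1 x * v n i z.1 x)) z.2 := by
    intro z
    rw [dt_time_mul hθ.differentiable (hP n) le_rfl, mul_add, Finset.mul_sum, add_assoc]
    congr 2
    refine Finset.sum_congr rfl fun i _ => ?_
    rw [TimeCutoff.pd_mul θ ((hP n).mul (hv n i)), pd_mul (hP n) (hv n i) le_rfl]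
  simp only [e]
  have hθP : PCD 1 (fun t x => θ t * P n t x) := hθ1.mul (hP n)
  have hθPv : ∀ i, PCD 1 (fun t x => θ t * (P n t x * v n i t x)) := fun i =>
    hθ1.mul ((hP n).mul (hv n i))
  have i1 : Integrable (fun z : ℝ × Torus d => dt (fun t x => θ t * P n t x) z.1 z.2)
      (dtdx d (Ioo ε (T - ε))) :=
    integrable_dtdx_of_continuousOn (hθP.dt (m := 0) (by norm_num)).continuous.continuousOn
  have i2 : ∀ i, Integrable (fun z : ℝ × Torus d =>
      pd i (fun x => θ z.1 * (P n z.1 x * v n i z.1 x)) z.2) (dtdx d (Ioo ε (T - ε))) := fun i =>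
    integrable_dtdx_of_continuousOn ((hθPv i).pd (m := 0) (by norm_num) i).continuous.continuousOn
  rw [integral_add i1 (integrable_finsetSum _ fun i _ => i2 i),
    integral_dtdx_dt_eq_zero hθP hεT
      (fun x => by rw [hθ.eq_zero (fun h => lt_irrefl _ h.1), zero_mul])
      (fun x => by rw [hθ.eq_zero (fun h => lt_irrefl _ h.2), zero_mul]),
    integral_finsetSum _ fun i _ => i2 i]
  rw [zero_add]
  exact Finset.sum_eq_zero fun i _ => integral_dtdx_pd_eq_zero (hθPv i) i _ _

/-! ### Integral identities between a weak and a strong solution -/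

/-- `G` is integrable and has integral zero. -/
def ZeroInt {α : Type*} [MeasurableSpace α] (μ : Measure α) (G : α → ℝ) : Prop :=
  Integrable G μ ∧ ∫ z, G z ∂μ = 0

namespace ZeroInt

variable {α : Type*} [MeasurableSpace α] {μ : Measure α} {G H : α → ℝ}

lemma add (h : ZeroInt μ G) (k : ZeroInt μ H) : ZeroInt μ (fun z => G z + H z) :=
  ⟨h.1.add k.1, by rw [integral_add h.1 k.1, h.2, k.2, add_zero]⟩

lemma sub (h : ZeroInt μ G) (k : ZeroInt μ H) : ZeroInt μ (fun z => G z - H z) :=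
  ⟨h.1.sub k.1, by rw [integral_sub h.1 k.1, h.2, k.2, sub_zero]⟩

lemma const_mul (c : ℝ) (h : ZeroInt μ G) : ZeroInt μ (fun z => c * G z) :=
  ⟨h.1.const_mul c, by rw [integral_const_mul, h.2, mul_zero]⟩

end ZeroInt

lemma PCD.two {f : ℝ → Torus d → ℝ} (hf : PCD ∞ f) : PCD 2 f := by
  exact_mod_cast contDiff_infty.1 hf 2

lemma PCD.one {f : ℝ → Torus d → ℝ} (hf : PCD ∞ f) : PCD 1 f := hf.of_le (by simp)

section Identities

variable {T ε δ R : ℝ} {V : StrongFields d} {r : ℕ → ℝ → Torus d → ℝ}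
  {v : ℕ → Fin d → ℝ → Torus d → ℝ}

namespace Approx

section Composition

variable {G : ℝ → ℝ}

lemma delta_le (A : Approx T ε δ R V r v) : δ ≤ R := (A.r_mem 0 0 0).1.trans (A.r_mem 0 0 0).2

lemma pcd_comp (A : Approx T ε δ R V r v) (hδ : 0 < δ) (hG : ContDiffOn ℝ 2 G (Ioi 0)) (n : ℕ) :
    PCD 2 (fun t x => G (r n t x)) :=
  PCD.comp hG isOpen_Ioi (A.r_smooth n).two fun t x => hδ.trans_le (A.r_mem n t x).1

lemma differentiableAt (A : Approx T ε δ R V r v) (hδ : 0 < δ) (hG : ContDiffOn ℝ 2 G (Ioi 0))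
    (n : ℕ) (t : ℝ) (x : Torus d) : DifferentiableAt ℝ G (r n t x) :=
  (hG.differentiableOn (by norm_num)).differentiableAt
    (isOpen_Ioi.mem_nhds (hδ.trans_le (A.r_mem n t x).1))

lemma lim_comp (A : Approx T ε δ R V r v) (hδ : 0 < δ) (hG : ContinuousOn G (Ioi 0)) :
    BTend (dtdx d (Ioo ε (T - ε))) (fun n z => G (r n z.1 z.2)) (fun z => G (V.ρ z.1 z.2)) :=
  BTend.comp A.delta_le (hG.mono fun _ h => hδ.trans_le h.1) A.lim_r fun n z => A.r_mem n z.1 z.2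

lemma continuousOn_deriv (hG : ContDiffOn ℝ 2 G (Ioi 0)) : ContinuousOn (deriv G) (Ioi 0) :=
  hG.continuousOn_deriv_of_isOpen isOpen_Ioi (by norm_num)

lemma lim_pd_comp (A : Approx T ε δ R V r v) (hδ : 0 < δ) (hG : ContDiffOn ℝ 2 G (Ioi 0))
    (i : Fin d) :
    BTend (dtdx d (Ioo ε (T - ε))) (fun n z => pd i (fun x => G (r n z.1 x)) z.2)
      (fun z => deriv G (V.ρ z.1 z.2) * V.gradρ z.1 z.2 i) :=
  ((A.lim_comp hδ (continuousOn_deriv hG)).mul (A.lim_dr i)).congr fun n =>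
    Eventually.of_forall fun z =>
      (pd_comp (A.r_smooth n) (by simp) i z.1 z.2 (A.differentiableAt hδ hG n z.1 z.2)).symm

lemma lim_dt_comp (A : Approx T ε δ R V r v) (hδ : 0 < δ) (hG : ContDiffOn ℝ 2 G (Ioi 0)) :
    BTend (dtdx d (Ioo ε (T - ε))) (fun n z => dt (fun t x => G (r n t x)) z.1 z.2)
      (fun z => deriv G (V.ρ z.1 z.2) * V.dtρ z.1 z.2) :=
  ((A.lim_comp hδ (continuousOn_deriv hG)).mul A.lim_dtr).congr fun n =>
    Eventually.of_forall fun z =>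
      (dt_comp (A.r_smooth n) (by simp) z.1 z.2 (A.differentiableAt hδ hG n z.1 z.2)).symm

end Composition

section Weak

variable {F : ℝ → Vec d → ℝ} {W : WeakFields d} {θ : ℝ → ℝ}

/-- The continuity equation tested with θ ½|ū|². -/
lemma kinetic_identity (A : Approx T ε δ R V r v) (hW : IsWeakSolution F W) (hε : 0 < ε)
    (hθ : TimeCutoff T ε θ) :
    ZeroInt (dtdx d (Ioo ε (T - ε))) (fun z => W.ρ z.1 z.2 *
      (deriv θ z.1 * (1 / 2 * ∑ i, V.u z.1 z.2 i * V.u z.1 z.2 i)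
        + θ z.1 * ∑ i, V.u z.1 z.2 i * V.dtu i z.1 z.2)
      + ∑ j, W.m z.1 z.2 j * (θ z.1 * ∑ i, V.u z.1 z.2 i * V.du i j z.1 z.2)) := by
  have hv1 : ∀ n i, PCD 1 (v n i) := fun n i => (A.v_smooth n i).one
  have hvv : ∀ n i, PCD 1 (fun t x => v n i t x * v n i t x) := fun n i =>
    (hv1 n i).mul (hv1 n i)
  refine hW.mass_limit hε hθ (f := fun n t x => 1 / 2 * ∑ i, v n i t x * v n i t x)
    (fun n => PCD.const_mul _ (PCD.sum fun i _ => (A.v_smooth n i).two.mul (A.v_smooth n i).two))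
    (BTend.const_mul _ (BTend.sum fun i _ => (A.lim_v i).mul (A.lim_v i))) ?_ fun j => ?_
  · refine (BTend.sum (s := Finset.univ) fun i _ => (A.lim_v i).mul (A.lim_dtv i)).congr fun n =>
      Eventually.of_forall fun z => ?_
    simp only
    rw [dt_const_mul (PCD.sum fun i _ => hvv n i) le_rfl, dt_sum (fun i _ => hvv n i) le_rfl,
      Finset.mul_sum]
    refine Finset.sum_congr rfl fun i _ => ?_
    rw [dt_mul (hv1 n i) (hv1 n i) le_rfl]
    ring
  · refine (BTend.sum (s := Finset.univ) fun i _ => (A.lim_v i).mul (A.lim_dv i j)).congr fun n =>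
      Eventually.of_forall fun z => ?_
    simp only
    rw [pd_const_mul (PCD.sum fun i _ => hvv n i) le_rfl, pd_sum (fun i _ => hvv n i) le_rfl,
      Finset.mul_sum]
    refine Finset.sum_congr rfl fun i _ => ?_
    rw [pd_mul (hv1 n i) (hv1 n i) le_rfl]
    ring

/-- The continuity equation tested with θ G(ρ̄); the case that matters is G = h'. -/
lemma enthalpy_identity (A : Approx T ε δ R V r v) (hW : IsWeakSolution F W) (hε : 0 < ε)
    (hδ : 0 < δ) (hθ : TimeCutoff T ε θ) {G : ℝ → ℝ} (hG : ContDiffOn ℝ 2 G (Ioi 0)) :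
    ZeroInt (dtdx d (Ioo ε (T - ε))) (fun z => W.ρ z.1 z.2 *
      (deriv θ z.1 * G (V.ρ z.1 z.2) + θ z.1 * (deriv G (V.ρ z.1 z.2) * V.dtρ z.1 z.2))
      + ∑ j, W.m z.1 z.2 j * (θ z.1 * (deriv G (V.ρ z.1 z.2) * V.gradρ z.1 z.2 j))) :=
  hW.mass_limit hε hθ (A.pcd_comp hδ hG) (A.lim_comp hδ hG.continuousOn) (A.lim_dt_comp hδ hG)
    (A.lim_pd_comp hδ hG)

/-- The continuity equation tested with θ Δρ̄. As ∂_t Δρ̄ is not among the bounded derivatives, the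
terms with ρ are first rewritten, for smooth approximations, by the weak gradient of ρ. The limit
then involves only ∂_t ∂_k ρ̄ and third spatial derivatives. -/
lemma laplacian_identity (A : Approx T ε δ R V r v) (hW : IsWeakSolution F W) (hε : 0 < ε)
    (hq : ∀ i, Integrable (fun z : ℝ × Torus d => W.gradρ z.1 z.2 i) (dtdx d (Ioo ε (T - ε))))
    (hθ : TimeCutoff T ε θ) :
    ZeroInt (dtdx d (Ioo ε (T - ε))) (fun z =>
      ∑ j, W.m z.1 z.2 j * (θ z.1 * ∑ k, V.dddρ k k j z.1 z.2)
      - (∑ k, W.gradρ z.1 z.2 k * (deriv θ z.1 * V.gradρ z.1 z.2 k)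
        + ∑ k, W.gradρ z.1 z.2 k * (θ z.1 * V.dtgradρ k z.1 z.2))) := by
  have hs := fun n k => (A.r_smooth n).pd_top k
  have hss := fun n k => (hs n k).pd_top k
  have key := ITend.sub
    (ITend.sum (s := Finset.univ) fun j _ => ((hθ.bTend _).mul
      (BTend.sum (s := Finset.univ) fun k _ => A.lim_dddr k k j)).iTend
      (w := fun z => W.m z.1 z.2 j) (integrable_inner hε ((hW.cont_m j).integrable_dtdx T)))
    (ITend.add
      (ITend.sum (s := Finset.univ) fun k _ => ((hθ.deriv.bTend _).mul (A.lim_dr k)).iTend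
        (w := fun z => W.gradρ z.1 z.2 k) (hq k))
      (ITend.sum (s := Finset.univ) fun k _ => ((hθ.bTend _).mul (A.lim_dtdr k)).iTend
        (w := fun z => W.gradρ z.1 z.2 k) (hq k)))
  refine ⟨key.integrable, key.eq_zero fun n => ?_⟩
  have hL : PCD ∞ (fun t x => ∑ k, pd k (pd k (r n t)) x) := PCD.sum fun k _ => hss n k
  have e1 := hW.mass_smooth hε hθ hL.two
  have e2 := hW.grad_smooth hε hq hθ.deriv (g := fun k t => pd k (r n t)) (hs n)
  have e3 := hW.grad_smooth hε hq hθ (g := fun k => dt (fun t => pd k (r n t)))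
    fun k => (hs n k).dt_top
  have hdtL : ∀ z : ℝ × Torus d, dt (fun t x => ∑ k, pd k (pd k (r n t)) x) z.1 z.2
      = ∑ k, pd k (dt (fun t => pd k (r n t)) z.1) z.2 := by
    intro z
    rw [dt_sum (F := fun k t => pd k (pd k (r n t))) (fun k _ => hss n k) (by simp)]
    exact Finset.sum_congr rfl fun k _ => (pd_dt_comm (hs n k).two le_rfl k z.1 z.2).symm
  have hpdL : ∀ z : ℝ × Torus d, ∀ j, pd j (fun x => ∑ k, pd k (pd k (r n z.1)) x) z.2
      = ∑ k, pd j (pd k (pd k (r n z.1))) z.2 := fun z j =>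
    pd_sum (F := fun k t => pd k (pd k (r n t))) (fun k _ => hss n k) (by simp) j z.1 z.2
  simp only [hdtL, hpdL] at e1
  have hb : ∀ {f : ℝ → Torus d → ℝ}, PCD ∞ f →
      BTend (dtdx d (Ioo ε (T - ε))) (fun _ z => f z.1 z.2) (fun z => f z.1 z.2) := by
    intro f hf
    obtain ⟨M, hM⟩ := (isCompact_Icc (a := ε) (b := T - ε)).prod (isCompact_univ (X := Torus d))
      |>.exists_bound_of_continuousOn hf.continuous.continuousOn
    refine ⟨fun _ => hf.continuous.aestronglyMeasurable, ⟨M, fun _ => ?_⟩,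
      Eventually.of_forall fun _ => tendsto_const_nhds⟩
    rw [dtdx_eq]
    filter_upwards [ae_restrict_mem (measurableSet_Ioo.prod MeasurableSet.univ)] with z hz
    exact hM z ⟨Ioo_subset_Icc_self hz.1, mem_univ _⟩
  have iρ := integrable_inner (ε := ε) hε (hW.cont_ρ.integrable_dtdx T)
  have iρ1 := ((hθ.deriv.bTend _).mul (hb hL)).integrable_mul iρ
  have iρ2 := ((hθ.bTend _).mul (hb (PCD.sum (s := Finset.univ) fun k _ =>
    ((hs n k).dt_top).pd_top k))).integrable_mul iρ
  have im := integrable_finsetSum Finset.univ fun j _ => ((hθ.bTend _).mul (hb (PCD.sum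
    (s := Finset.univ) fun k _ => (hss n k).pd_top j))).integrable_mul
    (integrable_inner hε ((hW.cont_m j).integrable_dtdx T))
  have iq1 := integrable_finsetSum Finset.univ fun k _ => ((hθ.deriv.bTend _).mul
    (hb (hs n k))).integrable_mul (hq k)
  have iq2 := integrable_finsetSum Finset.univ fun k _ => ((hθ.bTend _).mul
    (hb (hs n k).dt_top)).integrable_mul (hq k)
  simp only [Function.uncurry] at iρ1 iρ2 im
  simp only [mul_add] at e1
  -- The two integrals containing ρ in the continuity equation are those in `e2` and `e3`;
  -- eliminating them leaves only m and ∇ρ.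
  have e1' := (integral_add (iρ1.add iρ2) im).symm.trans e1
  have e1'' := integral_add iρ1 iρ2
  have e2' := (integral_add iρ1 iq1).symm.trans e2
  have e3' := (integral_add iρ2 iq2).symm.trans e3
  have e4 := integral_sub im (iq1.add iq2)
  have e5 := integral_add iq1 iq2
  refine e4.trans ?_
  simp only [Pi.add_apply] at e1' e1'' e2' e3' e4 e5 ⊢
  linarith

/-- The momentum equation tested with θ ū. -/
lemma velocity_identity (A : Approx T ε δ R V r v) (hW : IsWeakSolution F W) (hε : 0 < ε)
    (hθ : TimeCutoff T ε θ) :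
    ZeroInt (dtdx d (Ioo ε (T - ε))) (fun z =>
      ((∑ i, W.m z.1 z.2 i * (deriv θ z.1 * V.u z.1 z.2 i + θ z.1 * V.dtu i z.1 z.2))
          + (∑ i, ∑ j, W.m z.1 z.2 i * W.m z.1 z.2 j / W.ρ z.1 z.2 * (θ z.1 * V.du i j z.1 z.2)))
          - ∑ i, ∑ j, W.S F i j z.1 z.2 * (θ z.1 * V.du i j z.1 z.2)) :=
  hW.momentum_limit hε hθ (fun n i => (A.v_smooth n i).two) A.lim_v A.lim_dtv A.lim_dv

/-- The weak gradient is tested with the field g_i = Σ_j (∂_i∂_jρ̄ ū_j - ∂_jρ̄ ∂_jū_i). In its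
divergence the products of ∂²ρ̄ with ∂ū cancel by symmetry of the Hessian. The identity serves to
remove ρ ū · ∇Δρ̄, which the equation for ∂_t ū introduces. -/
lemma gradient_identity (A : Approx T ε δ R V r v) (hW : IsWeakSolution F W) (hε : 0 < ε)
    (hq : ∀ i, Integrable (fun z : ℝ × Torus d => W.gradρ z.1 z.2 i) (dtdx d (Ioo ε (T - ε))))
    (hθ : TimeCutoff T ε θ) :
    ZeroInt (dtdx d (Ioo ε (T - ε))) (fun z =>
      W.ρ z.1 z.2 * (θ z.1 * ∑ i, ∑ j, (V.dddρ i i j z.1 z.2 * V.u z.1 z.2 j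
        - V.gradρ z.1 z.2 j * V.ddu i i j z.1 z.2))
      + ∑ i, W.gradρ z.1 z.2 i * (θ z.1 * ∑ j, (V.ddρ j i z.1 z.2 * V.u z.1 z.2 j
        - V.gradρ z.1 z.2 j * V.du i j z.1 z.2))) := by
  have s1 := fun n j => (A.r_smooth n).pd_top j
  have s2 := fun n i j => (s1 n j).pd_top i
  have s3 := fun n i j => (A.v_smooth n i).pd_top j
  have t1 : ∀ n i j, PCD ∞ (fun t x => pd i (pd j (r n t)) x * v n j t x) := fun n i j =>
    (s2 n i j).mul (A.v_smooth n j)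
  have t2 : ∀ n i j, PCD ∞ (fun t x => pd j (r n t) x * pd j (v n i t) x) := fun n i j =>
    (s1 n j).mul (s3 n i j)
  have t3 : ∀ n i j, PCD ∞ (fun t x => pd i (pd j (r n t)) x * v n j t x
      - pd j (r n t) x * pd j (v n i t) x) := fun n i j => (t1 n i j).sub (t2 n i j)
  refine hW.grad_limit hε hq hθ (g := fun n i t x => ∑ j, (pd i (pd j (r n t)) x * v n j t x
      - pd j (r n t) x * pd j (v n i t) x)) (fun n i => PCD.sum fun j _ => t3 n i j)
    (fun i => BTend.sum fun j _ => ((A.lim_ddr j i).mul (A.lim_v j)).sub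
      ((A.lim_dr j).mul (A.lim_dv i j))) ?_
  refine (BTend.sum (s := Finset.univ) fun i _ => BTend.sum (s := Finset.univ) fun j _ =>
    ((A.lim_dddr i i j).mul (A.lim_v j)).sub ((A.lim_dr j).mul (A.lim_ddv i i j))).congr fun n =>
      Eventually.of_forall fun z => ?_
  simp only
  have c1 : ∀ i j, pd i (pd i (pd j (r n z.1))) z.2 = pd j (pd i (pd i (r n z.1))) z.2 := by
    intro i j
    rw [show pd i (pd j (r n z.1)) = pd j (pd i (r n z.1)) from
      funext fun x => pd_comm (A.r_smooth n).two le_rfl i j z.1 x]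
    exact pd_comm (s1 n i).two le_rfl i j z.1 z.2
  have e : ∀ i, pd i (fun x => ∑ j, (pd i (pd j (r n z.1)) x * v n j z.1 x
      - pd j (r n z.1) x * pd j (v n i z.1) x)) z.2 = ∑ j, ((pd j (pd i (pd i (r n z.1))) z.2
      * v n j z.1 z.2 + pd i (pd j (r n z.1)) z.2 * pd i (v n j z.1) z.2)
      - (pd i (pd j (r n z.1)) z.2 * pd j (v n i z.1) z.2
        + pd j (r n z.1) z.2 * pd j (pd i (v n i z.1)) z.2)) := by
    intro i
    rw [pd_sum (fun j _ => t3 n i j) (by simp) i z.1 z.2]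
    refine Finset.sum_congr rfl fun j _ => ?_
    rw [pd_sub (t1 n i j) (t2 n i j) (by simp), pd_mul (s2 n i j) (A.v_smooth n j) (by simp),
      pd_mul (s1 n j) (s3 n i j) (by simp), c1,
      pd_comm (A.v_smooth n i).two le_rfl i j z.1 z.2]
  simp only [e]
  have c3 : ∑ i, ∑ j, pd i (pd j (r n z.1)) z.2 * pd i (v n j z.1) z.2
      = ∑ i, ∑ j, pd i (pd j (r n z.1)) z.2 * pd j (v n i z.1) z.2 := by
    rw [Finset.sum_comm]
    refine Finset.sum_congr rfl fun i _ => Finset.sum_congr rfl fun j _ => ?_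
    rw [pd_comm (A.r_smooth n).two le_rfl j i z.1 z.2]
  simp only [Finset.sum_sub_distrib, Finset.sum_add_distrib, c3]
  ring

/-- Testing with θ div ū trades the divergence of ρ F_q, about which only integrability is known,
for ρ F_q · ∇ div ū. -/
lemma divergence_identity (A : Approx T ε δ R V r v) (hW : IsWeakSolution F W) (hε : 0 < ε)
    (hT : 0 < T) (hθ : TimeCutoff T ε θ) :
    ZeroInt (dtdx d (Ioo ε (T - ε))) (fun z =>
      W.divr z.1 z.2 * (θ z.1 * ∑ j, V.du j j z.1 z.2)
      + ∑ i, W.r F z.1 z.2 i * (θ z.1 * ∑ j, V.ddu j j i z.1 z.2)) := by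
  refine hW.div_limit hε hT hθ (f := fun n t x => ∑ j, pd j (v n j t) x)
    (fun n => PCD.sum fun j _ => (A.v_smooth n j).pd_top j)
    (BTend.sum fun j _ => A.lim_dv j j) fun i => ?_
  refine (BTend.sum (s := Finset.univ) fun j _ => A.lim_ddv j j i).congr fun n =>
      Eventually.of_forall fun z => ?_
  exact (pd_sum (F := fun j t => pd j (v n j t)) (fun j _ => (A.v_smooth n j).pd_top j)
    (by simp) i z.1 z.2).symm

end Weak

/-- The field P = G(ρ̄) + c|∇ρ̄|² is carried along ū: ∂_t(θP) + div(θPū) has integral zero. With G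
the pressure and c = Cκ/2 it accounts for the part of the relative energy free of weak fields; with
G = id and c = 0 it yields conservation of mass. -/
lemma pressure_identity (A : Approx T ε δ R V r v) (hεT : ε ≤ T - ε) (hδ : 0 < δ) {θ : ℝ → ℝ}
    (hθ : TimeCutoff T ε θ) {G : ℝ → ℝ} (hG : ContDiffOn ℝ 2 G (Ioi 0)) (c : ℝ) :
    ZeroInt (dtdx d (Ioo ε (T - ε))) (fun z =>
      deriv θ z.1 * (G (V.ρ z.1 z.2) + c * ∑ k, V.gradρ z.1 z.2 k * V.gradρ z.1 z.2 k)
      + θ z.1 * ((deriv G (V.ρ z.1 z.2) * V.dtρ z.1 z.2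
            + 2 * c * ∑ k, V.gradρ z.1 z.2 k * V.dtgradρ k z.1 z.2)
        + ∑ i, ((deriv G (V.ρ z.1 z.2) * V.gradρ z.1 z.2 i
              + 2 * c * ∑ k, V.gradρ z.1 z.2 k * V.ddρ i k z.1 z.2) * V.u z.1 z.2 i
          + (G (V.ρ z.1 z.2) + c * ∑ k, V.gradρ z.1 z.2 k * V.gradρ z.1 z.2 k)
              * V.du i i z.1 z.2))) := by
  have s1 := fun n j => (A.r_smooth n).pd_top j
  have hs : ∀ n j, PCD 1 (fun t => pd j (r n t)) := fun n j => (s1 n j).one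
  have hss : ∀ n k, PCD 1 (fun t x => pd k (r n t) x * pd k (r n t) x) := fun n k =>
    (hs n k).mul (hs n k)
  have hG1 : ∀ n, PCD 1 (fun t x => G (r n t x)) := fun n =>
    (A.pcd_comp hδ hG n).of_le (by norm_num)
  have hQ : ∀ n, PCD 1 (fun t x => c * ∑ k, pd k (r n t) x * pd k (r n t) x) := fun n =>
    PCD.const_mul c (PCD.sum fun k _ => hss n k)
  refine transport_limit hεT hθ
    (P := fun n t x => G (r n t x) + c * ∑ k, pd k (r n t) x * pd k (r n t) x)
    (fun n => (hG1 n).add (hQ n)) (fun n i => (A.v_smooth n i).one)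
    ((A.lim_comp hδ hG.continuousOn).add (BTend.const_mul c (BTend.sum fun k _ =>
      (A.lim_dr k).mul (A.lim_dr k)))) ?_ (fun i => ?_) A.lim_v (fun i => A.lim_dv i i)
  · refine ((A.lim_dt_comp hδ hG).add (BTend.const_mul (2 * c) (BTend.sum (s := Finset.univ)
      fun k _ => (A.lim_dr k).mul (A.lim_dtdr k)))).congr fun n =>
      Eventually.of_forall fun z => ?_
    simp only
    rw [dt_add (hG1 n) (hQ n) le_rfl, dt_const_mul (PCD.sum fun k _ => hss n k) le_rfl,
      dt_sum (fun k _ => hss n k) le_rfl, mul_assoc, Finset.mul_sum, Finset.mul_sum,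
      Finset.mul_sum]
    congr 1
    refine Finset.sum_congr rfl fun k _ => ?_
    rw [dt_mul (hs n k) (hs n k) le_rfl]
    ring
  · refine ((A.lim_pd_comp hδ hG i).add (BTend.const_mul (2 * c) (BTend.sum (s := Finset.univ)
      fun k _ => (A.lim_dr k).mul (A.lim_ddr i k)))).congr fun n =>
      Eventually.of_forall fun z => ?_
    simp only
    rw [pd_add (hG1 n) (hQ n) le_rfl, pd_const_mul (PCD.sum fun k _ => hss n k) le_rfl,
      pd_sum (fun k _ => hss n k) le_rfl, mul_assoc, Finset.mul_sum, Finset.mul_sum,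
      Finset.mul_sum]
    congr 1
    refine Finset.sum_congr rfl fun k _ => ?_
    rw [pd_mul (hs n k) (hs n k) le_rfl, pd_comm (A.r_smooth n).two le_rfl k i z.1 z.2]
    ring

end Approx

end Identities

/-! ### Constant capillarity -/

section ConstCapillarity

variable (h : ℝ → ℝ) (C : ℝ)

lemma Fρ_constCapillarity (ρ : ℝ) (q : Vec d) : Fρ (constCapillarity d h C) ρ q = deriv h ρ :=
  deriv_add_const _

lemma Fq_constCapillarity (ρ : ℝ) (q : Vec d) : Fq (constCapillarity d h C) ρ q = C • q := by
  refine HasGradientAt.gradient (hasGradientAt_iff_hasFDerivAt.2 ?_)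
  have h1 := ((hasStrictFDerivAt_norm_sq q).hasFDerivAt.const_mul (1 / 2 * C)).const_add (h ρ)
  refine h1.congr_fderiv ?_
  ext v
  simp
  ring

lemma norm_sq_eq (q : Vec d) : ‖q‖ ^ 2 = ∑ i, q i * q i := by
  rw [EuclideanSpace.norm_sq_eq]
  exact Finset.sum_congr rfl fun i _ => by rw [Real.norm_eq_abs, sq_abs, sq]

lemma inner_eq (p q : Vec d) : inner ℝ p q = ∑ i, p i * q i := by
  rw [PiLp.inner_apply]
  exact Finset.sum_congr rfl fun i _ => by rw [real_inner_eq_re_inner]; simp [mul_comm]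

end ConstCapillarity

/-! ### Essentially bounded functions -/

section Linf

variable {T : ℝ} {f g : ℝ → Torus d → ℝ}

lemma IsLinf.of_bound (hm : AEStronglyMeasurable (Function.uncurry f) (dtdx d (Ioo 0 T))) {M : ℝ}
    (hM : ∀ᵐ z ∂(dtdx d (Ioo 0 T)), |f z.1 z.2| ≤ M) : IsLinf T f :=
  memLp_top_of_bound hm M hM

lemma IsLinf.bTend (hf : IsLinf T f) :
    BTend (dtdx d (Ioo 0 T)) (fun _ z => f z.1 z.2) (fun z => f z.1 z.2) where
  meas _ := hf.1
  bdd := let ⟨M, _, hM⟩ := hf.exists_bound; ⟨M, fun _ => hM⟩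
  tend := Eventually.of_forall fun _ => tendsto_const_nhds

lemma BTend.isLinf {Φ : ℕ → ℝ × Torus d → ℝ}
    (h : BTend (dtdx d (Ioo 0 T)) Φ (fun z => f z.1 z.2)) : IsLinf T f :=
  let ⟨_, hM⟩ := h.ae_bound
  IsLinf.of_bound h.aestronglyMeasurable hM

lemma IsLinf.add (hf : IsLinf T f) (hg : IsLinf T g) : IsLinf T (fun t x => f t x + g t x) :=
  MemLp.add hf hg

lemma IsLinf.sub (hf : IsLinf T f) (hg : IsLinf T g) : IsLinf T (fun t x => f t x - g t x) :=
  MemLp.sub hf hg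

lemma IsLinf.mul (hf : IsLinf T f) (hg : IsLinf T g) : IsLinf T (fun t x => f t x * g t x) :=
  BTend.isLinf (hf.bTend.mul hg.bTend)

lemma IsLinf.const_mul (c : ℝ) (hf : IsLinf T f) : IsLinf T (fun t x => c * f t x) :=
  BTend.isLinf (BTend.const_mul c hf.bTend)

lemma IsLinf.sum {ι : Type*} {s : Finset ι} {F : ι → ℝ → Torus d → ℝ}
    (h : ∀ i ∈ s, IsLinf T (F i)) : IsLinf T (fun t x => ∑ i ∈ s, F i t x) :=
  BTend.isLinf (BTend.sum fun i hi => (h i hi).bTend)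

lemma IsLinf.integrable_mul {w : ℝ × Torus d → ℝ} (hf : IsLinf T f)
    (hw : Integrable w (dtdx d (Ioo 0 T))) :
    Integrable (fun z => f z.1 z.2 * w z) (dtdx d (Ioo 0 T)) :=
  (hf.bTend.integrable_mul hw).congr (Eventually.of_forall fun _ => mul_comm _ _)

end Linf

/-! ### Calculus of weak derivatives -/

section WeakCalculus

variable {T : ℝ} {i : Fin d} {f g f' g' : ℝ → Torus d → ℝ}

lemma PCD.integrable_dtdx {ψ : ℝ → Torus d → ℝ} {n : WithTop ℕ∞} (hψ : PCD n ψ) (a b : ℝ) :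
    Integrable (fun z : ℝ × Torus d => ψ z.1 z.2) (dtdx d (Ioo a b)) :=
  integrable_dtdx_of_continuousOn hψ.continuous.continuousOn

lemma IsTestSmooth.pcd {ψ : ℝ → Torus d → ℝ} (hψ : IsTestSmooth T ψ) : PCD ∞ ψ := hψ.contDiff

lemma HasWeakDx.sub (hf : HasWeakDx T i f f') (hg : HasWeakDx T i g g') (lf : IsLinf T f)
    (lg : IsLinf T g) (lf' : IsLinf T f') (lg' : IsLinf T g') :
    HasWeakDx T i (fun t x => f t x - g t x) (fun t x => f' t x - g' t x) := by
  intro ψ hψ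
  have i1 := (hψ.pcd.pd_top i).integrable_dtdx 0 T
  have i0 := hψ.pcd.integrable_dtdx 0 T
  simp only [sub_mul]
  rw [integral_sub (lf.integrable_mul i1) (lg.integrable_mul i1),
    integral_sub (lf'.integrable_mul i0) (lg'.integrable_mul i0), hf ψ hψ, hg ψ hψ]
  ring

lemma HasWeakDx.const_mul (c : ℝ) (hf : HasWeakDx T i f f') :
    HasWeakDx T i (fun t x => c * f t x) (fun t x => c * f' t x) := by
  intro ψ hψ
  simp only [mul_assoc]
  rw [integral_const_mul, integral_const_mul, hf ψ hψ]
  ring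

lemma HasWeakDx.sum {ι : Type*} {s : Finset ι} {F F' : ι → ℝ → Torus d → ℝ}
    (h : ∀ k ∈ s, HasWeakDx T i (F k) (F' k)) (l : ∀ k ∈ s, IsLinf T (F k))
    (l' : ∀ k ∈ s, IsLinf T (F' k)) :
    HasWeakDx T i (fun t x => ∑ k ∈ s, F k t x) (fun t x => ∑ k ∈ s, F' k t x) := by
  intro ψ hψ
  have i1 := (hψ.pcd.pd_top i).integrable_dtdx 0 T
  have i0 := hψ.pcd.integrable_dtdx 0 T
  simp only [Finset.sum_mul]
  rw [integral_finsetSum _ fun k hk => (l k hk).integrable_mul i1,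
    integral_finsetSum _ fun k hk => (l' k hk).integrable_mul i0, ← Finset.sum_neg_distrib]
  exact Finset.sum_congr rfl fun k hk => h k hk ψ hψ

lemma HasWeakDx.congr_left (hf : HasWeakDx T i f f')
    (h : ∀ᵐ z ∂(dtdx d (Ioo 0 T)), f z.1 z.2 = g z.1 z.2) : HasWeakDx T i g f' := by
  intro ψ hψ
  rw [← hf ψ hψ]
  refine integral_congr_ae ?_
  filter_upwards [h] with z hz
  rw [hz]

lemma HasWeakDx.ae_unique (hf : HasWeakDx T i f f') (hg : HasWeakDx T i f g') (lf' : IsLinf T f')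
    (lg' : IsLinf T g') : ∀ᵐ z ∂(dtdx d (Ioo 0 T)), f' z.1 z.2 = g' z.1 z.2 := by
  have := ae_eq_zero_of_forall_test (g := fun t x => f' t x - g' t x) (lf'.sub lg').integrable ?_
  · filter_upwards [this] with z hz
    linarith
  · intro ψ hψ
    have i0 := hψ.pcd.integrable_dtdx 0 T
    have h1 := hf ψ hψ
    rw [hg ψ hψ] at h1
    simp only [sub_mul]
    rw [integral_sub (lf'.integrable_mul i0) (lg'.integrable_mul i0)]
    linarith

lemma hasWeakDx_zero : HasWeakDx (d := d) T i (fun _ _ => 0) (fun _ _ => 0) := by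
  intro ψ _
  simp

/-- The weak divergence is postulated for the whole field; the fundamental lemma identifies it with
the sum of the separate weak derivatives. -/
lemma HasWeakDiv.ae_eq {w : ℝ → Torus d → Vec d} {D : ℝ → Torus d → ℝ} {w' : Fin d → ℝ → Torus d → ℝ}
    (h : HasWeakDiv T w D) (h' : ∀ k, HasWeakDx T k (fun t x => w t x k) (w' k))
    (lw : ∀ k, IsLinf T (fun t x => w t x k)) (lw' : ∀ k, IsLinf T (w' k)) (lD : IsLinf T D) :
    ∀ᵐ z ∂(dtdx d (Ioo 0 T)), D z.1 z.2 = ∑ k, w' k z.1 z.2 := by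
  have hl : IsLinf T (fun t x => ∑ k, w' k t x) := IsLinf.sum fun k _ => lw' k
  have := ae_eq_zero_of_forall_test (g := fun t x => D t x - ∑ k, w' k t x) (lD.sub hl).integrable ?_
  · filter_upwards [this] with z hz
    linarith
  · intro ψ hψ
    have i0 := hψ.pcd.integrable_dtdx 0 T
    have i1 := fun k => (hψ.pcd.pd_top k).integrable_dtdx 0 T
    have h1 := h ψ hψ
    rw [integral_finsetSum _ fun k _ => (lw k).integrable_mul (i1 k)] at h1
    have h2 : ∀ k, ∫ z, w z.1 z.2 k * pd k (ψ z.1) z.2 ∂(dtdx d (Ioo 0 T))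
      = - ∫ z, w' k z.1 z.2 * ψ z.1 z.2 ∂(dtdx d (Ioo 0 T)) := fun k => h' k ψ hψ
    simp only [h2, Finset.sum_neg_distrib, neg_inj] at h1
    simp only [sub_mul, Finset.sum_mul]
    rw [integral_sub (lD.integrable_mul i0)
      (integrable_finsetSum _ fun k _ => (lw' k).integrable_mul i0),
      integral_finsetSum _ fun k _ => (lw' k).integrable_mul i0]
    linarith

/-- Weak derivatives are local limits of classical derivatives. -/
lemma hasWeakDx_of_approx (happ : ∀ ε : ℝ, 0 < ε → ∃ F : ℕ → ℝ → Torus d → ℝ,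
      (∀ n, PCD 1 (F n)) ∧
      BTend (dtdx d (Ioo ε (T - ε))) (fun n z => F n z.1 z.2) (fun z => f z.1 z.2) ∧
      BTend (dtdx d (Ioo ε (T - ε))) (fun n z => pd i (F n z.1) z.2) (fun z => f' z.1 z.2)) :
    HasWeakDx T i f f' := by
  intro ψ hψ
  obtain ⟨a, b, ha, hb, hs⟩ := hψ.compactSupport
  set ε := min a (T - b) / 2 with hεd
  have hε : 0 < ε := half_pos (lt_min ha (by linarith))
  have h1 : ε < a := (half_lt_self (lt_min ha (by linarith))).trans_le (min_le_left _ _)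
  have h2 : b < T - ε := by
    have : ε < T - b := (half_lt_self (lt_min ha (by linarith))).trans_le (min_le_right _ _)
    linarith
  have hz : ∀ t, t ∉ Ioo ε (T - ε) → ∀ x, ψ t x = 0 := fun t ht =>
    hs t fun hh => ht ⟨h1.trans_le hh.1, hh.2.trans_lt h2⟩
  have hz' : ∀ t, t ∉ Ioo ε (T - ε) → ∀ x, pd i (ψ t) x = 0 := fun t ht x => by
    rw [show ψ t = fun _ => 0 from funext (hz t ht), pd_const]
  obtain ⟨F, hF, l0, l1⟩ := happ ε hε
  have hsub : Ioo ε (T - ε) ⊆ Ioo 0 T := Ioo_subset_Ioo hε.le (by linarith)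
  rw [integral_dtdx_eq_of_support hsub measurableSet_Ioo
      (fun z hh => by rw [hz' z.1 hh, mul_zero]),
    integral_dtdx_eq_of_support hsub measurableSet_Ioo
      (fun z hh => by rw [hz z.1 hh, mul_zero])]
  have hψ1 : PCD 1 ψ := hψ.pcd.one
  have j1 := (hψ.pcd.pd_top i).integrable_dtdx ε (T - ε)
  have j0 := hψ.pcd.integrable_dtdx ε (T - ε)
  have key := (l0.iTend j1).add (l1.iTend j0)
  have h0 := key.eq_zero fun n => by
    rw [← integral_dtdx_pd_eq_zero ((hF n).mul hψ1) i ε (T - ε)]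
    refine integral_congr_ae (Eventually.of_forall fun z => ?_)
    simp only
    rw [pd_mul (hF n) hψ1 le_rfl]
    ring
  rw [integral_add (l0.integrable_mul j1) (l1.integrable_mul j0)] at h0
  simp only [mul_comm (pd i _ _), mul_comm (ψ _ _)] at h0
  linarith

end WeakCalculus

/-! ### Equations satisfied by a strong solution -/

section StrongEquations

variable {F : ℝ → Vec d → ℝ} {T δ R : ℝ} {V : StrongFields d}

lemma HypStrong.linf_ρ (hV : HypStrong F T V) : IsLinf T V.ρ := isLinf_of_continuousOn hV.cont_ρ

lemma HypStrong.linf_u (hV : HypStrong F T V) (i : Fin d) : IsLinf T (fun t x => V.u t x i) :=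
  isLinf_of_continuousOn ((EuclideanSpace.proj (𝕜 := ℝ) i).continuous.comp_continuousOn hV.cont_u)

lemma HypStrong.linf_gradρ (hV : HypStrong F T V) (i : Fin d) :
    IsLinf T (fun t x => V.gradρ t x i) :=
  isLinf_of_continuousOn
    ((EuclideanSpace.proj (𝕜 := ℝ) i).continuous.comp_continuousOn hV.cont_gradρ)

lemma HypStrong.linf_comp (hV : HypStrong F T V) (hδ : 0 < δ)
    (hmem : ∀ t ∈ Icc 0 T, ∀ x, V.ρ t x ∈ Icc δ R) {G : ℝ → ℝ} (hG : ContinuousOn G (Ioi 0)) :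
    IsLinf T (fun t x => G (V.ρ t x)) :=
  isLinf_of_continuousOn (hG.comp hV.cont_ρ fun z hz => hδ.trans_le (hmem z.1 hz.1 z.2).1)

/-- The chain rule passes to the limit from the approximations, whose values stay in [δ,R], where G
is smooth. -/
lemma HypStrong.hasWeakDx_comp (hT : 0 < T) (hV : HypStrong F T V) (hδ : 0 < δ)
    (hmem : ∀ t ∈ Icc 0 T, ∀ x, V.ρ t x ∈ Icc δ R) {G : ℝ → ℝ} (hG : ContDiffOn ℝ 2 G (Ioi 0))
    (i : Fin d) : HasWeakDx T i (fun t x => G (V.ρ t x))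
      (fun t x => deriv G (V.ρ t x) * V.gradρ t x i) := by
  refine hasWeakDx_of_approx fun ε hε => ?_
  obtain ⟨r, v, A⟩ := exists_approx hT hV hε hmem
  exact ⟨fun n t x => G (r n t x), fun n => (A.pcd_comp hδ hG n).of_le (by norm_num),
    A.lim_comp hδ hG.continuousOn, A.lim_pd_comp hδ hG i⟩

/-- The left side of the continuity equation has a weak derivative by approximation and vanishes
almost everywhere; uniqueness of weak derivatives makes that derivative zero. This provides the
equation for ∂_t ∇ρ̄. -/
lemma HypStrong.grad_mass (hT : 0 < T) (hV : HypStrong F T V)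
    (hmem : ∀ t ∈ Icc 0 T, ∀ x, V.ρ t x ∈ Icc δ R) (i : Fin d) :
    ∀ᵐ z ∂(dtdx d (Ioo 0 T)), V.dtgradρ i z.1 z.2
      + ∑ j, ((V.ddρ j i z.1 z.2 * V.u z.1 z.2 j + V.gradρ z.1 z.2 j * V.du j i z.1 z.2)
        + (V.gradρ z.1 z.2 i * V.du j j z.1 z.2 + V.ρ z.1 z.2 * V.ddu j j i z.1 z.2)) = 0 := by
  have hw : HasWeakDx T i (fun t x => V.dtρ t x
        + ∑ j, (V.gradρ t x j * V.u t x j + V.ρ t x * V.du j j t x))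
      (fun t x => V.dtgradρ i t x
      + ∑ j, ((V.ddρ j i t x * V.u t x j + V.gradρ t x j * V.du j i t x)
        + (V.gradρ t x i * V.du j j t x + V.ρ t x * V.ddu j j i t x))) := by
    refine hasWeakDx_of_approx fun ε hε => ?_
    obtain ⟨r, v, A⟩ := exists_approx hT hV hε hmem
    have s0 := fun n => (A.r_smooth n).dt_top
    have s1 := fun n j => (A.r_smooth n).pd_top j
    have s3 := fun n i j => (A.v_smooth n i).pd_top j
    have t1 : ∀ n j, PCD ∞ (fun t x => pd j (r n t) x * v n j t x) := fun n j =>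
      (s1 n j).mul (A.v_smooth n j)
    have t2 : ∀ n j, PCD ∞ (fun t x => r n t x * pd j (v n j t) x) := fun n j =>
      (A.r_smooth n).mul (s3 n j j)
    have t3 : ∀ n j, PCD ∞ (fun t x => pd j (r n t) x * v n j t x
      + r n t x * pd j (v n j t) x) := fun n j => (t1 n j).add (t2 n j)
    have t4 : ∀ n, PCD ∞ (fun t x => ∑ j, (pd j (r n t) x * v n j t x
      + r n t x * pd j (v n j t) x)) := fun n => PCD.sum fun j _ => t3 n j
    refine ⟨fun n t x => dt (r n) t x + ∑ j, (pd j (r n t) x * v n j t x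
      + r n t x * pd j (v n j t) x), fun n => ((s0 n).add (t4 n)).one,
      A.lim_dtr.add (BTend.sum fun j _ => ((A.lim_dr j).mul (A.lim_v j)).add
        (A.lim_r.mul (A.lim_dv j j))), ?_⟩
    refine ((A.lim_dtdr i).add (BTend.sum (s := Finset.univ) fun j _ =>
      (((A.lim_ddr j i).mul (A.lim_v j)).add ((A.lim_dr j).mul (A.lim_dv j i))).add
      (((A.lim_dr i).mul (A.lim_dv j j)).add (A.lim_r.mul (A.lim_ddv j j i))))).congr fun n =>
      Eventually.of_forall fun z => ?_
    simp only
    rw [pd_add (s0 n) (t4 n) (by simp), pd_dt_comm (A.r_smooth n).two le_rfl,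
      pd_sum (fun j _ => t3 n j) (by simp) i z.1 z.2]
    congr 1
    refine Finset.sum_congr rfl fun j _ => ?_
    rw [pd_add (t1 n j) (t2 n j) (by simp), pd_mul (s1 n j) (A.v_smooth n j) (by simp),
      pd_mul (A.r_smooth n) (s3 n j j) (by simp)]
  have h0 : HasWeakDx T i (fun _ _ => (0 : ℝ)) (fun t x => V.dtgradρ i t x
      + ∑ j, ((V.ddρ j i t x * V.u t x j + V.gradρ t x j * V.du j i t x)
        + (V.gradρ t x i * V.du j j t x + V.ρ t x * V.ddu j j i t x))) :=
    hw.congr_left hV.mass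
  refine h0.ae_unique hasWeakDx_zero ?_ (isLinf_of_continuousOn continuousOn_const)
  exact (hV.linf_dtgradρ i).add (IsLinf.sum fun j _ =>
    (((hV.linf_ddρ j i).mul (hV.linf_u j)).add ((hV.linf_gradρ j).mul (hV.linf_du j i))).add
    (((hV.linf_gradρ i).mul (hV.linf_du j j)).add (hV.linf_ρ.mul (hV.linf_ddu j j i))))

variable {h : ℝ → ℝ} {C : ℝ}

lemma HypStrong.divFq_eq (hV : HypStrong (constCapillarity d h C) T V) :
    ∀ᵐ z ∂(dtdx d (Ioo 0 T)), V.divFq z.1 z.2 = ∑ k, C * V.ddρ k k z.1 z.2 := by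
  have h1 := hV.divFq
  simp only [Fq_constCapillarity] at h1
  refine h1.ae_eq (w' := fun k t x => C * V.ddρ k k t x) (fun k => ?_) (fun k => ?_)
    (fun k => (hV.linf_ddρ k k).const_mul C) hV.linf_divFq
  · exact (hV.ddρ k k).const_mul C
  · exact (hV.linf_gradρ k).const_mul C

lemma HypStrong.gradμ_eq (hT : 0 < T) (hV : HypStrong (constCapillarity d h C) T V) (hδ : 0 < δ)
    (hmem : ∀ t ∈ Icc 0 T, ∀ x, V.ρ t x ∈ Icc δ R) (hh : ContDiffOn ℝ 2 (deriv h) (Ioi 0))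
    (i : Fin d) : ∀ᵐ z ∂(dtdx d (Ioo 0 T)), V.gradμ i z.1 z.2
      = deriv (deriv h) (V.ρ z.1 z.2) * V.gradρ z.1 z.2 i - ∑ k, C * V.dddρ k k i z.1 z.2 := by
  have h1 := hV.gradμ i
  simp only [Fρ_constCapillarity] at h1
  have h2 : HasWeakDx T i (fun t x => ∑ k, C * V.ddρ k k t x)
      (fun t x => ∑ k, C * V.dddρ k k i t x) :=
    HasWeakDx.sum (fun k _ => (hV.dddρ k k i).const_mul C)
      (fun k _ => (hV.linf_ddρ k k).const_mul C) (fun k _ => (hV.linf_dddρ k k i).const_mul C)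
  have l1 := hV.linf_comp hδ hmem hh.continuousOn
  have l2 : IsLinf T (fun t x => ∑ k, C * V.ddρ k k t x) :=
    IsLinf.sum fun k _ => (hV.linf_ddρ k k).const_mul C
  have l3 : IsLinf T (fun t x => ∑ k, C * V.dddρ k k i t x) :=
    IsLinf.sum fun k _ => (hV.linf_dddρ k k i).const_mul C
  have l4 := (hV.linf_comp hδ hmem (Approx.continuousOn_deriv hh)).mul (hV.linf_gradρ i)
  refine (h1.congr_left (g := fun t x => deriv h (V.ρ t x) - ∑ k, C * V.ddρ k k t x) ?_).ae_unique
    ((hV.hasWeakDx_comp hT hδ hmem hh i).sub h2 l1 l2 l4 l3) (hV.linf_gradμ i) (l4.sub l3)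
  filter_upwards [hV.divFq_eq] with z hz
  rw [hz]

/-- Subtract ū times the continuity equation from the momentum equation and divide by ρ̄ > 0. -/
lemma HypStrong.velocity_eq (hT : 0 < T) (hV : HypStrong (constCapillarity d h C) T V)
    (hδ : 0 < δ) (hmem : ∀ t ∈ Icc 0 T, ∀ x, V.ρ t x ∈ Icc δ R)
    (hh : ContDiffOn ℝ 2 (deriv h) (Ioi 0)) (i : Fin d) :
    ∀ᵐ z ∂(dtdx d (Ioo 0 T)), V.dtu i z.1 z.2 = C * ∑ k, V.dddρ k k i z.1 z.2
      - deriv (deriv h) (V.ρ z.1 z.2) * V.gradρ z.1 z.2 i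
      - ∑ j, V.u z.1 z.2 j * V.du i j z.1 z.2 := by
  have hin : ∀ᵐ z ∂(dtdx d (Ioo 0 T)), z.1 ∈ Ioo 0 T := by
    rw [dtdx_eq]
    filter_upwards [ae_restrict_mem (measurableSet_Ioo.prod MeasurableSet.univ)] with z hz
    exact hz.1
  filter_upwards [hV.mass, hV.momentum i, hV.gradμ_eq hT hδ hmem hh i, hin] with z h1 h2 h3 hz
  have hρ : 0 < V.ρ z.1 z.2 := hδ.trans_le (hmem z.1 (Ioo_subset_Icc_self hz) z.2).1
  rw [h3, ← Finset.mul_sum] at h2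
  refine mul_left_cancel₀ hρ.ne' ?_
  have e1 : ∑ j, (V.gradρ z.1 z.2 j * V.u z.1 z.2 j * V.u z.1 z.2 i
          + V.ρ z.1 z.2 * V.du j j z.1 z.2 * V.u z.1 z.2 i
          + V.ρ z.1 z.2 * V.u z.1 z.2 j * V.du i j z.1 z.2)
      = (∑ j, (V.gradρ z.1 z.2 j * V.u z.1 z.2 j + V.ρ z.1 z.2 * V.du j j z.1 z.2))
          * V.u z.1 z.2 i + V.ρ z.1 z.2 * ∑ j, V.u z.1 z.2 j * V.du i j z.1 z.2 := by
    rw [Finset.sum_mul, Finset.mul_sum, ← Finset.sum_add_distrib]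
    exact Finset.sum_congr rfl fun j _ => by ring
  rw [e1] at h2
  linear_combination h2 - V.u z.1 z.2 i * h1

end StrongEquations

/-! ### The thermodynamic functions -/

/-- A function lies above its tangents where its second derivative is non-negative. -/
lemma tangent_le_of_deriv2_nonneg {D : Set ℝ} (hD : Convex ℝ D) {f : ℝ → ℝ}
    (hf : ContinuousOn f D) (hf' : ContDiffOn ℝ 2 f (interior D))
    (hf'' : ∀ x ∈ interior D, 0 ≤ deriv (deriv f) x) {a x : ℝ} (ha : a ∈ interior D)
    (hx : x ∈ D) : f a + deriv f a * (x - a) ≤ f x := by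
  have h1 : DifferentiableOn ℝ f (interior D) := hf'.differentiableOn (by norm_num)
  have h2 : ContDiffOn ℝ 1 (deriv f) (interior D) :=
    hf'.deriv_of_isOpen isOpen_interior (by norm_num)
  have hc : ConvexOn ℝ D f := convexOn_of_deriv2_nonneg hD hf h1
    (h2.differentiableOn (by norm_num)) hf''
  have hda : HasDerivAt f (deriv f a) a :=
    (h1.differentiableAt (isOpen_interior.mem_nhds ha)).hasDerivAt
  rcases lt_trichotomy x a with hxa | rfl | hxa
  · have := hc.slope_le_of_hasDerivAt hx (interior_subset ha) hxa hda
    rw [slope_def_field, div_le_iff₀ (by linarith)] at this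
    linarith
  · simp
  · have := hc.le_slope_of_hasDerivAt (interior_subset ha) hx hxa hda
    rw [slope_def_field, le_div_iff₀ (by linarith)] at this
    linarith

/-- The pressure `ρ h'(ρ) - h(ρ)`. -/
def press (h : ℝ → ℝ) (ρ : ℝ) : ℝ := ρ * deriv h ρ - h ρ

/-- The relative potential `h(ρ) - h(a) - h'(a)(ρ - a)`. -/
def relh (h : ℝ → ℝ) (ρ a : ℝ) : ℝ := h ρ - h a - deriv h a * (ρ - a)

/-- The structural assumptions on the potential `h` and its pressure. -/
structure Thermo (h : ℝ → ℝ) (A : ℝ) : Prop where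
  pos : 0 < A
  cont : ContinuousOn h (Ici 0)
  smooth : ContDiffOn ℝ 2 h (Ioi 0)
  smooth_press : ContDiffOn ℝ 2 (press h) (Ioi 0)
  monotone : ∀ ρ, 0 < ρ → 0 < deriv (press h) ρ
  bound : ∀ ρ, 0 < ρ → |deriv (deriv (press h)) ρ| ≤ A * (deriv (press h) ρ / ρ)

namespace Thermo

variable {h : ℝ → ℝ} {A : ℝ}

/-- As h' = (p + h)/ρ, the regularity of the pressure gains one order over h ∈ C². It is what makes
h'(ρ̄) usable as a test function. -/
lemma smooth_deriv (H : Thermo h A) : ContDiffOn ℝ 2 (deriv h) (Ioi 0) := by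
  have h1 : ContDiffOn ℝ 2 (fun ρ => (press h ρ + h ρ) / ρ) (Ioi 0) :=
    (H.smooth_press.add H.smooth).div contDiffOn_id fun x hx => (mem_Ioi.1 hx).ne'
  refine h1.congr fun x hx => ?_
  have : x ≠ 0 := (mem_Ioi.1 hx).ne'
  unfold press
  field_simp
  ring

lemma hasDerivAt (H : Thermo h A) {ρ : ℝ} (hρ : 0 < ρ) : HasDerivAt h (deriv h ρ) ρ :=
  ((H.smooth.differentiableOn (by norm_num)).differentiableAt (isOpen_Ioi.mem_nhds hρ)).hasDerivAt

lemma hasDerivAt_deriv (H : Thermo h A) {ρ : ℝ} (hρ : 0 < ρ) :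
    HasDerivAt (deriv h) (deriv (deriv h) ρ) ρ :=
  ((H.smooth_deriv.differentiableOn (by norm_num)).differentiableAt
    (isOpen_Ioi.mem_nhds hρ)).hasDerivAt

lemma deriv_press (H : Thermo h A) {ρ : ℝ} (hρ : 0 < ρ) :
    deriv (press h) ρ = ρ * deriv (deriv h) ρ := by
  have := ((hasDerivAt_id ρ).mul (H.hasDerivAt_deriv hρ)).sub (H.hasDerivAt hρ)
  refine this.deriv.trans ?_
  simp

lemma deriv2_pos (H : Thermo h A) {ρ : ℝ} (hρ : 0 < ρ) : 0 < deriv (deriv h) ρ := by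
  have := H.monotone ρ hρ
  rw [H.deriv_press hρ] at this
  exact pos_of_mul_pos_right this hρ.le

lemma tangent_le (H : Thermo h A) {ρ a : ℝ} (hρ : 0 ≤ ρ) (ha : 0 < a) :
    h a + deriv h a * (ρ - a) ≤ h ρ := by
  refine tangent_le_of_deriv2_nonneg (convex_Ici 0) H.cont ?_ ?_ ?_ (mem_Ici.2 hρ)
  · rw [interior_Ici]; exact H.smooth
  · rw [interior_Ici]; exact fun x hx => (H.deriv2_pos hx).le
  · rwa [interior_Ici]

lemma relh_nonneg (H : Thermo h A) {ρ a : ℝ} (hρ : 0 ≤ ρ) (ha : 0 < a) : 0 ≤ relh h ρ a := by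
  have := H.tangent_le hρ ha
  unfold relh
  linarith

lemma relh_self (a : ℝ) : relh h a a = 0 := by simp [relh]

/-- If h met its tangent at a in a second point, strict convexity would put h below that tangent at
the midpoint. -/
lemma relh_eq_zero (H : Thermo h A) {ρ a : ℝ} (hρ : 0 ≤ ρ) (ha : 0 < a) (h0 : relh h ρ a = 0) :
    ρ = a := by
  by_contra hne
  have hs : StrictConvexOn ℝ (Ici 0) h := by
    refine strictConvexOn_of_deriv2_pos (convex_Ici 0) H.cont ?_
    rw [interior_Ici]
    exact fun x hx => H.deriv2_pos hx
  obtain ⟨_, hs⟩ := hs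
  have hm := hs (mem_Ici.2 hρ) (mem_Ici.2 ha.le) hne (a := 1 / 2) (b := 1 / 2)
    (by norm_num) (by norm_num) (by norm_num)
  have ht := H.tangent_le (ρ := (1 / 2 : ℝ) • ρ + (1 / 2 : ℝ) • a)
    (by simp only [smul_eq_mul]; linarith) ha
  simp only [smul_eq_mul] at hm ht
  unfold relh at h0
  linarith

/-- Only the vacuum ρ = 0 is at issue. The tangent at ρ, evaluated at 0 and at 2ρ, gives -h(0) ≤
p(ρ) ≤ h(2ρ) - 2h(ρ), and the upper bound tends to -h(0) by continuity of h. -/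
lemma continuousOn_press (H : Thermo h A) : ContinuousOn (press h) (Ici 0) := by
  intro x hx
  rcases (mem_Ici.1 hx).eq_or_lt with rfl | hx
  · have hc : Tendsto h (𝓝[Ici 0] 0) (𝓝 (h 0)) := H.cont 0 hx
    have hc2 : Tendsto (fun ρ => h (2 * ρ)) (𝓝[Ici 0] 0) (𝓝 (h 0)) := by
      refine hc.comp (tendsto_nhdsWithin_iff.2 ⟨?_, ?_⟩)
      · have : Tendsto (fun ρ : ℝ => 2 * ρ) (𝓝 0) (𝓝 (2 * 0)) :=
          tendsto_id.const_mul 2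
        rw [mul_zero] at this
        exact this.mono_left nhdsWithin_le_nhds
      · filter_upwards [self_mem_nhdsWithin] with ρ hρ
        exact mul_nonneg (by norm_num : (0 : ℝ) ≤ 2) hρ
    refine tendsto_of_tendsto_of_tendsto_of_le_of_le' (g := fun _ => press h 0)
      (h := fun ρ => h (2 * ρ) - h ρ - h ρ) tendsto_const_nhds ?_ ?_ ?_
    · have := (hc2.sub hc).sub hc
      simpa [press] using this
    · filter_upwards [self_mem_nhdsWithin] with ρ hρ
      rcases (mem_Ici.1 hρ).eq_or_lt with rfl | hρ
      · exact le_rfl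
      · have := H.tangent_le le_rfl hρ
        unfold press
        linarith
    · filter_upwards [self_mem_nhdsWithin] with ρ hρ
      rcases (mem_Ici.1 hρ).eq_or_lt with rfl | hρ
      · simp [press]
      · have := H.tangent_le (ρ := 2 * ρ) (by linarith) hρ
        unfold press
        linarith
  · exact (H.smooth_press.continuousOn.continuousAt (isOpen_Ioi.mem_nhds hx)).continuousWithinAt

/-- Since p' = ρ h'', the hypothesis on p'' reads |p''| ≤ A h''. Thus A h + s p is convex for |s| ≤
1, and its tangent inequalities for s = ±1 are the two halves of the estimate. Continuity of p at 0
lets them reach the vacuum. -/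
lemma abs_rel_press_le (H : Thermo h A) {ρ a : ℝ} (hρ : 0 ≤ ρ) (ha : 0 < a) :
    |press h ρ - press h a - deriv (press h) a * (ρ - a)| ≤ A * relh h ρ a := by
  have key : ∀ s : ℝ, |s| ≤ 1 → A * h a + s * press h a
      + (A * deriv h a + s * deriv (press h) a) * (ρ - a) ≤ A * h ρ + s * press h ρ := by
    intro s hs
    have hd : ∀ x, 0 < x → HasDerivAt (fun x => A * h x + s * press h x)
        (A * deriv h x + s * deriv (press h) x) x := fun x hx =>
      ((H.hasDerivAt hx).const_mul A).add ((((H.smooth_press.differentiableOn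
        (by norm_num)).differentiableAt (isOpen_Ioi.mem_nhds hx)).hasDerivAt).const_mul s)
    have hp2 : ContDiffOn ℝ 1 (deriv (press h)) (Ioi 0) :=
      H.smooth_press.deriv_of_isOpen isOpen_Ioi (by norm_num)
    have hd2 : ∀ x, 0 < x → deriv (deriv fun x => A * h x + s * press h x) x
        = A * deriv (deriv h) x + s * deriv (deriv (press h)) x := fun x hx => by
      have e : deriv (fun x => A * h x + s * press h x)
          =ᶠ[𝓝 x] fun x => A * deriv h x + s * deriv (press h) x :=
        (isOpen_Ioi.eventually_mem hx).mono fun y hy => (hd y hy).deriv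
      rw [e.deriv_eq]
      exact (((H.hasDerivAt_deriv hx).const_mul A).add ((((hp2.differentiableOn
        (by norm_num)).differentiableAt (isOpen_Ioi.mem_nhds hx)).hasDerivAt).const_mul s)).deriv
    have := tangent_le_of_deriv2_nonneg (f := fun x => A * h x + s * press h x) (convex_Ici 0)
      ((continuousOn_const.mul H.cont).add (continuousOn_const.mul H.continuousOn_press))
      (by rw [interior_Ici]
          exact (contDiffOn_const.mul H.smooth).add (contDiffOn_const.mul H.smooth_press))
      (by
        rw [interior_Ici]
        intro x hx
        have hx : 0 < x := hx
        rw [hd2 x hx]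
        have h1 := H.bound x hx
        rw [H.deriv_press hx, mul_div_cancel_left₀ _ hx.ne'] at h1
        have h2 : |s * deriv (deriv (press h)) x| ≤ A * deriv (deriv h) x := by
          rw [abs_mul]
          exact (mul_le_of_le_one_left (abs_nonneg _) hs).trans h1
        linarith [neg_abs_le (s * deriv (deriv (press h)) x)])
      (a := a) (x := ρ) (by rwa [interior_Ici]) hρ
    rwa [(hd a ha).deriv] at this
  have k1 := key 1 (by norm_num)
  have k2 := key (-1) (by norm_num)
  unfold relh
  rw [abs_le]
  constructor <;> nlinarith

/-- The tangent at 1 is a linear minorant; so the total energy and the mass together bound the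
gradient. -/
lemma exists_neg_le (H : Thermo h A) : ∃ K, 0 < K ∧ ∀ ρ, 0 ≤ ρ → - (K * (1 + ρ)) ≤ h ρ := by
  refine ⟨|h 1| + |deriv h 1| + 1, by positivity, fun ρ hρ => ?_⟩
  have h1 := H.tangent_le hρ one_pos
  have h2 := neg_abs_le (h 1)
  have h3 := neg_abs_le (deriv h 1 * (ρ - 1))
  have h4 : |deriv h 1 * (ρ - 1)| ≤ |deriv h 1| * (1 + ρ) := by
    rw [abs_mul]
    refine mul_le_mul_of_nonneg_left ?_ (abs_nonneg _)
    rw [abs_le]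
    constructor <;> linarith
  nlinarith [abs_nonneg (h 1), mul_nonneg (abs_nonneg (h 1)) hρ]

/-- On a compact interval away from 0 the continuous function h'' has a positive minimum c, and h -
(c/2)x² is convex there. -/
lemma relh_quadratic (H : Thermo h A) {b M : ℝ} (hb : 0 < b) (hbM : b < M) :
    ∃ c, 0 < c ∧ ∀ ρ ∈ Icc b M, ∀ a ∈ Ioo b M, c * (ρ - a) ^ 2 ≤ relh h ρ a := by
  have hsub : Icc b M ⊆ Ioi 0 := fun x hx => hb.trans_le hx.1
  obtain ⟨x₀, hx₀, hmin⟩ := (isCompact_Icc (a := b) (b := M)).exists_isMinOn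
    ⟨b, left_mem_Icc.2 hbM.le⟩ ((Approx.continuousOn_deriv H.smooth_deriv).mono hsub)
  set c := deriv (deriv h) x₀ with hc
  have hcpos : 0 < c := H.deriv2_pos (hsub hx₀)
  refine ⟨c / 2, half_pos hcpos, fun ρ hρ a ha => ?_⟩
  have hd : ∀ x, 0 < x → HasDerivAt (fun x => h x - c / 2 * x ^ 2) (deriv h x - c * x) x :=
    fun x hx => by
      have := (H.hasDerivAt hx).sub (((hasDerivAt_id x).pow 2).const_mul (c / 2))
      refine this.congr_deriv ?_
      simp
      ring
  have hd2 : ∀ x, 0 < x → deriv (deriv fun x => h x - c / 2 * x ^ 2) x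
      = deriv (deriv h) x - c := fun x hx => by
    have e : deriv (fun x => h x - c / 2 * x ^ 2) =ᶠ[𝓝 x] fun x => deriv h x - c * x :=
      (isOpen_Ioi.eventually_mem hx).mono fun y hy => (hd y hy).deriv
    rw [e.deriv_eq]
    refine ((H.hasDerivAt_deriv hx).sub ((hasDerivAt_id x).const_mul c)).deriv.trans ?_
    simp
  have hq : ContDiffOn ℝ 2 (fun x => h x - c / 2 * x ^ 2) (Ioi 0) :=
    H.smooth.sub (contDiff_const.mul (contDiff_id.pow 2)).contDiffOn
  have := tangent_le_of_deriv2_nonneg (f := fun x => h x - c / 2 * x ^ 2) (convex_Icc b M)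
    (hq.continuousOn.mono hsub) (hq.mono (interior_subset.trans hsub))
    (fun x hx => by
      have hx := interior_subset hx
      rw [hd2 x (hsub hx)]
      exact sub_nonneg.2 (hmin hx))
    (a := a) (x := ρ) (by rwa [interior_Icc]) hρ
  rw [(hd a (hb.trans ha.1)).deriv] at this
  unfold relh
  nlinarith

/-- Three ranges of ρ. For large ρ the growth ρ^γ with γ ≥ 2 dominates; on [δ/2, M] strict convexity
is uniform; below δ/2 the relative potential only increases towards the vacuum, while (ρ - a)² stays
bounded. -/
lemma relh_coercive (H : Thermo h A) {γ k δ R : ℝ} (hγ : 2 ≤ γ) (hk : 0 < k) (hδ : 0 < δ)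
    (growth : (fun ρ : ℝ => h ρ - k / (γ - 1) * ρ ^ γ) =o[atTop] fun ρ : ℝ => ρ ^ γ) :
    ∃ c, 0 < c ∧ ∀ ρ, 0 ≤ ρ → ∀ a ∈ Icc δ R, c * (ρ - a) ^ 2 ≤ relh h ρ a := by
  set κ := k / (γ - 1) with hκ
  have hκp : 0 < κ := div_pos hk (by linarith)
  have hsub : Icc δ R ⊆ Ioi 0 := fun x hx => hδ.trans_le hx.1
  obtain ⟨B₁, hB₁⟩ := (isCompact_Icc (a := δ) (b := R)).exists_bound_of_continuousOn
    (H.smooth.continuousOn.mono hsub)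
  obtain ⟨B₂, hB₂⟩ := (isCompact_Icc (a := δ) (b := R)).exists_bound_of_continuousOn
    (H.smooth_deriv.continuousOn.mono hsub)
  have hlarge : ∀ᶠ ρ : ℝ in atTop, ∀ a ∈ Icc δ R, κ / 4 * (ρ - a) ^ 2 ≤ relh h ρ a := by
    -- An error of at most (κ/2)ρ^γ leaves h ≥ (κ/2)ρ². The terms linear in ρ, of size |B₁| + 2|B₂|,
    -- consume another (κ/4)ρ², hence the threshold 4/κ · (|B₁| + 2|B₂|).
    have e1 := growth.def (half_pos hκp)
    have e2 : ∀ᶠ ρ : ℝ in atTop, max 1 (max R (4 / κ * (|B₁| + 2 * |B₂|))) ≤ ρ :=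
      eventually_ge_atTop _
    filter_upwards [e1, e2] with ρ h1 h2 a ha
    have r1 : 1 ≤ ρ := (le_max_left _ _).trans h2
    have r2 : R ≤ ρ := ((le_max_left _ _).trans (le_max_right _ _)).trans h2
    have r3 : 4 / κ * (|B₁| + 2 * |B₂|) ≤ ρ :=
      ((le_max_right _ _).trans (le_max_right _ _)).trans h2
    have hpow : ρ ^ 2 ≤ ρ ^ γ := by
      rw [← Real.rpow_natCast]
      exact Real.rpow_le_rpow_of_exponent_le r1 (by exact_mod_cast hγ)
    have hpos : 0 ≤ ρ ^ γ := Real.rpow_nonneg (by linarith) _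
    rw [Real.norm_eq_abs, Real.norm_eq_abs, abs_of_nonneg hpos] at h1
    have h3 := (abs_le.1 h1).1
    have b1 : |h a| ≤ |B₁| := (hB₁ a ha).trans (le_abs_self _)
    have b2 : |deriv h a| ≤ |B₂| := (hB₂ a ha).trans (le_abs_self _)
    have ha0 : 0 < a := hδ.trans_le ha.1
    have haρ : a ≤ ρ := ha.2.trans r2
    have b3 : deriv h a * (ρ - a) ≤ |B₂| * ρ := by
      refine (le_abs_self _).trans ?_
      rw [abs_mul, abs_of_nonneg (sub_nonneg.2 haρ)]
      exact mul_le_mul b2 (by linarith) (by linarith) (abs_nonneg _)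
    have r4 : |B₁| + 2 * |B₂| ≤ κ / 4 * ρ := by
      have := mul_le_mul_of_nonneg_left r3 (by positivity : 0 ≤ κ / 4)
      rwa [← mul_assoc, show κ / 4 * (4 / κ) = 1 by field_simp, one_mul] at this
    have h4 : κ / 2 * ρ ^ 2 ≤ h ρ := by nlinarith
    have h5 : (ρ - a) ^ 2 ≤ ρ ^ 2 := by nlinarith
    unfold relh
    have b4 := (abs_le.1 b1).2
    have h6 : (|B₁| + 2 * |B₂|) * ρ ≤ κ / 4 * ρ * ρ := mul_le_mul_of_nonneg_right r4 (by linarith)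
    nlinarith [mul_nonneg (abs_nonneg B₁) (by linarith : (0 : ℝ) ≤ ρ - 1),
      mul_nonneg (abs_nonneg B₂) (by linarith : (0 : ℝ) ≤ ρ)]
  obtain ⟨M₀, hM₀⟩ := eventually_atTop.1 hlarge
  -- R + 1 places a strictly below M, as the quadratic estimate wants an interior base point; δ + 1
  -- keeps the interval [δ/2, M] nondegenerate even when R < δ.
  set M := max (max M₀ (R + 1)) (δ + 1) with hM
  have hM1 : M₀ ≤ M := (le_max_left _ _).trans (le_max_left _ _)
  have hM2 : R + 1 ≤ M := (le_max_right _ _).trans (le_max_left _ _)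
  have hM3 : δ + 1 ≤ M := le_max_right _ _
  obtain ⟨c, hc, hcq⟩ := H.relh_quadratic (half_pos hδ) (M := M) (by linarith)
  refine ⟨min (κ / 4) (min c (c * (δ / 2) ^ 2 / M ^ 2)), by
    have : 0 < M := by linarith
    positivity, fun ρ hρ a ha => ?_⟩
  have ham : a ∈ Ioo (δ / 2) M := ⟨by linarith [ha.1], by linarith [ha.2]⟩
  rcases le_or_gt M ρ with h1 | h1
  · exact (mul_le_mul_of_nonneg_right (min_le_left _ _) (sq_nonneg _)).trans
      (hM₀ ρ (hM1.trans h1) a ha)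
  rcases le_or_gt (δ / 2) ρ with h2 | h2
  · exact (mul_le_mul_of_nonneg_right ((min_le_right _ _).trans (min_le_left _ _))
      (sq_nonneg _)).trans (hcq ρ ⟨h2, h1.le⟩ a ham)
  · refine (mul_le_mul_of_nonneg_right ((min_le_right _ _).trans (min_le_right _ _))
      (sq_nonneg _)).trans ?_
    have hMp : 0 < M := by linarith
    have e1 : (ρ - a) ^ 2 ≤ M ^ 2 := by nlinarith [ha.1, ham.2]
    have e2 : c * (δ / 2) ^ 2 / M ^ 2 * (ρ - a) ^ 2 ≤ c * (δ / 2) ^ 2 := by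
      rw [div_mul_eq_mul_div, div_le_iff₀ (by positivity)]
      exact mul_le_mul_of_nonneg_left e1 (by positivity)
    have e3 := hcq (δ / 2) ⟨le_rfl, by linarith⟩ a ham
    have e4 : (δ / 2) ^ 2 ≤ (δ / 2 - a) ^ 2 := by nlinarith [ha.1]
    have e5 := H.tangent_le hρ (half_pos hδ)
    have e6 := H.tangent_le (ρ := δ / 2) (by linarith) (hδ.trans_le ha.1)
    have e7 := H.tangent_le (hδ.trans_le ha.1).le (half_pos hδ)
    -- Monotonicity of h', from adding the tangent inequalities at δ/2 and at a. With the tangent at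
    -- δ/2 it shows that moving ρ below δ/2 does not decrease the relative potential.
    have e8 : deriv h (δ / 2) ≤ deriv h a := by
      have : 0 < a - δ / 2 := by linarith [ha.1]
      nlinarith
    have e9 : relh h (δ / 2) a ≤ relh h ρ a := by
      unfold relh
      nlinarith
    nlinarith

end Thermo

/-! ### Pointwise algebra -/

section Algebra

/-- The bilinear form with matrix `D`. -/
def bil (D : Fin d → Fin d → ℝ) (x y : Fin d → ℝ) : ℝ := ∑ i, ∑ j, x i * y j * D i j

/-- The dot product. -/
def dot (x y : Fin d → ℝ) : ℝ := ∑ i, x i * y i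

lemma dot_comm (x y : Fin d → ℝ) : dot x y = dot y x :=
  Finset.sum_congr rfl fun _ _ => mul_comm _ _

lemma bil_sub_smul (D : Fin d → Fin d → ℝ) (x y : Fin d → ℝ) (c : ℝ) :
    bil D (fun i => x i - c * y i) (fun i => x i - c * y i)
      = bil D x x - c * bil D x y - c * bil D y x + c ^ 2 * bil D y y := by
  simp only [bil, Finset.mul_sum, ← Finset.sum_sub_distrib, ← Finset.sum_add_distrib]
  exact Finset.sum_congr rfl fun i _ => Finset.sum_congr rfl fun j _ => by ring

lemma dot_sub_left (x y z : Fin d → ℝ) : dot (fun i => x i - y i) z = dot x z - dot y z := by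
  simp only [dot, ← Finset.sum_sub_distrib]
  exact Finset.sum_congr rfl fun i _ => by ring

lemma dot_sub_self (x y : Fin d → ℝ) :
    dot (fun i => x i - y i) (fun i => x i - y i) = dot x x - 2 * dot x y + dot y y := by
  rw [dot_sub_left, dot_comm x, dot_comm y, dot_sub_left, dot_sub_left, dot_comm y x]
  ring

variable {m u q qb dtu dtq : Fin d → ℝ} {du dd S : Fin d → Fin d → ℝ}
  {ddu ddd : Fin d → Fin d → Fin d → ℝ} {ρ ρb dtρ D C e P Pb π' h₁ h₂ a b : ℝ}

/-- The cancellation at the heart of the method, at a single point, with a = θ' and b = θ. The left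
side adds the integrands of the energy balance and of the seven tested identities, with the signs
dictated by the expanded relative energy. On the right, θ' multiplies the relative energy density
and θ only terms of second order in the differences. -/
lemma relative_energy_algebra
    (hS : ∀ i j, S i j = (if i = j then - P - C / 2 * dot q q + D else 0) - C * (q i * q j))
    (hdtu : ∀ i, dtu i = C * ∑ k, ddd k k i - h₂ * qb i - ∑ j, u j * du i j)
    (hdtq : ∀ i, dtq i + ∑ j, ((dd j i * u j + qb j * du j i) + (qb i * du j j + ρb * ddu j j i))
      = 0)
    (hmass : dtρ + ∑ j, (qb j * u j + ρb * du j j) = 0) (hπ : π' = ρb * h₂)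
    (hvac : ρ = 0 → ∀ i, m i = 0) :
    a * e
      - ((∑ i, m i * (a * u i + b * dtu i)) + (∑ i, ∑ j, m i * m j / ρ * (b * du i j))
          - ∑ i, ∑ j, S i j * (b * du i j))
      + (ρ * (a * (1 / 2 * ∑ i, u i * u i) + b * ∑ i, u i * dtu i)
          + ∑ j, m j * (b * ∑ i, u i * du i j))
      - (ρ * (a * h₁ + b * (h₂ * dtρ)) + ∑ j, m j * (b * (h₂ * qb j)))
      + C * (∑ j, m j * (b * ∑ k, ddd k k j)
          - (∑ k, q k * (a * qb k) + ∑ k, q k * (b * dtq k)))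
      + (a * (Pb + C / 2 * ∑ k, qb k * qb k)
        + b * ((π' * dtρ + 2 * (C / 2) * ∑ k, qb k * dtq k)
          + ∑ i, ((π' * qb i + 2 * (C / 2) * ∑ k, qb k * dd i k) * u i
            + (Pb + C / 2 * ∑ k, qb k * qb k) * du i i)))
      - C * (ρ * (b * ∑ i, ∑ j, (ddd i i j * u j - qb j * ddu i i j))
          + ∑ i, q i * (b * ∑ j, (dd j i * u j - qb j * du i j)))
      - (D * (b * ∑ j, du j j) + ∑ i, ρ * (C * q i) * (b * ∑ j, ddu j j i))
    = a * (e - dot m u + ρ * (1 / 2 * dot u u - h₁) - C * dot q qb + Pb + C / 2 * dot qb qb)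
      + b * (- (bil du (fun i => m i - ρ * u i) (fun i => m i - ρ * u i) / ρ)
        - (P - Pb - π' * (ρ - ρb)) * ∑ j, du j j
        - C * (bil du (fun i => q i - qb i) (fun i => q i - qb i)
          + 1 / 2 * dot (fun i => q i - qb i) (fun i => q i - qb i) * ∑ j, du j j
          + (ρ - ρb) * dot (fun i => q i - qb i) (fun i => ∑ j, ddu j j i))) := by
  have c1 : ∑ i, m i * (a * u i + b * dtu i) = a * dot m u + b * dot m dtu := by
    simp only [dot, Finset.mul_sum, ← Finset.sum_add_distrib]
    exact Finset.sum_congr rfl fun i _ => by ring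
  have c2 : ∑ i, ∑ j, m i * m j / ρ * (b * du i j) = b * (bil du m m / ρ) := by
    simp only [bil, Finset.mul_sum, Finset.sum_div]
    exact Finset.sum_congr rfl fun i _ => Finset.sum_congr rfl fun j _ => by ring
  have c3 : ∑ i, ∑ j, S i j * (b * du i j)
      = b * ((- P - C / 2 * dot q q + D) * ∑ j, du j j - C * bil du q q) := by
    simp only [bil, hS, sub_mul, Finset.sum_sub_distrib, ite_mul, zero_mul, Finset.sum_ite_eq,
      Finset.mem_univ, if_true, Finset.mul_sum, mul_sub]
    congr 1
    · exact Finset.sum_congr rfl fun i _ => by ring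
    · exact Finset.sum_congr rfl fun i _ => Finset.sum_congr rfl fun j _ => by ring
  have c4 : ∑ j, m j * (b * ∑ i, u i * du i j) = b * bil du u m := by
    simp only [bil, Finset.mul_sum]
    rw [Finset.sum_comm]
    exact Finset.sum_congr rfl fun i _ => Finset.sum_congr rfl fun j _ => by ring
  have c5 : ∑ j, m j * (b * (h₂ * qb j)) = b * h₂ * dot m qb := by
    simp only [dot, Finset.mul_sum]
    exact Finset.sum_congr rfl fun i _ => by ring
  have c6 : ∑ j, m j * (b * ∑ k, ddd k k j) = b * dot m (fun i => ∑ k, ddd k k i) := by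
    simp only [dot, Finset.mul_sum]
    exact Finset.sum_congr rfl fun i _ => Finset.sum_congr rfl fun j _ => by ring
  have c7 : ∀ (c : ℝ) (y : Fin d → ℝ), ∑ k, q k * (c * y k) = c * dot q y := fun c y => by
    simp only [dot, Finset.mul_sum]
    exact Finset.sum_congr rfl fun i _ => by ring
  have c8 : ∑ i, ((π' * qb i + 2 * (C / 2) * ∑ k, qb k * dd i k) * u i
            + (Pb + C / 2 * ∑ k, qb k * qb k) * du i i)
      = π' * dot qb u + C * bil dd u qb + (Pb + C / 2 * dot qb qb) * ∑ j, du j j := by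
    rw [Finset.sum_add_distrib, ← Finset.mul_sum]
    congr 1
    simp only [bil, dot, Finset.mul_sum, ← Finset.sum_add_distrib, add_mul, Finset.sum_mul]
    refine Finset.sum_congr rfl fun i _ => ?_
    congr 1
    · ring
    · exact Finset.sum_congr rfl fun j _ => by ring
  have c9 : ∑ i, ∑ j, (ddd i i j * u j - qb j * ddu i i j)
      = dot u (fun i => ∑ k, ddd k k i) - dot qb (fun i => ∑ j, ddu j j i) := by
    simp only [dot, Finset.mul_sum, ← Finset.sum_sub_distrib]
    rw [Finset.sum_comm]
    exact Finset.sum_congr rfl fun i _ => Finset.sum_congr rfl fun j _ => by ring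
  have c10 : ∑ i, q i * (b * ∑ j, (dd j i * u j - qb j * du i j))
      = b * (bil dd u q - bil du q qb) := by
    have : bil dd u q = ∑ i, ∑ j, u j * q i * dd j i := by rw [bil, Finset.sum_comm]
    rw [this]
    simp only [bil, Finset.mul_sum, ← Finset.sum_sub_distrib]
    exact Finset.sum_congr rfl fun i _ => Finset.sum_congr rfl fun j _ => by ring
  have c11 : ∑ i, ρ * (C * q i) * (b * ∑ j, ddu j j i)
      = b * ρ * C * dot q (fun i => ∑ j, ddu j j i) := by
    simp only [dot, Finset.mul_sum]
    exact Finset.sum_congr rfl fun i _ => Finset.sum_congr rfl fun j _ => by ring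
  have d1 : ∀ x : Fin d → ℝ, dot x dtu = C * dot x (fun i => ∑ k, ddd k k i) - h₂ * dot x qb
      - bil du x u := fun x => by
    simp only [dot, bil, hdtu, Finset.mul_sum, ← Finset.sum_sub_distrib, mul_sub]
    refine Finset.sum_congr rfl fun i _ => ?_
    congr 1
    · congr 1
      · exact Finset.sum_congr rfl fun j _ => by ring
      · ring
    · exact Finset.sum_congr rfl fun j _ => by ring
  have d2 : ∀ x : Fin d → ℝ, dot x dtq = - bil dd u x - bil du qb x - dot x qb * ∑ j, du j j
      - ρb * dot x (fun i => ∑ j, ddu j j i) := fun x => by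
    have e1 : ∀ i, dtq i = - ∑ j, ((dd j i * u j + qb j * du j i)
        + (qb i * du j j + ρb * ddu j j i)) := fun i => by linarith [hdtq i]
    have e2 : bil dd u x = ∑ i, ∑ j, u j * x i * dd j i := by rw [bil, Finset.sum_comm]
    have e3 : bil du qb x = ∑ i, ∑ j, qb j * x i * du j i := by rw [bil, Finset.sum_comm]
    have e4 : dot x qb * ∑ j, du j j = ∑ i, ∑ j, x i * qb i * du j j := Finset.sum_mul_sum ..
    rw [e2, e3, e4]
    simp only [dot, e1, Finset.mul_sum, ← Finset.sum_sub_distrib,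
      ← Finset.sum_neg_distrib, mul_neg]
    refine Finset.sum_congr rfl fun i _ => Finset.sum_congr rfl fun j _ => by ring
  have d3 : dtρ + dot qb u + ρb * ∑ j, du j j = 0 := by
    rw [← hmass, Finset.sum_add_distrib, ← Finset.mul_sum, dot]
    ring
  -- On the vacuum both sides vanish because m = 0 there and division by zero gives zero.
  have d4 : bil du (fun i => m i - ρ * u i) (fun i => m i - ρ * u i) / ρ
      = bil du m m / ρ - bil du m u - bil du u m + ρ * bil du u u := by
    by_cases h0 : ρ = 0
    · have hm := hvac h0
      subst h0
      simp [bil, hm]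
    · rw [bil_sub_smul]
      field_simp
  have d5 : bil du (fun i => q i - qb i) (fun i => q i - qb i)
      = bil du q q - bil du q qb - bil du qb q + bil du qb qb := by
    have := bil_sub_smul du q qb 1
    simp only [one_mul, one_pow] at this
    exact this
  have f1 : ∑ i, u i * u i = dot u u := rfl
  have f2 : ∑ i, u i * dtu i = dot u dtu := rfl
  have f3 : ∑ i, qb i * qb i = dot qb qb := rfl
  have f4 : ∑ i, qb i * dtq i = dot qb dtq := rfl
  -- The strong equations eliminate the time derivatives of ū and ∇ρ̄, and below also of ρ̄. In
  -- terms of the pairings `dot` and `bil` a ring identity remains.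
  rw [c8, c1, c2, c3, c4, c5, c6, c7, c7, c9, c10, c11, d4, d5, f1, f2, f3, f4, d1, d1, d2, d2,
    dot_sub_self, dot_sub_left, dot_comm u qb, hπ]
  generalize (∑ j, du j j) = dv at *
  have hd : dtρ = - dot qb u - ρb * dv := by linarith
  rw [hd]
  ring

end Algebra

/-! ### The relative energy density -/

section Density

variable {h : ℝ → ℝ} {C : ℝ}

lemma dot_self_eq (q : Vec d) : dot q q = ‖q‖ ^ 2 := (norm_sq_eq q).symm

lemma relF_constCapillarity (ρ ρ' : ℝ) (q q' : Vec d) :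
    relF (constCapillarity d h C) ρ q ρ' q' = relh h ρ ρ' + C / 2 * ‖q - q'‖ ^ 2 := by
  have h1 : ‖q - q'‖ ^ 2 = ‖q‖ ^ 2 - 2 * inner ℝ q q' + ‖q'‖ ^ 2 := norm_sub_sq_real q q'
  rw [relF, Fρ_constCapillarity, Fq_constCapillarity, relh, h1, inner_smul_left, inner_sub_right,
    real_inner_self_eq_norm_sq, real_inner_comm]
  simp only [constCapillarity, conj_trivial]
  ring

lemma relDensity_eq (W : WeakFields d) (V : StrongFields d) {t : ℝ} {x : Torus d}
    (hV : 0 < V.ρ t x) : relDensity (constCapillarity d h C) W V t x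
      = 1 / 2 * W.ρ t x * ‖(W.ρ t x)⁻¹ • W.m t x - V.u t x‖ ^ 2
        + relh h (W.ρ t x) (V.ρ t x) + C / 2 * ‖W.gradρ t x - V.gradρ t x‖ ^ 2 := by
  rw [relDensity, relEnergyDensity, relF_constCapillarity, StrongFields.m, smul_smul,
    inv_mul_cancel₀ hV.ne', one_smul, add_assoc]

/-- Apart from the energy density, this form is affine in the weak fields. Integrability, continuity
in time and the evolution of the relative energy are all obtained from it. -/
lemma relDensity_expand (W : WeakFields d) (V : StrongFields d) {t : ℝ} {x : Torus d}
    (hV : 0 < V.ρ t x) (hvac : W.ρ t x = 0 → W.m t x = 0) :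
    relDensity (constCapillarity d h C) W V t x
      = W.e (constCapillarity d h C) t x - dot (W.m t x) (V.u t x)
        + W.ρ t x * (1 / 2 * dot (V.u t x) (V.u t x) - deriv h (V.ρ t x))
        - C * dot (W.gradρ t x) (V.gradρ t x) + press h (V.ρ t x)
        + C / 2 * dot (V.gradρ t x) (V.gradρ t x) := by
  have h1 : ‖W.gradρ t x - V.gradρ t x‖ ^ 2 = ‖W.gradρ t x‖ ^ 2
      - 2 * dot (W.gradρ t x) (V.gradρ t x) + dot (V.gradρ t x) (V.gradρ t x) := by
    rw [norm_sub_sq_real, inner_eq, dot_self_eq]; rfl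
  have h2 : W.ρ t x * ‖(W.ρ t x)⁻¹ • W.m t x - V.u t x‖ ^ 2 = ‖W.m t x‖ ^ 2 / W.ρ t x
      - 2 * dot (W.m t x) (V.u t x) + W.ρ t x * dot (V.u t x) (V.u t x) := by
    by_cases h0 : W.ρ t x = 0
    · simp [h0, hvac h0, dot]
    · rw [norm_sub_sq_real, inner_smul_left, inner_eq, dot_self_eq, norm_smul, mul_pow]
      simp only [norm_inv, Real.norm_eq_abs, inv_pow, sq_abs, conj_trivial]
      unfold dot
      field_simp
  rw [relDensity_eq W V hV, h1, mul_assoc, h2, WeakFields.e, energyDensity, constCapillarity, relh,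
    press]
  ring

lemma stress_eq (W : WeakFields d) (i j : Fin d) (t : ℝ) (x : Torus d) :
    W.S (constCapillarity d h C) i j t x
      = (if i = j then - press h (W.ρ t x) - C / 2 * dot (W.gradρ t x) (W.gradρ t x)
          + W.divr t x else 0) - C * (W.gradρ t x i * W.gradρ t x j) := by
  rw [WeakFields.S, stress, Fρ_constCapillarity, Fq_constCapillarity, inner_smul_right,
    real_inner_self_eq_norm_sq, dot_self_eq]
  simp only [constCapillarity, press, PiLp.smul_apply, smul_eq_mul]
  split_ifs <;> ring

lemma r_eq (W : WeakFields d) (i : Fin d) (t : ℝ) (x : Torus d) :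
    W.r (constCapillarity d h C) t x i = W.ρ t x * (C * W.gradρ t x i) := by
  rw [WeakFields.r, Fq_constCapillarity]
  simp

end Density

/-! ### Integrability of the energy of a weak solution -/

/-- Replace the null measurable set by a measurable subset of full relative measure and apply Fubini
to it. It is used to bring the vacuum condition, assumed at every time, to space-time. -/
lemma ae_prod_of_ae_ae {α β : Type*} [MeasurableSpace α] [MeasurableSpace β] {μ : Measure α}
    {ν : Measure β} [SFinite μ] [SFinite ν] {P : α × β → Prop}
    (hP : NullMeasurableSet {z | P z} (μ.prod ν)) (h : ∀ᵐ t ∂μ, ∀ᵐ x ∂ν, P (t, x)) :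
    ∀ᵐ z ∂(μ.prod ν), P z := by
  obtain ⟨s, hsub, hs, hae⟩ := hP.exists_measurable_subset_ae_eq
  have h1 : ∀ᵐ z ∂(μ.prod ν), P z → z ∈ s := by
    filter_upwards [hae.mem_iff] with z hz hp
    exact hz.2 hp
  have h2 : ∀ᵐ z ∂(μ.prod ν), z ∈ s := by
    rw [Measure.ae_prod_mem_iff_ae_ae_mem hs]
    filter_upwards [h, Measure.ae_ae_of_ae_prod h1] with t ht ht'
    filter_upwards [ht, ht'] with x hx hx'
    exact hx' hx
  filter_upwards [h2] with z hz
  exact hsub hz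

lemma integrable_mul_continuous {w g : Torus d → ℝ} (hw : Integrable w (dx d))
    (hg : Continuous g) : Integrable (fun x => w x * g x) (dx d) := by
  obtain ⟨M, hM⟩ := isCompact_univ.exists_bound_of_continuousOn hg.continuousOn
  exact hw.mul_bdd hg.aestronglyMeasurable (Eventually.of_forall fun x => hM x (mem_univ _))

section WeakEnergy

variable {h : ℝ → ℝ} {A C : ℝ} {W : WeakFields d}

lemma energy_lower {ρ : ℝ} (hρ : 0 ≤ ρ) (m q : Vec d) :
    h ρ + C / 2 * ‖q‖ ^ 2 ≤ energyDensity (constCapillarity d h C) ρ m q := by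
  have : 0 ≤ ‖m‖ ^ 2 / ρ := by positivity
  unfold energyDensity constCapillarity
  linarith

namespace IsWeakSolution

lemma aesm_grad (hW : IsWeakSolution (constCapillarity d h C) W) {t : ℝ} (ht : 0 ≤ t) (i : Fin d) :
    AEStronglyMeasurable (fun x => W.gradρ t x i) (dx d) :=
  ((hW.grad t ht).integrable_grad i).aestronglyMeasurable

/-- The kinetic energy is non-negative and h ≥ -K(1 + ρ), so the energy plus K(1 + ρ) dominates
(C/2)|∇ρ|². -/
lemma sq_grad_le (hW : IsWeakSolution (constCapillarity d h C) W) (H : Thermo h A) (hC : 0 < C) :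
    ∃ K, 0 < K ∧ ∀ t, 0 ≤ t → ∀ᵐ x ∂(dx d), ∑ i, W.gradρ t x i * W.gradρ t x i
      ≤ 2 / C * (W.e (constCapillarity d h C) t x + K * (1 + W.ρ t x)) := by
  obtain ⟨K, hK, hlow⟩ := H.exists_neg_le
  refine ⟨K, hK, fun t ht => ?_⟩
  filter_upwards [hW.nonneg t ht] with x hx
  have h1 := energy_lower (h := h) (C := C) hx (W.m t x) (W.gradρ t x)
  have h4 : W.e (constCapillarity d h C) t x
    = energyDensity (constCapillarity d h C) (W.ρ t x) (W.m t x) (W.gradρ t x) := rfl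
  rw [← norm_sq_eq, div_mul_eq_mul_div, le_div_iff₀ hC]
  linarith [hlow _ hx]

lemma integrable_sq_grad (hW : IsWeakSolution (constCapillarity d h C) W) (H : Thermo h A)
    (hC : 0 < C) (hE : IsContL1 (W.e (constCapillarity d h C))) {t : ℝ} (ht : 0 ≤ t) :
    Integrable (fun x => ∑ i, W.gradρ t x i * W.gradρ t x i) (dx d) := by
  obtain ⟨K, hK, hle⟩ := hW.sq_grad_le H hC
  refine (((hE.integrable t ht).add (((integrable_const 1).add
    (hW.cont_ρ.integrable t ht)).const_mul K)).const_mul (2 / C)).mono' ?_ ?_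
  · exact Finset.aestronglyMeasurable_fun_sum _ fun i _ =>
      (hW.aesm_grad ht i).mul (hW.aesm_grad ht i)
  · filter_upwards [hle t ht] with x hx
    rw [Real.norm_of_nonneg (Finset.sum_nonneg fun i _ => mul_self_nonneg _)]
    exact hx

lemma exists_sq_grad_bound (hW : IsWeakSolution (constCapillarity d h C) W) (H : Thermo h A)
    (hC : 0 < C) (hE : IsContL1 (W.e (constCapillarity d h C))) (T : ℝ) :
    ∃ M, ∀ t ∈ Icc 0 T, ∫ x, ∑ i, W.gradρ t x i * W.gradρ t x i ∂(dx d) ≤ M := by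
  obtain ⟨K, hK, hle⟩ := hW.sq_grad_le H hC
  obtain ⟨M₁, hM₁⟩ := (isCompact_Icc (a := (0 : ℝ)) (b := T)).exists_bound_of_continuousOn
    (hE.continuousOn_integral.mono fun t ht => ht.1)
  obtain ⟨M₂, hM₂⟩ := (isCompact_Icc (a := (0 : ℝ)) (b := T)).exists_bound_of_continuousOn
    (hW.cont_ρ.continuousOn_integral.mono fun t ht => ht.1)
  refine ⟨2 / C * (M₁ + K * (1 + M₂)), fun t ht => ?_⟩
  have i1 := hE.integrable t ht.1
  have i2 := hW.cont_ρ.integrable t ht.1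
  refine (integral_mono_ae (hW.integrable_sq_grad H hC hE ht.1) ((i1.add (((integrable_const
    1).add i2).const_mul K)).const_mul (2 / C)) (hle t ht.1)).trans ?_
  have e1 : ∫ x, (W.e (constCapillarity d h C) t x + K * (1 + W.ρ t x)) ∂(dx d)
      = ∫ x, W.e (constCapillarity d h C) t x ∂(dx d) + K * (1 + ∫ x, W.ρ t x ∂(dx d)) := by
    have i3 : Integrable (fun x => K * (1 + W.ρ t x)) (dx d) :=
      ((integrable_const 1).add i2).const_mul K
    rw [integral_add i1 i3, integral_const_mul,
      integral_add (integrable_const 1) i2]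
    simp
  have e2 := (integral_const_mul (2 / C) (fun x => W.e (constCapillarity d h C) t x
    + K * (1 + W.ρ t x)) (μ := dx d))
  refine e2.le.trans ?_
  rw [e1]
  refine mul_le_mul_of_nonneg_left ?_ (by positivity)
  have := (le_abs_self _).trans (hM₁ t ht)
  have := (le_abs_self _).trans (hM₂ t ht)
  gcongr

lemma integrable_abs_grad_le (hW : IsWeakSolution (constCapillarity d h C) W) (H : Thermo h A)
    (hC : 0 < C) (hE : IsContL1 (W.e (constCapillarity d h C))) (T : ℝ) :
    ∃ M, ∀ t ∈ Icc 0 T, ∀ i, ∫ x, |W.gradρ t x i| ∂(dx d) ≤ M := by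
  obtain ⟨M, hM⟩ := hW.exists_sq_grad_bound H hC hE T
  refine ⟨1 + M, fun t ht i => ?_⟩
  have i1 := hW.integrable_sq_grad H hC hE ht.1
  refine (integral_mono ((hW.grad t ht.1).integrable_grad i).abs ((integrable_const 1).add i1)
    fun x => ?_).trans ?_
  · have h1 : W.gradρ t x i * W.gradρ t x i ≤ ∑ i, W.gradρ t x i * W.gradρ t x i :=
      Finset.single_le_sum (f := fun i => W.gradρ t x i * W.gradρ t x i)
        (fun i _ => mul_self_nonneg _) (Finset.mem_univ i)
    simp only [Pi.add_apply]
    nlinarith [sq_abs (W.gradρ t x i), sq_nonneg (|W.gradρ t x i| - 1)]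
  · simp only [Pi.add_apply]
    rw [integral_add (integrable_const 1) i1]
    simpa using hM t ht

/-- Integrability of ∇ρ is given at each time only; the energy supplies a bound uniform in time. -/
lemma integrable_grad_dtdx (hW : IsWeakSolution (constCapillarity d h C) W) (H : Thermo h A)
    (hC : 0 < C) (hE : IsContL1 (W.e (constCapillarity d h C))) (T : ℝ) (i : Fin d) :
    Integrable (fun z : ℝ × Torus d => W.gradρ z.1 z.2 i) (dtdx d (Ioo 0 T)) := by
  have hm := (hW.measurable_grad i).mono_measure
    (dtdx_mono (d := d) (fun t (ht : t ∈ Ioo 0 T) => ht.1.le : Ioo 0 T ⊆ Ici 0))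
  obtain ⟨M, hM⟩ := hW.integrable_abs_grad_le H hC hE T
  unfold dtdx at hm ⊢
  rw [integrable_prod_iff hm]
  constructor
  · filter_upwards [ae_restrict_mem measurableSet_Ioo] with t ht
      using (hW.grad t ht.1.le).integrable_grad i
  · refine Integrable.of_bound hm.norm.integral_prod_right' M ?_
    filter_upwards [ae_restrict_mem measurableSet_Ioo] with t ht
    rw [Real.norm_of_nonneg (integral_nonneg fun x => norm_nonneg _)]
    exact hM t (Ioo_subset_Icc_self ht) i

lemma ae_vacuum {F : ℝ → Vec d → ℝ} (hW : IsWeakSolution F W) (T : ℝ) :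
    ∀ᵐ z ∂(dtdx d (Ioo 0 T)), W.ρ z.1 z.2 = 0 → W.m z.1 z.2 = 0 := by
  have hρ := (hW.cont_ρ.integrable_dtdx T).aestronglyMeasurable
  have hm := fun i => ((hW.cont_m i).integrable_dtdx T).aestronglyMeasurable
  have hset : {z : ℝ × Torus d | W.ρ z.1 z.2 = 0 → W.m z.1 z.2 = 0}
      = {z | W.ρ z.1 z.2 = 0}ᶜ ∪ ⋂ i, {z | W.m z.1 z.2 i = 0} := by
    ext z
    simp only [mem_ofPred_eq, mem_union, mem_compl_iff, mem_iInter, imp_iff_not_or]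
    refine or_congr Iff.rfl ⟨fun h i => by rw [h]; rfl, fun h => ?_⟩
    ext i
    exact h i
  refine ae_prod_of_ae_ae ?_ ?_
  · rw [hset]
    refine NullMeasurableSet.union (NullMeasurableSet.compl ?_) (NullMeasurableSet.iInter fun i => ?_)
    · exact hρ.nullMeasurableSet_eq_fun aestronglyMeasurable_const
    · exact (hm i).nullMeasurableSet_eq_fun aestronglyMeasurable_const
  · filter_upwards [ae_restrict_mem measurableSet_Ioo] with t ht using hW.vacuum t ht.1.le

end IsWeakSolution

end WeakEnergy

/-! ### The energy inequality -/

section EnergyInequality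

variable {F : ℝ → Vec d → ℝ} {W : WeakFields d} {T ε : ℝ} {θ : ℝ → ℝ}

lemma HypWeak.isWeakSolution (hW : HypWeak F T W) : IsWeakSolution F W :=
  hW.solution.elim (fun h => h.toIsWeakSolution) fun h => h.toIsWeakSolution

lemma HypWeak.cont_energy (hW : HypWeak F T W) : IsContL1 (W.e F) :=
  hW.solution.elim (fun h => h.cont_energy) fun h => h.cont_energy

lemma HypWeak.energy_le (hW : HypWeak F T W) {θ : ℝ → ℝ} (hθ : IsTimeTest ⊤ θ) :
    - ∫ t in Ioi 0, (∫ x, W.e F t x ∂(dx d)) * deriv θ t ≤ (∫ x, W.e F 0 x ∂(dx d)) * θ 0 :=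
  hW.solution.elim (fun h => h.energy_le θ hθ) fun h => (h.energy_eq θ hθ).le

lemma TimeCutoff.isTimeTest (hθ : TimeCutoff T ε θ) (hnn : ∀ t, 0 ≤ θ t) : IsTimeTest ⊤ θ where
  lipschitz := by
    obtain ⟨a, b, _, _, hs⟩ := hθ.support
    have hc : HasCompactSupport θ := HasCompactSupport.intro isCompact_Icc fun t ht => hs t ht
    exact (hθ.smooth.of_le (by simp : (1 : WithTop ℕ∞) ≤ ∞)).lipschitzWith_of_hasCompactSupport
      hc (by simp)
  nonneg t _ := hnn t
  compactSupport := ⟨T - ε, EReal.coe_lt_top _, fun t ht => hθ.eq_zero fun h => by linarith [h.2]⟩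

/-- The cutoff vanishes at time 0, so the dissipation inequality loses its initial term. -/
lemma HypWeak.energy_identity (hW : HypWeak F T W) (hε : 0 < ε) (hθ : TimeCutoff T ε θ)
    (hnn : ∀ t, 0 ≤ θ t) :
    Integrable (fun z : ℝ × Torus d => deriv θ z.1 * W.e F z.1 z.2) (dtdx d (Ioo ε (T - ε))) ∧
    0 ≤ ∫ z, deriv θ z.1 * W.e F z.1 z.2 ∂(dtdx d (Ioo ε (T - ε))) := by
  have hint : Integrable (fun z : ℝ × Torus d => deriv θ z.1 * W.e F z.1 z.2)
      (dtdx d (Ioo ε (T - ε))) :=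
    ((hθ.deriv.bTend _).integrable_mul (integrable_inner hε
      (hW.cont_energy.integrable_dtdx T))).congr (Eventually.of_forall fun z => mul_comm _ _)
  refine ⟨hint, ?_⟩
  have h1 := hW.energy_le (hθ.isTimeTest hnn)
  rw [hθ.eq_zero (t := 0) (fun h => by linarith [h.1]), mul_zero,
    setIntegral_eq_of_subset_of_forall_sdiff_eq_zero measurableSet_Ioi
      (inner_subset_Ioi hε (T := T)) fun t ht => by rw [hθ.deriv.eq_zero ht.2, mul_zero]] at h1
  unfold dtdx at hint ⊢
  rw [integral_prod _ hint]
  simp only [integral_const_mul]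
  simp only [mul_comm (_root_.deriv θ _)]
  linarith

end EnergyInequality

/-! ### The relative energy inequality -/

lemma ZeroInt.transfer {α : Type*} [MeasurableSpace α] {μ : Measure α} {Z f g : α → ℝ}
    (hZ : ZeroInt μ Z) (hf : Integrable f μ ∧ 0 ≤ ∫ z, f z ∂μ) (h : ∀ᵐ z ∂μ, f z + Z z = g z) :
    Integrable g μ ∧ 0 ≤ ∫ z, g z ∂μ := by
  refine ⟨(hf.1.add hZ.1).congr h, ?_⟩
  rw [← integral_congr_ae h, integral_add hf.1 hZ.1, hZ.2, add_zero]
  exact hf.2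

section RelativeEnergy

variable {h : ℝ → ℝ} {A C T δ R : ℝ} {W : WeakFields d} {V : StrongFields d}

/-- The quadratic remainder in the relative energy inequality. -/
def remainder (h : ℝ → ℝ) (C : ℝ) (W : WeakFields d) (V : StrongFields d) (t : ℝ) (x : Torus d) :
    ℝ :=
  - (bil (fun i j => V.du i j t x) (fun i => W.m t x i - W.ρ t x * V.u t x i)
      (fun i => W.m t x i - W.ρ t x * V.u t x i) / W.ρ t x)
    - (press h (W.ρ t x) - press h (V.ρ t x)
        - deriv (press h) (V.ρ t x) * (W.ρ t x - V.ρ t x)) * ∑ j, V.du j j t x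
    - C * (bil (fun i j => V.du i j t x) (fun i => W.gradρ t x i - V.gradρ t x i)
          (fun i => W.gradρ t x i - V.gradρ t x i)
        + 1 / 2 * dot (fun i => W.gradρ t x i - V.gradρ t x i)
            (fun i => W.gradρ t x i - V.gradρ t x i) * ∑ j, V.du j j t x
        + (W.ρ t x - V.ρ t x) * dot (fun i => W.gradρ t x i - V.gradρ t x i)
            (fun i => ∑ j, V.ddu j j i t x))

lemma relative_energy_inequality (H : Thermo h A) (hC : 0 < C) (hT : 0 < T) (hδ : 0 < δ)
    (hV : HypStrong (constCapillarity d h C) T V)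
    (hmem : ∀ t ∈ Icc 0 T, ∀ x, V.ρ t x ∈ Icc δ R)
    (hW : HypWeak (constCapillarity d h C) T W) {ε : ℝ} (hε : 0 < ε) (hεT : ε ≤ T - ε)
    {θ : ℝ → ℝ} (hθ : TimeCutoff T ε θ) (hnn : ∀ t, 0 ≤ θ t) :
    Integrable (fun z : ℝ × Torus d => deriv θ z.1 * relDensity (constCapillarity d h C) W V z.1 z.2
      + θ z.1 * remainder h C W V z.1 z.2) (dtdx d (Ioo ε (T - ε))) ∧
    0 ≤ ∫ z, (deriv θ z.1 * relDensity (constCapillarity d h C) W V z.1 z.2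
      + θ z.1 * remainder h C W V z.1 z.2) ∂(dtdx d (Ioo ε (T - ε))) := by
  obtain ⟨r, v, hA⟩ := exists_approx hT hV hε hmem
  have hS := hW.isWeakSolution
  have hE := hW.cont_energy
  have hq := fun i => integrable_inner hε (hS.integrable_grad_dtdx H hC hE T i)
  have k0 := hW.energy_identity hε hθ hnn
  have k1 := hA.kinetic_identity hS hε hθ
  have k2 := hA.enthalpy_identity hS hε hδ hθ H.smooth_deriv
  have k3 := hA.laplacian_identity hS hε hq hθ
  have k4 := hA.velocity_identity hS hε hθ
  have k6 := hA.pressure_identity hεT hδ hθ H.smooth_press (C / 2)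
  have k7 := hA.gradient_identity hS hε hq hθ
  have k8 := hA.divergence_identity hS hε hT hθ
  -- Together `k1`, `k2` and `k3` amount to the continuity equation tested with ½|ū|² - h'(ρ̄) +
  -- CΔρ̄, and `k4` is momentum against ū: these are minus the variations of the energy at the
  -- strong solution, up to sign conventions. The remaining identities remove third derivatives of
  -- ρ̄ and the divergence of ρ F_q.
  have k := (((((k1.sub k4).sub k2).add (k3.const_mul C)).add k6).sub (k7.const_mul C)).sub k8
  have hmono := ae_mono (dtdx_inner_le (d := d) (T := T) hε)
  have hin : ∀ᵐ z ∂(dtdx d (Ioo ε (T - ε))), z.1 ∈ Ioo ε (T - ε) := by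
    rw [dtdx_eq]
    filter_upwards [ae_restrict_mem (measurableSet_Ioo.prod MeasurableSet.univ)] with z hz
    exact hz.1
  have hae := fun i => hmono (hV.velocity_eq hT hδ hmem H.smooth_deriv i)
  have hae2 := fun i => hmono (hV.grad_mass hT hmem i)
  refine k.transfer k0 ?_
  filter_upwards [ae_all_iff.2 hae, ae_all_iff.2 hae2, hmono hV.mass, hmono (hS.ae_vacuum T), hin]
    with z h1 h2 h3 h4 h5
  have hρ : 0 < V.ρ z.1 z.2 :=
    hδ.trans_le (hmem z.1 ⟨hε.le.trans h5.1.le, by linarith [h5.2]⟩ z.2).1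
  have alg := relative_energy_algebra (m := W.m z.1 z.2) (u := V.u z.1 z.2)
    (q := W.gradρ z.1 z.2) (qb := V.gradρ z.1 z.2) (dtu := fun i => V.dtu i z.1 z.2)
    (dtq := fun i => V.dtgradρ i z.1 z.2) (du := fun i j => V.du i j z.1 z.2)
    (dd := fun i j => V.ddρ i j z.1 z.2)
    (S := fun i j => W.S (constCapillarity d h C) i j z.1 z.2)
    (ddu := fun i j k => V.ddu i j k z.1 z.2) (ddd := fun i j k => V.dddρ i j k z.1 z.2)
    (ρ := W.ρ z.1 z.2) (ρb := V.ρ z.1 z.2) (dtρ := V.dtρ z.1 z.2) (D := W.divr z.1 z.2)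
    (C := C) (e := W.e (constCapillarity d h C) z.1 z.2) (P := press h (W.ρ z.1 z.2))
    (Pb := press h (V.ρ z.1 z.2)) (π' := deriv (press h) (V.ρ z.1 z.2))
    (h₁ := deriv h (V.ρ z.1 z.2)) (h₂ := deriv (deriv h) (V.ρ z.1 z.2)) (a := deriv θ z.1)
    (b := θ z.1) (fun i j => stress_eq W i j z.1 z.2) h1 h2 h3 (H.deriv_press hρ)
    (fun h0 i => by rw [h4 h0]; rfl)
  rw [relDensity_expand W V hρ h4]
  refine Eq.trans ?_ alg
  simp only [r_eq]
  ring

end RelativeEnergy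

/-! ### Differential inequalities in the weak sense -/

/-- A smooth primitive of a difference of two translated bumps. -/
lemma exists_timeCutoff {T s t r : ℝ} (hs : 0 < s) (hst : s ≤ t) (hr : 0 < r) (htr : t + r < T) :
    ∃ η : ℝ → ℝ, ContDiff ℝ ∞ η ∧ (∀ x, 0 ≤ η x) ∧ (∀ x, x ∉ Icc 0 r → η x = 0) ∧
      ∫ x, η x = 1 ∧ ∃ θ, TimeCutoff T (min s (T - (t + r)) / 2) θ ∧ (∀ x, 0 ≤ θ x) ∧
        deriv θ = fun x => η (x - s) - η (x - t) := by
  -- Centre and radius r/2 put the support in [0,r], so that the bumps translated to s and t look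
  -- forward in time only.
  let f : ContDiffBump (r / 2) := ⟨r / 4, r / 2, by linarith, by linarith⟩
  let η : ℝ → ℝ := f.normed volume
  have hη : ContDiff ℝ ∞ η := f.contDiff_normed
  have hη0 : ∀ x, 0 ≤ η x := f.nonneg_normed
  have hηs : ∀ x, x ∉ Icc 0 r → η x = 0 := fun x hx => by
    have : x ∉ Function.support η := by
      rw [f.support_normed_eq, Real.ball_eq_Ioo]
      intro h
      have h1 : r / 2 - r / 2 < x := h.1
      have h2 : x < r / 2 + r / 2 := h.2
      exact hx ⟨by linarith, by linarith⟩
    exact Function.notMem_support.1 this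
  have hη1 : ∫ x, η x = 1 := f.integral_normed
  let β : ℝ → ℝ := fun x => ∫ y in (-1 : ℝ)..x, η y
  have hβd : ∀ x, HasDerivAt β (η x) x := fun x =>
    intervalIntegral.integral_hasDerivAt_right (hη.continuous.intervalIntegrable _ _)
      (hη.continuous.stronglyMeasurableAtFilter _ _) hη.continuous.continuousAt
  have hβ : ContDiff ℝ ∞ β := by
    rw [contDiff_infty_iff_deriv]
    refine ⟨fun x => (hβd x).differentiableAt, ?_⟩
    rwa [show deriv β = η from funext fun x => (hβd x).deriv]
  have hmono : Monotone β := monotone_of_deriv_nonneg (fun x => (hβd x).differentiableAt)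
    fun x => by rw [(hβd x).deriv]; exact hη0 x
  -- The primitive β is monotone, and antitone wherever η vanishes; so it is constant on both sides
  -- of [0,r], and the difference of its two translates is supported in [s, t + r].
  have hconst : ∀ {D : Set ℝ}, Convex ℝ D → (∀ x ∈ interior D, η x = 0) →
      ∀ x ∈ D, ∀ y ∈ D, β x = β y := by
    intro D hD h0 x hx y hy
    have h1 : MonotoneOn β D := hmono.monotoneOn D
    have h2 : AntitoneOn β D := antitoneOn_of_deriv_nonpos hD hβ.continuous.continuousOn
      (fun x _ => (hβd x).differentiableAt.differentiableWithinAt)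
      fun x hx => by rw [(hβd x).deriv, h0 x hx]
    rcases le_total x y with h | h
    · exact le_antisymm (h1 hx hy h) (h2 hx hy h)
    · exact le_antisymm (h2 hy hx h) (h1 hy hx h)
  have hleft : ∀ x ≤ 0, β x = β 0 := fun x hx =>
    hconst (convex_Iic 0) (fun y hy => hηs y fun h => by
      rw [interior_Iic] at hy; exact absurd h.1 (not_le.2 hy)) x hx 0 (mem_Iic.2 le_rfl)
  have hright : ∀ x, r ≤ x → β x = β r := fun x hx =>
    hconst (convex_Ici r) (fun y hy => hηs y fun h => by
      rw [interior_Ici] at hy; exact absurd h.2 (not_le.2 hy)) x hx r (mem_Ici.2 le_rfl)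
  have hm : 0 < min s (T - (t + r)) := lt_min hs (by linarith)
  refine ⟨η, hη, hη0, hηs, hη1, fun x => β (x - s) - β (x - t), ⟨?_, s, t + r, ?_, ?_, ?_⟩, ?_, ?_⟩
  · exact (hβ.comp (contDiff_id.sub contDiff_const)).sub
      (hβ.comp (contDiff_id.sub contDiff_const))
  · exact (half_lt_self hm).trans_le (min_le_left _ _)
  · have := (half_lt_self hm).trans_le (min_le_right s (T - (t + r)))
    linarith
  · intro x hx
    rcases lt_or_ge x s with h | h
    · rw [hleft (x - s) (by linarith), hleft (x - t) (by linarith), sub_self]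
    · have h2 : t + r < x := not_le.1 fun h2 => hx ⟨h, h2⟩
      rw [hright (x - s) (by linarith), hright (x - t) (by linarith), sub_self]
  · exact fun x => sub_nonneg.2 (hmono (by linarith))
  · funext x
    exact (((hβd (x - s)).comp_sub_const x s).sub ((hβd (x - t)).comp_sub_const x t)).deriv

/-- If g(s) < c < c' < g(t) for some s < t, a cutoff whose derivative is a bump just after s minus a
bump just after t gives ∫ θ' g ≤ c - c' < 0, a contradiction. -/
lemma antitone_of_weak {T : ℝ} (hT : 0 < T) {g : ℝ → ℝ} (hg : ContinuousOn g (Icc 0 T))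
    (h : ∀ ε, 0 < ε → ε ≤ T - ε → ∀ θ, TimeCutoff T ε θ → (∀ t, 0 ≤ θ t) →
      0 ≤ ∫ t in Ioo ε (T - ε), deriv θ t * g t) {t : ℝ} (ht : t ∈ Icc 0 T) : g t ≤ g 0 := by
  have key : ∀ s t, 0 < s → s < t → t < T → g t ≤ g s := by
    intro s t hs hst ht
    by_contra! hlt
    obtain ⟨c, hc1, hc3⟩ := exists_between hlt
    obtain ⟨c', hcc, hc2⟩ := exists_between hc3
    have cs : ∀ᶠ x in 𝓝 s, g x < c :=
      (hg.continuousAt (Icc_mem_nhds hs (hst.trans ht))).eventually (gt_mem_nhds hc1)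
    have ct : ∀ᶠ x in 𝓝 t, c' < g x :=
      (hg.continuousAt (Icc_mem_nhds (hs.trans hst) ht)).eventually (lt_mem_nhds hc2)
    obtain ⟨r₁, hr₁, h₁⟩ := Metric.eventually_nhds_iff.1 cs
    obtain ⟨r₂, hr₂, h₂⟩ := Metric.eventually_nhds_iff.1 ct
    set r := min (min r₁ r₂) (T - t) / 2 with hrd
    have hm : 0 < min (min r₁ r₂) (T - t) := lt_min (lt_min hr₁ hr₂) (by linarith)
    have hr : 0 < r := half_pos hm
    have hrlt : r < min (min r₁ r₂) (T - t) := half_lt_self hm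
    have hr1 : r < r₁ := hrlt.trans_le ((min_le_left _ _).trans (min_le_left _ _))
    have hr2 : r < r₂ := hrlt.trans_le ((min_le_left _ _).trans (min_le_right _ _))
    have hr3 : r < T - t := hrlt.trans_le (min_le_right _ _)
    obtain ⟨η, hη, hη0, hηs, hη1, θ, hθ, hθ0, hθd⟩ :=
      exists_timeCutoff (T := T) hs hst.le hr (by linarith)
    set ε := min s (T - (t + r)) / 2 with hεd
    have hm2 : 0 < min s (T - (t + r)) := lt_min hs (by linarith)
    have hε : 0 < ε := half_pos hm2
    have hε1 : ε < s := (half_lt_self hm2).trans_le (min_le_left _ _)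
    have hε2 : ε < T - (t + r) := (half_lt_self hm2).trans_le (min_le_right _ _)
    have hpos := h ε hε (by linarith) θ hθ hθ0
    rw [hθd] at hpos
    have hηc : HasCompactSupport η := HasCompactSupport.intro isCompact_Icc hηs
    have hηi : Integrable η := hη.continuous.integrable_of_hasCompactSupport hηc
    have hsub : ∀ a, Integrable fun x => η (x - a) := fun a => hηi.comp_sub_right a
    have hint : ∀ a, ∫ x, η (x - a) = 1 := fun a => by
      rw [integral_sub_right_eq_self η a, hη1]
    have hgI : ContinuousOn g (Icc ε (T - ε)) := hg.mono (Icc_subset_Icc hε.le (by linarith))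
    have hIi : IntegrableOn (fun x => (η (x - s) - η (x - t)) * g x) (Ioo ε (T - ε)) := by
      have : ContinuousOn (fun x => (η (x - s) - η (x - t)) * g x) (Icc ε (T - ε)) :=
        ContinuousOn.mul (by have := hη.continuous; fun_prop) hgI
      exact (this.integrableOn_compact isCompact_Icc).mono_set Ioo_subset_Icc_self
    have hIn : ∀ a, a = s ∨ a = t → ∫ x in Ioo ε (T - ε), η (x - a) = 1 := fun a ha => by
      rw [← hint a]
      refine setIntegral_eq_integral_of_forall_compl_eq_zero fun x hx => hηs _ fun h => hx ?_
      rcases ha with rfl | rfl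
      · exact ⟨by linarith [h.1], by linarith [h.2]⟩
      · exact ⟨by linarith [h.1], by linarith [h.2]⟩
    have hle : ∫ x in Ioo ε (T - ε), (η (x - s) - η (x - t)) * g x
        ≤ ∫ x in Ioo ε (T - ε), (η (x - s) * c - η (x - t) * c') := by
      refine setIntegral_mono hIi
        (((hsub s).mul_const c).sub ((hsub t).mul_const c')).integrableOn fun x => ?_
      have e1 : η (x - s) * g x ≤ η (x - s) * c := by
        by_cases hx : x - s ∈ Icc 0 r
        · refine mul_le_mul_of_nonneg_left (h₁ ?_).le (hη0 _)
          rw [Real.dist_eq, abs_of_nonneg hx.1]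
          exact hx.2.trans_lt hr1
        · rw [hηs _ hx]; simp
      have e2 : η (x - t) * c' ≤ η (x - t) * g x := by
        by_cases hx : x - t ∈ Icc 0 r
        · refine mul_le_mul_of_nonneg_left (h₂ ?_).le (hη0 _)
          rw [Real.dist_eq, abs_of_nonneg hx.1]
          exact hx.2.trans_lt hr2
        · rw [hηs _ hx]; simp
      simp only [sub_mul]
      linarith
    rw [integral_sub ((hsub s).mul_const c).integrableOn ((hsub t).mul_const c').integrableOn,
      integral_mul_const, integral_mul_const, hIn s (Or.inl rfl), hIn t (Or.inr rfl)] at hle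
    linarith
  -- The cutoffs see only the open interval; the endpoints 0 and T are reached by continuity.
  have key0 : ∀ t, 0 < t → t < T → g t ≤ g 0 := by
    intro t h0 h1
    have hlim : Tendsto g (𝓝[>] 0) (𝓝 (g 0)) :=
      (hg 0 (left_mem_Icc.2 hT.le)).mono_left (nhdsWithin_le_iff.2 (by
        filter_upwards [Ioo_mem_nhdsGT hT] with x hx using Ioo_subset_Icc_self hx))
    refine ge_of_tendsto hlim ?_
    filter_upwards [Ioo_mem_nhdsGT h0] with s hs using key s t hs.1 hs.2 h1
  rcases ht.1.eq_or_lt with rfl | h0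
  · exact le_rfl
  rcases ht.2.eq_or_lt with rfl | h1
  · have hlim : Tendsto g (𝓝[<] t) (𝓝 (g t)) :=
      (hg t (right_mem_Icc.2 hT.le)).mono_left (nhdsWithin_le_iff.2 (by
        filter_upwards [Ioo_mem_nhdsLT hT] with x hx using Ioo_subset_Icc_self hx))
    refine le_of_tendsto hlim ?_
    filter_upwards [Ioo_mem_nhdsLT hT] with s hs using key0 s hs.1 hs.2
  · exact key0 t h0 h1

lemma TimeCutoff.mul {T ε : ℝ} {θ f : ℝ → ℝ} (hθ : TimeCutoff T ε θ) (hf : ContDiff ℝ ∞ f) :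
    TimeCutoff T ε (fun t => f t * θ t) where
  smooth := hf.mul hθ.smooth
  support := let ⟨a, b, ha, hb, hs⟩ := hθ.support
    ⟨a, b, ha, hb, fun t ht => by rw [hs t ht, mul_zero]⟩

/-- Gronwall's inequality in the weak sense. -/
lemma weak_gronwall {T K : ℝ} (hT : 0 < T) {f : ℝ → ℝ} (hf : ContinuousOn f (Icc 0 T))
    (h : ∀ ε, 0 < ε → ε ≤ T - ε → ∀ θ, TimeCutoff T ε θ → (∀ t, 0 ≤ θ t) →
      0 ≤ ∫ t in Ioo ε (T - ε), (deriv θ t * f t + θ t * (K * f t))) {t : ℝ} (ht : t ∈ Icc 0 T) :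
    f t ≤ Real.exp (K * t) * f 0 := by
  have hexp : ContDiff ℝ ∞ fun t => Real.exp (-(K * t)) :=
    (contDiff_const.mul contDiff_id).neg.exp
  have hd : ∀ t, HasDerivAt (fun t => Real.exp (-(K * t))) (Real.exp (-(K * t)) * -K) t :=
    fun t => by simpa using ((hasDerivAt_id t).const_mul K).neg.exp
  -- The usual integrating factor: e^{-Kt} θ is again a non-negative cutoff, and the derivative of
  -- the exponential cancels the growth term.
  have := antitone_of_weak hT (g := fun t => Real.exp (-(K * t)) * f t)
    (hexp.continuous.continuousOn.mul hf) (fun ε hε hεT θ hθ h0 => ?_) ht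
  · simp only [mul_zero, neg_zero, Real.exp_zero, one_mul] at this
    calc f t = Real.exp (K * t) * (Real.exp (-(K * t)) * f t) := by
          rw [← mul_assoc, ← Real.exp_add, add_neg_cancel, Real.exp_zero, one_mul]
      _ ≤ _ := mul_le_mul_of_nonneg_left this (Real.exp_pos _).le
  · refine (h ε hε hεT _ (hθ.mul hexp) fun t => mul_nonneg (Real.exp_pos _).le (h0 t)).trans_eq ?_
    refine integral_congr_ae (Eventually.of_forall fun t => ?_)
    simp only
    have e := ((hd t).mul (hθ.differentiable t).hasDerivAt).deriv
    have e' : (fun t => Real.exp (-(K * t))) * θ = fun t => Real.exp (-(K * t)) * θ t := rfl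
    rw [e'] at e
    rw [e]
    ring

lemma constant_of_weak {T : ℝ} (hT : 0 < T) {f : ℝ → ℝ} (hf : ContinuousOn f (Icc 0 T))
    (h : ∀ ε, 0 < ε → ε ≤ T - ε → ∀ θ, TimeCutoff T ε θ →
      ∫ t in Ioo ε (T - ε), deriv θ t * f t = 0) {t : ℝ} (ht : t ∈ Icc 0 T) : f t = f 0 := by
  refine le_antisymm (antitone_of_weak hT hf (fun ε h1 h2 θ h3 _ => (h ε h1 h2 θ h3).ge) ht) ?_
  have := antitone_of_weak hT (g := fun t => - f t) hf.neg (fun ε h1 h2 θ h3 _ => by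
    simp only [mul_neg, integral_neg]
    rw [h ε h1 h2 θ h3, neg_zero]) ht
  linarith

/-! ### Continuity in time of integrals -/

section Pairing

variable {T : ℝ}

/-- The algebra of smooth functions on the torus. -/
def smoothAlgebra (d : ℕ) : Subalgebra ℝ C(Torus d, ℝ) where
  carrier := {f | PCD ∞ fun _ => f}
  mul_mem' hf hg := by
    rw [mem_ofPred_eq] at *
    exact PCD.mul hf hg
  add_mem' hf hg := by
    rw [mem_ofPred_eq] at *
    exact PCD.add hf hg
  algebraMap_mem' c := by
    rw [mem_ofPred_eq]
    exact PCD.const c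

/-- Stone–Weierstrass: the profile recentred at a has its unique maximum there, so smooth functions
separate points. -/
lemma exists_smooth_near (g : C(Torus d, ℝ)) {η : ℝ} (hη : 0 < η) :
    ∃ χ : Torus d → ℝ, PCD ∞ (fun _ => χ) ∧ ∀ x, |χ x - g x| ≤ η := by
  have hsep : (smoothAlgebra d).SeparatesPoints := by
    intro a b hab
    have hp : PCD ∞ (fun _ => reflect (profile (d := d) 1) 0 a 0) :=
      ((pcd_profile 1).reflect 0 a).slice 0
    refine ⟨_, ⟨⟨_, hp.continuous_slice 0⟩, hp, rfl⟩, ?_⟩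
    have h1 := profile_lt (d := d) one_pos (0, a - b) (fun h => hab (sub_eq_zero.1
      (congrArg Prod.snd h)))
    simp only [reflect, sub_self, ContinuousMap.coe_mk]
    exact h1.ne'
  obtain ⟨χ, hχ⟩ := ContinuousMap.exists_mem_subalgebra_near_continuousMap_of_separatesPoints
    (smoothAlgebra d) hsep g η hη
  exact ⟨χ, χ.2, fun x => ((ContinuousMap.norm_coe_le_norm ((χ : C(Torus d, ℝ)) - g) x).trans
    hχ.le)⟩

lemma integrable_mul_cmap {w : Torus d → ℝ} (hw : Integrable w (dx d)) (g : C(Torus d, ℝ)) :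
    Integrable (fun x => w x * g x) (dx d) := integrable_mul_continuous hw g.continuous

lemma abs_integral_mul_le {w g : Torus d → ℝ} (hw : Integrable w (dx d)) (hg : Continuous g)
    {M : ℝ} (hM : ∀ x, |g x| ≤ M) : |∫ x, w x * g x ∂(dx d)| ≤ M * ∫ x, |w x| ∂(dx d) := by
  rw [← integral_const_mul]
  refine (abs_integral_le_integral_abs).trans (integral_mono
    (integrable_mul_continuous hw hg).abs (hw.abs.const_mul M) fun x => ?_)
  simp only [abs_mul]
  rw [mul_comm]
  exact mul_le_mul_of_nonneg_right (hM x) (abs_nonneg _)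

variable {w : ℝ → Torus d → ℝ} {M : ℝ}

/-- With a uniform L¹ bound, the pairing with g is a uniform limit in time of pairings with smooth
functions. For ∇ρ the latter are continuous after integration by parts, although ∇ρ is not assumed
continuous in L¹. -/
lemma continuousOn_pairing_of_smooth (hint : ∀ t ∈ Icc 0 T, Integrable (w t) (dx d))
    (hM : ∀ t ∈ Icc 0 T, ∫ x, |w t x| ∂(dx d) ≤ M)
    (hs : ∀ χ : Torus d → ℝ, PCD ∞ (fun _ => χ) →
      ContinuousOn (fun t => ∫ x, w t x * χ x ∂(dx d)) (Icc 0 T)) (g : C(Torus d, ℝ)) :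
    ContinuousOn (fun t => ∫ x, w t x * g x ∂(dx d)) (Icc 0 T) := by
  refine continuousOn_of_uniform_approx_of_continuousOn fun u hu => ?_
  obtain ⟨ε, hε, hu⟩ := Metric.mem_uniformity_dist.1 hu
  obtain ⟨χ, hχ, hle⟩ := exists_smooth_near g (η := ε / (2 * (|M| + 1))) (by positivity)
  refine ⟨_, hs χ hχ, fun t ht => hu ?_⟩
  have hχc : Continuous χ := hχ.continuous_slice 0
  rw [dist_comm, Real.dist_eq, ← integral_sub (integrable_mul_continuous (hint t ht) hχc)
    (integrable_mul_cmap (hint t ht) g)]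
  simp only [← mul_sub]
  refine (abs_integral_mul_le (hint t ht) (hχc.sub g.continuous) hle).trans_lt ?_
  have h1 : ∫ x, |w t x| ∂(dx d) < 2 * (|M| + 1) := by
    linarith [hM t ht, le_abs_self M, abs_nonneg M]
  rw [div_mul_eq_mul_div, div_lt_iff₀ (by positivity)]
  exact mul_lt_mul_of_pos_left h1 hε

/-- Compactness of the torus turns joint continuity into a continuous curve for the uniform norm;
times outside [0,T] are projected onto it. -/
lemma exists_curry (hT : 0 ≤ T) {g : ℝ → Torus d → ℝ}
    (hg : ContinuousOn (Function.uncurry g) (Icc 0 T ×ˢ univ)) :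
    ∃ G : C(ℝ, C(Torus d, ℝ)), ∀ t ∈ Icc 0 T, ∀ x, G t x = g t x := by
  have hc : Continuous fun z : ℝ × Torus d => g (projIcc 0 T hT z.1) z.2 := by
    refine hg.comp_continuous (f := fun z : ℝ × Torus d => ((projIcc 0 T hT z.1 : ℝ), z.2)) ?_ ?_
    · exact (continuous_subtype_val.comp (continuous_projIcc.comp continuous_fst)).prodMk
        continuous_snd
    · exact fun z => ⟨(projIcc 0 T hT z.1).2, mem_univ _⟩
  refine ⟨ContinuousMap.curry ⟨_, hc⟩, fun t ht x => ?_⟩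
  simp [ContinuousMap.curry_apply, projIcc_of_mem hT ht]

/-- A moving test function is compared with its value at t: the error is at most its uniform
oscillation times the L¹ bound. -/
lemma continuousOn_pairing (hT : 0 ≤ T) (hint : ∀ t ∈ Icc 0 T, Integrable (w t) (dx d))
    (hM : ∀ t ∈ Icc 0 T, ∫ x, |w t x| ∂(dx d) ≤ M)
    (hw : ∀ g : C(Torus d, ℝ), ContinuousOn (fun t => ∫ x, w t x * g x ∂(dx d)) (Icc 0 T))
    {g : ℝ → Torus d → ℝ} (hg : ContinuousOn (Function.uncurry g) (Icc 0 T ×ˢ univ)) :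
    ContinuousOn (fun t => ∫ x, w t x * g t x ∂(dx d)) (Icc 0 T) := by
  obtain ⟨G, hG⟩ := exists_curry hT hg
  have hcongr : ∀ t ∈ Icc 0 T, ∫ x, w t x * g t x ∂(dx d) = ∫ x, w t x * G t x ∂(dx d) :=
    fun t ht => integral_congr_ae (Eventually.of_forall fun x => by simp only [hG t ht x])
  refine ContinuousOn.congr ?_ hcongr
  intro t ht
  have h1 : Tendsto (fun s => ∫ x, w s x * (G s - G t) x ∂(dx d)) (𝓝[Icc 0 T] t) (𝓝 0) := by
    have h2 : Tendsto (fun s => ‖G s - G t‖ * M) (𝓝[Icc 0 T] t) (𝓝 0) := by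
      have h3 : Tendsto (fun s => ‖G s - G t‖) (𝓝 t) (𝓝 ‖G t - G t‖) :=
        ((G.continuous.sub continuous_const).norm).tendsto t
      rw [sub_self, norm_zero] at h3
      simpa using (h3.mono_left nhdsWithin_le_nhds).mul_const M
    refine squeeze_zero_norm' ?_ h2
    filter_upwards [self_mem_nhdsWithin] with s hs
    exact (abs_integral_mul_le (hint s hs) (G s - G t).continuous
      (fun x => (G s - G t).norm_coe_le_norm x)).trans
      (mul_le_mul_of_nonneg_left (hM s hs) (norm_nonneg _))
  have h4 := h1.add (hw (G t) t ht)
  rw [zero_add] at h4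
  refine h4.congr' ?_
  filter_upwards [self_mem_nhdsWithin] with s hs
  rw [← integral_add (integrable_mul_cmap (hint s hs) _) (integrable_mul_cmap (hint s hs) _)]
  refine integral_congr_ae (Eventually.of_forall fun x => ?_)
  simp
  ring

lemma IsContL1.continuousOn_pairing (hT : 0 ≤ T) (hw : IsContL1 w) {g : ℝ → Torus d → ℝ}
    (hg : ContinuousOn (Function.uncurry g) (Icc 0 T ×ˢ univ)) :
    ContinuousOn (fun t => ∫ x, w t x * g t x ∂(dx d)) (Icc 0 T) := by
  obtain ⟨M, hM⟩ := (isCompact_Icc (a := (0 : ℝ)) (b := T)).exists_bound_of_continuousOn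
    (hw.continuousOn_integral_abs.mono fun t ht => ht.1)
  refine EulerKorteweg.continuousOn_pairing hT (fun t ht => hw.integrable t ht.1)
    (fun t ht => (le_abs_self _).trans (hM t ht)) (fun g t ht => ?_) hg
  refine tendsto_iff_norm_sub_tendsto_zero.2 ?_
  have h2 := ((hw.continuous t ht.1).mono_left
    (nhdsWithin_mono t (fun s hs => hs.1 : Icc 0 T ⊆ Ici 0))).const_mul ‖g‖
  rw [mul_zero] at h2
  refine squeeze_zero' (Eventually.of_forall fun s => norm_nonneg _) ?_ h2
  filter_upwards [self_mem_nhdsWithin] with s hs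
  have i1 := hw.integrable s hs.1
  have i2 := hw.integrable t ht.1
  rw [← integral_sub (integrable_mul_cmap i1 g) (integrable_mul_cmap i2 g)]
  simp only [← sub_mul]
  exact abs_integral_mul_le (i1.sub i2) g.continuous fun x => g.norm_coe_le_norm x

end Pairing

/-! ### Weak gradients at fixed times -/

/-- The space-time fundamental lemma applied to a function constant in time. -/
lemma ae_eq_zero_of_forall_smooth {f : Torus d → ℝ} (hf : Integrable f (dx d))
    (h : ∀ χ : Torus d → ℝ, PCD ∞ (fun _ => χ) → ∫ x, f x * χ x ∂(dx d) = 0) :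
    ∀ᵐ x ∂(dx d), f x = 0 := by
  have hint : Integrable (Function.uncurry fun (_ : ℝ) => f) (dtdx d (Ioo 0 1)) :=
    hf.comp_snd _
  have := ae_eq_zero_of_forall_test (T := 1) (g := fun _ => f) hint fun ψ hψ => by
    have hi : Integrable (fun z : ℝ × Torus d => f z.2 * ψ z.1 z.2) (dtdx d (Ioo 0 1)) := by
      have h0 := hψ.pcd.continuous
      obtain ⟨M, hM⟩ := (isCompact_Icc (a := (0 : ℝ)) (b := 1)).prod
        (isCompact_univ (X := Torus d)) |>.exists_bound_of_continuousOn h0.continuousOn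
      refine Integrable.mul_bdd (c := M) hint h0.aestronglyMeasurable ?_
      rw [dtdx_eq]
      filter_upwards [ae_restrict_mem (measurableSet_Ioo.prod MeasurableSet.univ)] with z hz
      exact hM z ⟨Ioo_subset_Icc_self hz.1, mem_univ _⟩
    unfold dtdx at hi ⊢
    rw [integral_prod _ hi]
    simp [h _ (hψ.pcd.slice _)]
  have h2 : ∀ᵐ t ∂(volume.restrict (Ioo (0 : ℝ) 1)), ∀ᵐ x ∂(dx d), f x = 0 :=
    Measure.ae_ae_of_ae_prod this
  have hne : NeZero (volume.restrict (Ioo (0 : ℝ) 1)) := ⟨by simp⟩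
  exact h2.exists.choose_spec

lemma IsWeakGrad.ae_unique {f : Torus d → ℝ} {g g' : Torus d → Vec d} (h : IsWeakGrad f g)
    (h' : IsWeakGrad f g') : ∀ᵐ x ∂(dx d), g x = g' x := by
  have : ∀ i, ∀ᵐ x ∂(dx d), g x i - g' x i = 0 := fun i => by
    refine ae_eq_zero_of_forall_smooth ((h.integrable_grad i).sub (h'.integrable_grad i))
      fun χ hχ => ?_
    have hc := hχ.continuous_slice 0
    have e := (h.eq i χ hχ).symm.trans (h'.eq i χ hχ)
    simp only [sub_mul]
    rw [integral_sub (integrable_mul_continuous (h.integrable_grad i) hc)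
      (integrable_mul_continuous (h'.integrable_grad i) hc)]
    linarith
  filter_upwards [ae_all_iff.2 this] with x hx
  ext i
  exact sub_eq_zero.1 (hx i)

lemma IsWeakGrad.congr {f f' : Torus d → ℝ} {g : Torus d → Vec d} (h : IsWeakGrad f g)
    (hf : ∀ᵐ x ∂(dx d), f x = f' x) : IsWeakGrad f' g where
  integrable := h.integrable.congr hf
  integrable_grad := h.integrable_grad
  eq i χ hχ := by
    rw [← h.eq i χ hχ]
    refine integral_congr_ae ?_
    filter_upwards [hf] with x hx
    rw [hx]

lemma IsWeakGrad.sub {f f' : Torus d → ℝ} {g g' : Torus d → Vec d} (h : IsWeakGrad f g)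
    (h' : IsWeakGrad f' g') : IsWeakGrad (fun x => f x - f' x) (fun x => g x - g' x) where
  integrable := h.integrable.sub h'.integrable
  integrable_grad i := (h.integrable_grad i).sub (h'.integrable_grad i)
  eq i χ hχ := by
    have hχ' : PCD ∞ (fun _ => χ) := hχ
    have hc := hχ'.continuous_slice 0
    have hc' := (hχ'.pd_top i).continuous_slice 0
    simp only [PiLp.sub_apply, sub_mul]
    rw [integral_sub (integrable_mul_continuous h.integrable hc')
      (integrable_mul_continuous h'.integrable hc'),
      integral_sub (integrable_mul_continuous (h.integrable_grad i) hc)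
      (integrable_mul_continuous (h'.integrable_grad i) hc), h.eq i χ hχ, h'.eq i χ hχ]
    ring

/-! ### From weak identities in time to every single time. -/

section Time

variable {T : ℝ}

/-- Testing with θ' shows that f is constant. Gronwall with rate 1 for f and for -f then compares
f(0) with e^T f(0) in both directions, which forces f(0) = 0. -/
lemma eq_zero_of_weak (hT : 0 < T) {f : ℝ → ℝ} (hf : ContinuousOn f (Icc 0 T))
    (h : ∀ ε, 0 < ε → ε ≤ T - ε → ∀ θ, TimeCutoff T ε θ →
      ∫ t in Ioo ε (T - ε), θ t * f t = 0) {t : ℝ} (ht : t ∈ Icc 0 T) : f t = 0 := by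
  have hint : ∀ {ε θ}, 0 < ε → TimeCutoff T ε θ →
      IntegrableOn (fun t => θ t * f t) (Ioo ε (T - ε)) := fun {ε θ} hε hθ =>
    ((hθ.smooth.continuous.continuousOn.mul (hf.mono (Icc_subset_Icc hε.le
      (by linarith)))).integrableOn_compact isCompact_Icc).mono_set Ioo_subset_Icc_self
  have hconst : ∀ t ∈ Icc 0 T, f t = f 0 := fun t ht =>
    constant_of_weak hT hf (fun ε h1 h2 θ h3 => h ε h1 h2 _ h3.deriv) ht
  have hz : ∀ ε, 0 < ε → ε ≤ T - ε → ∀ θ, TimeCutoff T ε θ →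
      ∫ t in Ioo ε (T - ε), (deriv θ t * f t + θ t * (1 * f t)) = 0 := fun ε h1 h2 θ h3 => by
    simp only [one_mul]
    rw [integral_add (hint h1 h3.deriv) (hint h1 h3), h ε h1 h2 _ h3.deriv, h ε h1 h2 _ h3,
      add_zero]
  have hTm : T ∈ Icc 0 T := right_mem_Icc.2 hT.le
  have k1 := weak_gronwall (K := 1) hT hf (fun ε h1 h2 θ h3 _ => (hz ε h1 h2 θ h3).ge) hTm
  have k2 := weak_gronwall (K := 1) hT (f := fun t => - f t) hf.neg (fun ε h1 h2 θ h3 _ => by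
    have e : ∀ t, deriv θ t * -f t + θ t * (1 * -f t)
        = -(deriv θ t * f t + θ t * (1 * f t)) := fun t => by ring
    simp only [e, integral_neg]
    rw [hz ε h1 h2 θ h3, neg_zero]) hTm
  have h1 : 1 < Real.exp (1 * T) := Real.one_lt_exp_iff.2 (by linarith)
  rw [hconst T hTm] at k1 k2
  rw [hconst t ht]
  nlinarith

lemma isContL1_one : IsContL1 (fun _ (_ : Torus d) => (1 : ℝ)) where
  measurable := aestronglyMeasurable_const
  integrable _ _ := integrable_const 1
  continuous _ _ := by simpa using tendsto_const_nhds

lemma continuousOn_integral_slice (hT : 0 ≤ T) {g : ℝ → Torus d → ℝ}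
    (hg : ContinuousOn (Function.uncurry g) (Icc 0 T ×ˢ univ)) :
    ContinuousOn (fun t => ∫ x, g t x ∂(dx d)) (Icc 0 T) := by
  simpa using isContL1_one.continuousOn_pairing hT hg

lemma continuous_slice_of_continuousOn {X : Type*} [TopologicalSpace X] {g : ℝ → Torus d → X}
    (hg : ContinuousOn (Function.uncurry g) (Icc 0 T ×ˢ univ)) {t : ℝ} (ht : t ∈ Icc 0 T) :
    Continuous (g t) :=
  hg.comp_continuous (f := fun x : Torus d => (t, x)) (by fun_prop) fun _ => ⟨ht, mem_univ _⟩

lemma integral_dtdx_time_mul {I : Set ℝ} {θ : ℝ → ℝ} {f : ℝ → Torus d → ℝ}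
    (hint : Integrable (fun z : ℝ × Torus d => θ z.1 * f z.1 z.2) (dtdx d I)) :
    ∫ z, θ z.1 * f z.1 z.2 ∂(dtdx d I) = ∫ t in I, θ t * ∫ x, f t x ∂(dx d) := by
  unfold dtdx at hint ⊢
  rw [integral_prod _ hint]
  simp only [integral_const_mul]

variable {F : ℝ → Vec d → ℝ} {V : StrongFields d} {W : WeakFields d}

lemma HypStrong.continuousOn_gradρ (hV : HypStrong F T V) (i : Fin d) :
    ContinuousOn (Function.uncurry fun t x => V.gradρ t x i) (Icc 0 T ×ˢ univ) :=
  (EuclideanSpace.proj (𝕜 := ℝ) i).continuous.comp_continuousOn hV.cont_gradρ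

lemma HypStrong.continuousOn_u (hV : HypStrong F T V) (i : Fin d) :
    ContinuousOn (Function.uncurry fun t x => V.u t x i) (Icc 0 T ×ˢ univ) :=
  (EuclideanSpace.proj (𝕜 := ℝ) i).continuous.comp_continuousOn hV.cont_u

/-- Product test functions θ(t)χ(x) give the spatial identity after integration against every θ;
since ρ̄ and ∇ρ̄ are continuous, it holds at each time, including 0 and T. -/
lemma HypStrong.isWeakGrad (hT : 0 < T) (hV : HypStrong F T V) {t : ℝ} (ht : t ∈ Icc 0 T) :
    IsWeakGrad (V.ρ t) (V.gradρ t) where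
  integrable := integrable_of_continuous (continuous_slice_of_continuousOn hV.cont_ρ ht)
  integrable_grad i :=
    integrable_of_continuous (continuous_slice_of_continuousOn (hV.continuousOn_gradρ i) ht)
  eq i χ hχ := by
    have hχ : PCD ∞ (fun _ => χ) := hχ
    have c0 : ContinuousOn (Function.uncurry fun (_ : ℝ) => χ) (Icc 0 T ×ˢ univ) :=
      hχ.continuous.continuousOn
    have c1 : ContinuousOn (Function.uncurry fun (_ : ℝ) => pd i χ) (Icc 0 T ×ˢ univ) :=
      (hχ.pd_top i).continuous.continuousOn
    have g1 : ContinuousOn (Function.uncurry fun t x => V.ρ t x * pd i χ x) (Icc 0 T ×ˢ univ) :=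
      hV.cont_ρ.mul c1
    have g2 : ContinuousOn (Function.uncurry fun t x => V.gradρ t x i * χ x) (Icc 0 T ×ˢ univ) :=
      (hV.continuousOn_gradρ i).mul c0
    have g3 : ContinuousOn (Function.uncurry fun t x => V.ρ t x * pd i χ x + V.gradρ t x i * χ x)
      (Icc 0 T ×ˢ univ) := g1.add g2
    have key := eq_zero_of_weak hT (continuousOn_integral_slice hT.le g3) (fun ε hε hεT θ hθ => ?_)
      ht
    · rw [integral_add (integrable_of_continuous (continuous_slice_of_continuousOn g1 ht))
        (integrable_of_continuous (continuous_slice_of_continuousOn g2 ht))] at key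
      linarith
    · have hψ := hθ.isTestSmooth hε hχ
      have h0 := hV.gradρ i _ hψ
      simp only [TimeCutoff.pd_mul θ hχ.one] at h0
      have cθ : ContinuousOn (fun z : ℝ × Torus d => θ z.1) (Icc 0 T ×ˢ univ) :=
        (hθ.smooth.continuous.comp continuous_fst).continuousOn
      have i1 : Integrable (fun z : ℝ × Torus d => V.ρ z.1 z.2 * (θ z.1 * pd i χ z.2))
        (dtdx d (Ioo 0 T)) := integrable_dtdx_of_continuousOn (hV.cont_ρ.mul (cθ.mul c1))
      have i2 : Integrable (fun z : ℝ × Torus d => V.gradρ z.1 z.2 i * (θ z.1 * χ z.2))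
        (dtdx d (Ioo 0 T)) :=
        integrable_dtdx_of_continuousOn ((hV.continuousOn_gradρ i).mul (cθ.mul c0))
      have i3 : Integrable (fun z : ℝ × Torus d => θ z.1 * (V.ρ z.1 z.2 * pd i χ z.2
        + V.gradρ z.1 z.2 i * χ z.2)) (dtdx d (Ioo 0 T)) :=
        integrable_dtdx_of_continuousOn (cθ.mul g3)
      have h1 : ∫ z, θ z.1 * (V.ρ z.1 z.2 * pd i χ z.2 + V.gradρ z.1 z.2 i * χ z.2)
          ∂(dtdx d (Ioo 0 T)) = 0 := by
        have e : ∀ z : ℝ × Torus d, θ z.1 * (V.ρ z.1 z.2 * pd i χ z.2 + V.gradρ z.1 z.2 i * χ z.2)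
            = V.ρ z.1 z.2 * (θ z.1 * pd i χ z.2) + V.gradρ z.1 z.2 i * (θ z.1 * χ z.2) :=
          fun z => by ring
        simp only [e]
        rw [integral_add i1 i2, h0]
        ring
      have hsub : Ioo ε (T - ε) ⊆ Ioo 0 T := Ioo_subset_Ioo hε.le (by linarith)
      rw [integral_dtdx_eq_of_support hsub measurableSet_Ioo
        fun z hz => by rw [hθ.eq_zero hz, zero_mul]] at h1
      rw [← integral_dtdx_time_mul (f := fun t x => V.ρ t x * pd i χ x + V.gradρ t x i * χ x)
        (integrable_inner hε i3)]
      exact h1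

/-! ### Conservation of mass -/

lemma IsWeakSolution.mass_conserved (hT : 0 < T) (hW : IsWeakSolution F W) {t : ℝ}
    (ht : t ∈ Icc 0 T) : ∫ x, W.ρ t x ∂(dx d) = ∫ x, W.ρ 0 x ∂(dx d) := by
  refine constant_of_weak hT (hW.cont_ρ.continuousOn_integral.mono fun t ht => ht.1)
    (fun ε hε hεT θ hθ => ?_) ht
  have h1 := hW.mass_smooth hε hθ (f := fun _ _ => 1) (PCD.const 1)
  have e1 : ∀ z : ℝ × Torus d, dt (fun _ (_ : Torus d) => (1 : ℝ)) z.1 z.2 = 0 := fun z => by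
    simp [dt]
  simp only [e1, pd_const, mul_zero, mul_one, add_zero, Finset.sum_const_zero] at h1
  rw [← integral_dtdx_time_mul (f := W.ρ), ← h1]
  · exact integral_congr_ae (Eventually.of_forall fun z => mul_comm _ _)
  · exact ((hθ.deriv.bTend _).integrable_mul (integrable_inner hε
      (hW.cont_ρ.integrable_dtdx T))).congr (Eventually.of_forall fun z => mul_comm _ _)

lemma HypStrong.mass_conserved {δ R : ℝ} (hT : 0 < T) (hδ : 0 < δ) (hV : HypStrong F T V)
    (hmem : ∀ t ∈ Icc 0 T, ∀ x, V.ρ t x ∈ Icc δ R) {t : ℝ}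
    (ht : t ∈ Icc 0 T) : ∫ x, V.ρ t x ∂(dx d) = ∫ x, V.ρ 0 x ∂(dx d) := by
  refine constant_of_weak hT (continuousOn_integral_slice hT.le hV.cont_ρ)
    (fun ε hε hεT θ hθ => ?_) ht
  obtain ⟨r, v, hA⟩ := exists_approx hT hV hε hmem
  have h1 := (hA.pressure_identity hεT hδ hθ (G := fun r => r) contDiffOn_id 0).2
  rw [← integral_dtdx_time_mul (f := V.ρ), ← h1]
  · refine integral_congr_ae ?_
    filter_upwards [ae_mono (dtdx_inner_le (d := d) hε) hV.mass] with z hz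
    have e : ∑ i, (V.gradρ z.1 z.2 i * V.u z.1 z.2 i + V.ρ z.1 z.2 * V.du i i z.1 z.2)
      = - V.dtρ z.1 z.2 := by linarith
    simp [e]
  · exact ((hθ.deriv.bTend _).integrable_mul (integrable_inner hε
      hV.linf_ρ.integrable)).congr (Eventually.of_forall fun z => mul_comm _ _)

end Time

/-! ### Regularity of the relative energy -/

section RelativeEnergyRegularity

variable {h : ℝ → ℝ} {A C T δ R : ℝ} {W : WeakFields d} {V : StrongFields d}

/-- Both claims follow term by term from the affine expansion. The energy, m and ρ are continuous in
L¹, whereas ∇ρ enters only through its pairing with ∇ρ̄, for which weak continuity suffices. -/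
lemma relEnergy_formula (H : Thermo h A) (hC : 0 < C) (hT : 0 < T) (hδ : 0 < δ)
    (hV : HypStrong (constCapillarity d h C) T V)
    (hmem : ∀ t ∈ Icc 0 T, ∀ x, V.ρ t x ∈ Icc δ R)
    (hW : HypWeak (constCapillarity d h C) T W) :
    (∀ t ∈ Icc 0 T, Integrable (relDensity (constCapillarity d h C) W V t) (dx d)) ∧
      ContinuousOn (relEnergy (constCapillarity d h C) W V) (Icc 0 T) := by
  have hS := hW.isWeakSolution
  have hE := hW.cont_energy
  have hpos : MapsTo (Function.uncurry V.ρ) (Icc 0 T ×ˢ univ) (Ioi 0) := fun z hz =>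
    hδ.trans_le (hmem z.1 hz.1 z.2).1
  set a₁ : ℝ → Torus d → ℝ := fun t x => 1 / 2 * dot (V.u t x) (V.u t x) - deriv h (V.ρ t x)
  set a₂ : ℝ → Torus d → ℝ := fun t x =>
    press h (V.ρ t x) + C / 2 * dot (V.gradρ t x) (V.gradρ t x)
  have c₁ : ContinuousOn (Function.uncurry a₁) (Icc 0 T ×ˢ univ) :=
    (continuousOn_const.mul (continuousOn_finsetSum _ fun i _ =>
      (hV.continuousOn_u i).mul (hV.continuousOn_u i))).sub
      (H.smooth_deriv.continuousOn.comp hV.cont_ρ hpos)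
  have c₂ : ContinuousOn (Function.uncurry a₂) (Icc 0 T ×ˢ univ) :=
    (H.smooth_press.continuousOn.comp hV.cont_ρ hpos).add
      (continuousOn_const.mul (continuousOn_finsetSum _ fun i _ =>
        (hV.continuousOn_gradρ i).mul (hV.continuousOn_gradρ i)))
  have hexp : ∀ t ∈ Icc 0 T, ∀ᵐ x ∂(dx d),
      ((W.e (constCapillarity d h C) t x - ∑ i, W.m t x i * V.u t x i) + W.ρ t x * a₁ t x)
        - C * (∑ i, W.gradρ t x i * V.gradρ t x i) + a₂ t x
      = relDensity (constCapillarity d h C) W V t x := fun t ht => by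
    filter_upwards [hS.vacuum t ht.1] with x hx
    rw [relDensity_expand W V (hδ.trans_le (hmem t ht x).1) hx]
    simp only [a₁, a₂, dot]
    ring
  have i1 := fun t (ht : t ∈ Icc 0 T) => hE.integrable t ht.1
  have i2 := fun t (ht : t ∈ Icc 0 T) => integrable_finsetSum Finset.univ fun i _ =>
    integrable_mul_continuous ((hS.cont_m i).integrable t ht.1)
      (continuous_slice_of_continuousOn (hV.continuousOn_u i) ht)
  have i3 := fun t (ht : t ∈ Icc 0 T) =>
    integrable_mul_continuous (hS.cont_ρ.integrable t ht.1) (continuous_slice_of_continuousOn c₁ ht)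
  have i4 := fun t (ht : t ∈ Icc 0 T) => integrable_finsetSum Finset.univ fun i _ =>
    integrable_mul_continuous ((hS.grad t ht.1).integrable_grad i)
      (continuous_slice_of_continuousOn (hV.continuousOn_gradρ i) ht)
  have i5 := fun t (ht : t ∈ Icc 0 T) =>
    integrable_of_continuous (continuous_slice_of_continuousOn c₂ ht)
  have j1 := fun t ht => (i1 t ht).sub (i2 t ht)
  have j2 := fun t ht => (j1 t ht).add (i3 t ht)
  have j3 := fun t ht => (j2 t ht).sub ((i4 t ht).const_mul C)
  refine ⟨fun t ht => ((j3 t ht).add (i5 t ht)).congr (hexp t ht), ?_⟩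
  obtain ⟨M, hM⟩ := hS.integrable_abs_grad_le H hC hE T
  have hcont : ContinuousOn (fun t => ∫ x, W.e (constCapillarity d h C) t x ∂(dx d)
      - ∑ i, ∫ x, W.m t x i * V.u t x i ∂(dx d) + ∫ x, W.ρ t x * a₁ t x ∂(dx d)
      - C * (∑ i, ∫ x, W.gradρ t x i * V.gradρ t x i ∂(dx d)) + ∫ x, a₂ t x ∂(dx d))
      (Icc 0 T) := by
    refine ((((hE.continuousOn_integral.mono fun t ht => ht.1).sub
      (continuousOn_finsetSum _ fun i _ => (hS.cont_m i).continuousOn_pairing hT.le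
        (hV.continuousOn_u i))).add (hS.cont_ρ.continuousOn_pairing hT.le c₁)).sub
      (continuousOn_const.mul (continuousOn_finsetSum _ fun i _ => ?_))).add
      (continuousOn_integral_slice hT.le c₂)
    have hi : ∀ t ∈ Icc 0 T, Integrable (fun x => W.gradρ t x i) (dx d) := fun t ht =>
      (hS.grad t ht.1).integrable_grad i
    refine continuousOn_pairing (w := fun t x => W.gradρ t x i) hT.le hi
      (fun t ht => hM t ht i) (continuousOn_pairing_of_smooth hi (fun t ht => hM t ht i)
        fun χ hχ => ?_) (hV.continuousOn_gradρ i)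
    -- Against a smooth function the pairing with ∇ρ becomes one with ρ, which is continuous in L¹.
    have hc : ContinuousOn (fun t => - ∫ x, W.ρ t x * pd i χ x ∂(dx d)) (Icc 0 T) :=
      (hS.cont_ρ.continuousOn_pairing hT.le (g := fun _ => pd i χ)
        (hχ.pd_top i).continuous.continuousOn).neg
    refine hc.congr fun t ht => ?_
    simp only
    rw [(hS.grad t ht.1).eq i χ hχ, neg_neg]
  refine hcont.congr fun t ht => ?_
  rw [relEnergy, ← integral_congr_ae (hexp t ht)]
  refine (integral_add (j3 t ht) (i5 t ht)).trans ?_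
  have e3 := integral_sub (j2 t ht) ((i4 t ht).const_mul C)
  have e2 := integral_add (j1 t ht) (i3 t ht)
  have e1 := integral_sub (i1 t ht) (i2 t ht)
  have e4 := integral_const_mul C (fun x => ∑ i, W.gradρ t x i * V.gradρ t x i) (μ := dx d)
  have e5 := integral_finsetSum Finset.univ fun i _ =>
    integrable_mul_continuous ((hS.grad t ht.1).integrable_grad i)
      (continuous_slice_of_continuousOn (hV.continuousOn_gradρ i) ht)
  have e6 := integral_finsetSum Finset.univ fun i _ =>
    integrable_mul_continuous ((hS.cont_m i).integrable t ht.1)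
      (continuous_slice_of_continuousOn (hV.continuousOn_u i) ht)
  simp only [Pi.add_apply, Pi.sub_apply] at e1 e2 e3 ⊢
  rw [e3, e2, e1, e4, e5, e6]

end RelativeEnergyRegularity

/-! ### The Poincaré inequality -/

/-- The exponential monomials are a Hilbert basis of `L^2` for the measure `dx`. -/
def fourierBasis (d : ℕ) : HilbertBasis (Fin d → ℤ) ℂ (Lp ℂ 2 (dx d)) :=
  UnitAddTorus.mFourierBasis

/-- Fourier coefficients with respect to `dx`. -/
def fc (f : Torus d → ℂ) (n : Fin d → ℤ) : ℂ := ∫ x, UnitAddTorus.mFourier (-n) x * f x ∂(dx d)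

lemma fourierBasis_repr (F : Lp ℂ 2 (dx d)) (n : Fin d → ℤ) : (fourierBasis d).repr F n = fc F n :=
  UnitAddTorus.mFourierBasis_repr F n

lemma hasSum_sq_fc (F : Lp ℂ 2 (dx d)) :
    HasSum (fun n => ‖fc F n‖ ^ 2) (∫ x, ‖F x‖ ^ 2 ∂(dx d)) :=
  UnitAddTorus.hasSum_sq_mFourierCoeff F

lemma mFourier_toTorus (n : Fin d → ℤ) (y : Fin d → ℝ) :
    UnitAddTorus.mFourier n (toTorus y)
      = ∏ j, Complex.exp (2 * Real.pi * Complex.I * n j * y j) := by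
  change ∏ j, fourier (n j) (toTorus y j) = _
  refine Finset.prod_congr rfl fun j _ => ?_
  simp only [toTorus]
  rw [fourier_coe_apply]
  simp

lemma contDiff_mFourier (n : Fin d → ℤ) :
    ContDiff ℝ ∞ fun z : ℝ × (Fin d → ℝ) => UnitAddTorus.mFourier n (toTorus z.2) := by
  simp only [mFourier_toTorus]
  refine contDiff_prod fun j _ => ContDiff.cexp (contDiff_const.mul ?_)
  exact Complex.ofRealCLM.contDiff.comp ((contDiff_apply ℝ ℝ j).comp contDiff_snd)

lemma hasDerivAt_mFourier (n : Fin d → ℤ) (i : Fin d) (x : Torus d) :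
    HasDerivAt (fun s : ℝ => UnitAddTorus.mFourier n (x + Pi.single i (s : UnitAddCircle)))
      (2 * Real.pi * Complex.I * n i * UnitAddTorus.mFourier n x) 0 := by
  have e : (fun s : ℝ => UnitAddTorus.mFourier n (x + Pi.single i (s : UnitAddCircle)))
      = fun s : ℝ => UnitAddTorus.mFourier n x * Complex.exp (2 * Real.pi * Complex.I * n i * s) := by
    funext s
    have h1 : ∀ j, fourier (n j) ((x + Pi.single i (s : UnitAddCircle) : Torus d) j)
        = fourier (n j) (x j)
          * (if j = i then Complex.exp (2 * Real.pi * Complex.I * n i * s) else 1) := fun j => by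
      by_cases hj : j = i
      · subst hj
        have h2 := fourier_coe_apply (T := (1 : ℝ)) (n := n j) (x := s)
        rw [Pi.add_apply, Pi.single_eq_same, if_pos rfl]
        have h3 : (fourier (n j) (s : UnitAddCircle) : ℂ)
            = Complex.exp (2 * Real.pi * Complex.I * n j * s) := by rw [h2]; simp
        rw [← h3]
        simp only [fourier_apply, smul_add, AddCircle.toCircle_add, Circle.coe_mul]
      · rw [Pi.add_apply, Pi.single_eq_of_ne hj, add_zero, if_neg hj, mul_one]
    change ∏ j, fourier (n j) ((x + Pi.single i (s : UnitAddCircle) : Torus d) j)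
      = (∏ j, fourier (n j) (x j)) * _
    simp only [h1, Finset.prod_mul_distrib]
    simp
  rw [e]
  have h1 : HasDerivAt (fun s : ℝ => 2 * Real.pi * Complex.I * n i * (s : ℂ))
      (2 * Real.pi * Complex.I * n i) 0 := by
    simpa using (Complex.ofRealCLM.hasDerivAt (x := (0 : ℝ))).const_mul
      (2 * Real.pi * Complex.I * (n i : ℂ))
  have h2 := (h1.cexp).const_mul (UnitAddTorus.mFourier n x)
  simpa [mul_comm, mul_left_comm, mul_assoc] using h2

lemma integrable_mFourier_mul (n : Fin d → ℤ) {f : Torus d → ℂ} (hf : Integrable f (dx d)) :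
    Integrable (fun x => UnitAddTorus.mFourier n x * f x) (dx d) :=
  hf.bdd_mul (c := 1) (UnitAddTorus.mFourier n).continuous.aestronglyMeasurable
    (Eventually.of_forall fun x => ((UnitAddTorus.mFourier n).norm_coe_le_norm x).trans
      UnitAddTorus.mFourier_norm.le)

/-- Integration by parts against a character. Weak gradients are tested with real functions, so the
identity is proved for the real and imaginary parts through real-linear functionals P. -/
lemma IsWeakGrad.fc_grad {f : Torus d → ℝ} {g : Torus d → Vec d} (h : IsWeakGrad f g) (i : Fin d)
    (n : Fin d → ℤ) :
    fc (fun x => (g x i : ℂ)) n = 2 * Real.pi * Complex.I * n i * fc (fun x => (f x : ℂ)) n := by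
  have hd := hasDerivAt_mFourier (d := d) (-n) i
  have hf' : Integrable (fun x => (f x : ℂ)) (dx d) := h.integrable.ofReal
  have hg' : Integrable (fun x => (g x i : ℂ)) (dx d) := (h.integrable_grad i).ofReal
  have key : ∀ (P : ℂ →L[ℝ] ℝ), P (fc (fun x => (g x i : ℂ)) n)
      = P (2 * Real.pi * Complex.I * n i * fc (fun x => (f x : ℂ)) n) := fun P => by
    have e1 := h.eq i (fun x => P (UnitAddTorus.mFourier (-n) x))
      (P.contDiff.comp (contDiff_mFourier (-n)))
    have e2 : ∀ x, pd i (fun x => P (UnitAddTorus.mFourier (-n) x)) x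
        = - P (2 * Real.pi * Complex.I * n i * UnitAddTorus.mFourier (-n) x) := fun x => by
      have h1 := (P.hasFDerivAt.comp_hasDerivAt (0 : ℝ) (hd x)).deriv
      refine h1.trans ?_
      rw [← map_neg]
      congr 1
      simp
    have e3 : P (fc (fun x => (g x i : ℂ)) n)
        = ∫ x, g x i * P (UnitAddTorus.mFourier (-n) x) ∂(dx d) := by
      rw [fc, ← P.integral_comp_comm (integrable_mFourier_mul _ hg')]
      refine integral_congr_ae (Eventually.of_forall fun x => ?_)
      simp only
      rw [mul_comm, ← Complex.real_smul, map_smul, smul_eq_mul]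
    have e4 : P (2 * Real.pi * Complex.I * n i * fc (fun x => (f x : ℂ)) n)
        = ∫ x, f x * P (2 * Real.pi * Complex.I * n i * UnitAddTorus.mFourier (-n) x) ∂(dx d) := by
      rw [fc, ← integral_const_mul, ← P.integral_comp_comm
        ((integrable_mFourier_mul _ hf').const_mul _)]
      refine integral_congr_ae (Eventually.of_forall fun x => ?_)
      simp only
      rw [← mul_assoc, mul_comm, ← Complex.real_smul, map_smul, smul_eq_mul]
    rw [e3, e4, ← neg_eq_iff_eq_neg.2 e1, ← integral_neg]
    refine integral_congr_ae (Eventually.of_forall fun x => ?_)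
    simp only [e2]
    ring
  exact Complex.ext (key Complex.reCLM) (key Complex.imCLM)

/-- Uniqueness of Fourier coefficients in L¹: the functional φ ↦ ∫ φG is continuous on C(𝕋^d) and
vanishes on the dense span of the characters, hence on all smooth functions. -/
lemma ae_eq_zero_of_fc {G : Torus d → ℂ} (hG : Integrable G (dx d)) (h : ∀ n, fc G n = 0) :
    ∀ᵐ x ∂(dx d), G x = 0 := by
  have hi : ∀ φ : C(Torus d, ℂ), Integrable (fun x => φ x * G x) (dx d) := fun φ =>
    hG.bdd_mul (c := ‖φ‖) φ.continuous.aestronglyMeasurable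
      (Eventually.of_forall fun x => φ.norm_coe_le_norm x)
  let Λ : C(Torus d, ℂ) →L[ℂ] ℂ := LinearMap.mkContinuous
    { toFun := fun φ => ∫ x, φ x * G x ∂(dx d)
      map_add' := fun φ ψ => by
        simp only [ContinuousMap.add_apply, add_mul]
        exact integral_add (hi φ) (hi ψ)
      map_smul' := fun c φ => by
        simp only [ContinuousMap.smul_apply, smul_eq_mul, mul_assoc, RingHom.id_apply]
        exact integral_const_mul _ _ }
    (∫ x, ‖G x‖ ∂(dx d)) fun φ => by
      rw [mul_comm, ← integral_const_mul]
      refine norm_integral_le_of_norm_le (hG.norm.const_mul _) (Eventually.of_forall fun x => ?_)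
      rw [norm_mul]
      exact mul_le_mul_of_nonneg_right (φ.norm_coe_le_norm x) (norm_nonneg _)
  have hΛ : Λ = 0 := by
    refine ContinuousLinearMap.ext_on (s := range (UnitAddTorus.mFourier (d := Fin d))) ?_ ?_
    · rw [dense_iff_closure_eq, ← Submodule.topologicalClosure_coe,
        UnitAddTorus.span_mFourier_closure_eq_top]
      rfl
    · rintro _ ⟨n, rfl⟩
      have := h (-n)
      rw [fc, neg_neg] at this
      exact this
  have key : ∀ (P : ℂ →L[ℝ] ℝ), ∀ᵐ x ∂(dx d), P (G x) = 0 := fun P => by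
    refine ae_eq_zero_of_forall_smooth (P.integrable_comp hG) fun χ hχ => ?_
    have hc := hχ.continuous_slice 0
    have h1 : ∫ x, (χ x : ℂ) * G x ∂(dx d) = 0 :=
      congrArg (fun Λ => Λ ⟨fun x => (χ x : ℂ), Complex.continuous_ofReal.comp hc⟩) hΛ
    have h2 := P.integral_comp_comm (hi ⟨fun x => (χ x : ℂ), Complex.continuous_ofReal.comp hc⟩)
    simp only [ContinuousMap.coe_mk] at h2
    rw [h1, map_zero] at h2
    rw [← h2]
    refine integral_congr_ae (Eventually.of_forall fun x => ?_)
    simp only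
    rw [← Complex.real_smul, map_smul, smul_eq_mul, mul_comm]
  filter_upwards [key Complex.reCLM, key Complex.imCLM] with x h1 h2
  exact Complex.ext h1 h2

/-- The Poincaré inequality on the torus. -/
lemma IsWeakGrad.poincare {f : Torus d → ℝ} {g : Torus d → Vec d} (h : IsWeakGrad f g)
    (hg : Integrable (fun x => ∑ i, g x i * g x i) (dx d)) (hmean : ∫ x, f x ∂(dx d) = 0) :
    Integrable (fun x => f x ^ 2) (dx d) ∧
      ∫ x, f x ^ 2 ∂(dx d) ≤ ∫ x, ∑ i, g x i * g x i ∂(dx d) := by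
  have hgi : ∀ i, Integrable (fun x => g x i * g x i) (dx d) := fun i => by
    refine hg.mono' ((h.integrable_grad i).1.mul (h.integrable_grad i).1)
      (Eventually.of_forall fun x => ?_)
    rw [Real.norm_of_nonneg (mul_self_nonneg _)]
    exact Finset.single_le_sum (f := fun j => g x j * g x j) (fun j _ => mul_self_nonneg _)
      (Finset.mem_univ i)
  have hm : ∀ i, MemLp (fun x => (g x i : ℂ)) 2 (dx d) := fun i => by
    have : MemLp (fun x => g x i) 2 (dx d) :=
      (memLp_two_iff_integrable_sq (h.integrable_grad i).1).2
        ((hgi i).congr (Eventually.of_forall fun x => (pow_two _).symm))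
    exact this.ofReal
  have hfc : ∀ i n, fc ((hm i).toLp) n = fc (fun x => (g x i : ℂ)) n := fun i n => by
    refine integral_congr_ae ?_
    filter_upwards [(hm i).coeFn_toLp] with x hx
    rw [hx]
  have hsum : HasSum (fun n => ∑ i, ‖fc (fun x => (g x i : ℂ)) n‖ ^ 2)
      (∫ x, ∑ i, g x i * g x i ∂(dx d)) := by
    rw [integral_finsetSum _ fun i _ => hgi i]
    refine hasSum_sum fun i _ => ?_
    have h1 := hasSum_sq_fc ((hm i).toLp)
    simp only [hfc] at h1
    convert h1 using 1
    refine integral_congr_ae ?_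
    filter_upwards [(hm i).coeFn_toLp] with x hx
    rw [hx, Complex.norm_real, Real.norm_eq_abs, sq_abs, pow_two]
  set c : (Fin d → ℤ) → ℂ := fc (fun x => (f x : ℂ)) with hc
  -- The zero mode vanishes because f has mean zero. In any other mode some |n_i| ≥ 1, and |2π n_i|
  -- ≥ 1 gives the Poincaré constant 1.
  have hle : ∀ n, ‖c n‖ ^ 2 ≤ ∑ i, ‖fc (fun x => (g x i : ℂ)) n‖ ^ 2 := fun n => by
    by_cases hn : n = 0
    · have : c n = 0 := by
        simp only [hc, fc, hn, neg_zero, UnitAddTorus.mFourier_zero, ContinuousMap.one_apply,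
          one_mul]
        rw [integral_complex_ofReal, hmean, Complex.ofReal_zero]
      rw [this]
      simpa using Finset.sum_nonneg fun i _ => sq_nonneg _
    · obtain ⟨i, hi⟩ := Function.ne_iff.1 hn
      refine le_trans ?_ (Finset.single_le_sum
        (f := fun i => ‖fc (fun x => (g x i : ℂ)) n‖ ^ 2) (fun j _ => sq_nonneg _)
        (Finset.mem_univ i))
      simp only [h.fc_grad, norm_mul, Complex.norm_I, Complex.norm_real, Complex.norm_intCast]
      refine pow_le_pow_left₀ (norm_nonneg _) ?_ 2
      refine le_mul_of_one_le_left (norm_nonneg _) ?_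
      have h1 : (1 : ℝ) ≤ |(n i : ℝ)| := by exact_mod_cast Int.one_le_abs hi
      have h2 : (1 : ℝ) ≤ 2 * Real.pi := by linarith [Real.pi_gt_three]
      rw [Real.norm_of_nonneg Real.pi_pos.le]
      simpa using one_le_mul_of_one_le_of_one_le h2 h1
  have hcs : Summable fun n => ‖c n‖ ^ 2 :=
    Summable.of_nonneg_of_le (fun _ => sq_nonneg _) hle hsum.summable
  have hmem : Memℓp c 2 := memℓp_gen (by simpa using hcs)
  -- A priori f is only integrable. Its coefficients are square summable, so they belong to some F
  -- in L², and uniqueness in L¹ identifies F with f.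
  set F : Lp ℂ 2 (dx d) := (fourierBasis d).repr.symm ⟨c, hmem⟩ with hF
  have hFc : ∀ n, fc F n = c n := fun n => by
    rw [← fourierBasis_repr, hF, LinearIsometryEquiv.apply_symm_apply]
  have hFi : Integrable F (dx d) := (Lp.memLp F).integrable (by norm_num)
  have hf' : Integrable (fun x => (f x : ℂ)) (dx d) := h.integrable.ofReal
  have hz := ae_eq_zero_of_fc (hFi.sub hf') fun n => by
    have : fc (fun x => F x - (f x : ℂ)) n = fc F n - c n := by
      simp only [fc, hc, mul_sub]
      exact integral_sub (integrable_mFourier_mul _ hFi)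
        (integrable_mFourier_mul _ hf')
    exact this.trans (by rw [hFc, sub_self])
  have hsq : ∀ᵐ x ∂(dx d), ‖F x‖ ^ 2 = f x ^ 2 := by
    filter_upwards [hz] with x hx
    have : F x = (f x : ℂ) := sub_eq_zero.1 hx
    rw [this, Complex.norm_real, Real.norm_eq_abs, sq_abs]
  refine ⟨((memLp_two_iff_integrable_sq_norm (Lp.memLp F).1).1 (Lp.memLp F)).congr hsq, ?_⟩
  rw [← integral_congr_ae hsq]
  have h1 := hasSum_sq_fc F
  simp only [hFc] at h1
  exact hasSum_le hle h1 hsum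

/-! ### Estimates for the quadratic remainder -/

lemma dot_self_nonneg (x : Fin d → ℝ) : 0 ≤ dot x x :=
  Finset.sum_nonneg fun _ _ => mul_self_nonneg _

lemma abs_bil_le {D : Fin d → Fin d → ℝ} {L : ℝ} (hD : ∀ i j, |D i j| ≤ L) (x : Fin d → ℝ) :
    |bil D x x| ≤ d * L * dot x x := by
  have h1 : ∀ i j, |x i * x j * D i j| ≤ L / 2 * (x i * x i) + L / 2 * (x j * x j) := fun i j => by
    have hL : 0 ≤ L := (abs_nonneg _).trans (hD i j)
    rw [abs_mul, abs_mul]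
    have h3 := mul_self_nonneg (x i)
    have h4 := mul_self_nonneg (x j)
    have h2 : |x i| * |x j| ≤ (x i * x i + x j * x j) / 2 := by
      rw [← abs_mul_abs_self (x i), ← abs_mul_abs_self (x j)]
      nlinarith [sq_nonneg (|x i| - |x j|)]
    calc |x i| * |x j| * |D i j| ≤ (x i * x i + x j * x j) / 2 * L :=
          mul_le_mul h2 (hD i j) (abs_nonneg _) (by positivity)
      _ = _ := by ring
  calc |bil D x x| ≤ ∑ i, ∑ j, (L / 2 * (x i * x i) + L / 2 * (x j * x j)) :=
        (Finset.abs_sum_le_sum_abs _ _).trans (Finset.sum_le_sum fun i _ =>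
          (Finset.abs_sum_le_sum_abs _ _).trans (Finset.sum_le_sum fun j _ => h1 i j))
    _ = d * L * dot x x := by
        simp only [Finset.sum_add_distrib, ← Finset.mul_sum, Finset.sum_const, Finset.card_univ,
          Fintype.card_fin, nsmul_eq_mul, dot]
        rw [show ∑ i, x i * (d * x i) = d * ∑ i, x i * x i by
          rw [Finset.mul_sum]; exact Finset.sum_congr rfl fun i _ => by ring]
        ring

lemma abs_sum_le {v : Fin d → ℝ} {L : ℝ} (hv : ∀ i, |v i| ≤ L) : |∑ i, v i| ≤ d * L := by
  refine (Finset.abs_sum_le_sum_abs _ _).trans ((Finset.sum_le_sum fun i _ => hv i).trans_eq ?_)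
  simp

lemma abs_mul_dot_le {z : Fin d → ℝ} {N : ℝ} (hz : ∀ i, |z i| ≤ N) (a : ℝ) (y : Fin d → ℝ) :
    |a * dot y z| ≤ N / 2 * (d * a ^ 2 + dot y y) := by
  have h1 : ∀ i, |a * (y i * z i)| ≤ N / 2 * (a ^ 2 + y i * y i) := fun i => by
    have hN : 0 ≤ N := (abs_nonneg _).trans (hz i)
    rw [abs_mul, abs_mul, ← mul_assoc]
    have h3 := mul_self_nonneg (y i)
    have h2 : |a| * |y i| ≤ (a ^ 2 + y i * y i) / 2 := by
      rw [← abs_mul_abs_self (y i), ← sq_abs a]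
      nlinarith [sq_nonneg (|a| - |y i|)]
    calc |a| * |y i| * |z i| ≤ (a ^ 2 + y i * y i) / 2 * N :=
          mul_le_mul h2 (hz i) (abs_nonneg _) (by positivity)
      _ = _ := by ring
  rw [dot, Finset.mul_sum]
  refine (Finset.abs_sum_le_sum_abs _ _).trans ((Finset.sum_le_sum fun i _ => h1 i).trans_eq ?_)
  simp only [← Finset.mul_sum, Finset.sum_add_distrib, Finset.sum_const, Finset.card_univ,
    Fintype.card_fin, nsmul_eq_mul, dot]

section Remainder

variable {h : ℝ → ℝ} {A C T δ R L : ℝ} {W : WeakFields d} {V : StrongFields d}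

lemma relDensity_nonneg (H : Thermo h A) (hC : 0 < C) {t : ℝ} {x : Torus d} (hρ : 0 ≤ W.ρ t x)
    (hV : 0 < V.ρ t x) : 0 ≤ relDensity (constCapillarity d h C) W V t x := by
  rw [relDensity_eq W V hV]
  have := H.relh_nonneg hρ hV
  positivity

lemma relh_le_relDensity (hC : 0 < C) {t : ℝ} {x : Torus d} (hρ : 0 ≤ W.ρ t x)
    (hV : 0 < V.ρ t x) :
    relh h (W.ρ t x) (V.ρ t x) ≤ relDensity (constCapillarity d h C) W V t x := by
  rw [relDensity_eq W V hV]
  have h1 : 0 ≤ 1 / 2 * W.ρ t x * ‖(W.ρ t x)⁻¹ • W.m t x - V.u t x‖ ^ 2 := by positivity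
  have h2 : 0 ≤ C / 2 * ‖W.gradρ t x - V.gradρ t x‖ ^ 2 := by positivity
  linarith

lemma norm_sq_grad_le_relDensity (H : Thermo h A) (hC : 0 < C) {t : ℝ} {x : Torus d}
    (hρ : 0 ≤ W.ρ t x) (hV : 0 < V.ρ t x) :
    ‖W.gradρ t x - V.gradρ t x‖ ^ 2
      ≤ 2 / C * relDensity (constCapillarity d h C) W V t x := by
  rw [relDensity_eq W V hV, div_mul_eq_mul_div, le_div_iff₀ hC]
  have h1 : 0 ≤ 1 / 2 * W.ρ t x * ‖(W.ρ t x)⁻¹ • W.m t x - V.u t x‖ ^ 2 := by positivity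
  have h2 := H.relh_nonneg hρ hV
  linarith

/-- Every term but one is bounded pointwise by the relative energy density. The product of ρ - ρ̄
with its gradient leaves (ρ - ρ̄)², which is estimated only after integration. -/
lemma remainder_le (H : Thermo h A) (hC : 0 < C) (hL : 0 ≤ L) {t : ℝ} {x : Torus d}
    (hρ : 0 ≤ W.ρ t x) (hV : 0 < V.ρ t x) (hdu : ∀ i j, |V.du i j t x| ≤ L)
    (hddu : ∀ i j k, |V.ddu i j k t x| ≤ L) :
    remainder h C W V t x ≤ d * L * (6 + A) * relDensity (constCapillarity d h C) W V t x
      + C * (d * L) * d / 2 * (W.ρ t x - V.ρ t x) ^ 2 := by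
  set N : ℝ := d * L with hN
  have hN0 : 0 ≤ N := by positivity
  set w := W.ρ t x * ‖(W.ρ t x)⁻¹ • W.m t x - V.u t x‖ ^ 2 with hw
  have hw0 : 0 ≤ w := by positivity
  set y : Fin d → ℝ := fun i => W.gradρ t x i - V.gradρ t x i with hy
  have hyy : ‖W.gradρ t x - V.gradρ t x‖ ^ 2 = dot y y := norm_sq_eq _
  have hy0 := dot_self_nonneg y
  set ζ : Fin d → ℝ := fun i => W.m t x i - W.ρ t x * V.u t x i with hζ
  -- Away from vacuum |ζ|² = ρ² |m/ρ - ū|², so one factor ρ cancels; on the vacuum the quotient is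
  -- read as zero.
  have h1 : |bil (fun i j => V.du i j t x) ζ ζ / W.ρ t x| ≤ N * w := by
    rcases hρ.eq_or_lt with h0 | h0
    · rw [← h0, div_zero, abs_zero]; positivity
    · rw [abs_div, abs_of_pos h0, div_le_iff₀ h0]
      refine (abs_bil_le hdu ζ).trans_eq ?_
      have e : dot ζ ζ = w * W.ρ t x := by
        rw [hw, norm_sq_eq, Finset.mul_sum, Finset.sum_mul]
        refine Finset.sum_congr rfl fun i _ => ?_
        simp only [hζ, PiLp.sub_apply, PiLp.smul_apply, smul_eq_mul]
        field_simp
      rw [e, hN]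
      ring
  have hdiv : |∑ j, V.du j j t x| ≤ N := abs_sum_le fun j => hdu j j
  have h2 : |(press h (W.ρ t x) - press h (V.ρ t x)
        - deriv (press h) (V.ρ t x) * (W.ρ t x - V.ρ t x)) * ∑ j, V.du j j t x|
      ≤ A * relh h (W.ρ t x) (V.ρ t x) * N := by
    rw [abs_mul]
    exact mul_le_mul (H.abs_rel_press_le hρ hV) hdiv (abs_nonneg _)
      (mul_nonneg H.pos.le (H.relh_nonneg hρ hV))
  have h3 : |bil (fun i j => V.du i j t x) y y| ≤ N * dot y y := abs_bil_le hdu y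
  have h4 : |1 / 2 * dot y y * ∑ j, V.du j j t x| ≤ 1 / 2 * dot y y * N := by
    rw [abs_mul, abs_of_nonneg (by positivity)]
    exact mul_le_mul_of_nonneg_left hdiv (by positivity)
  have h5 : |(W.ρ t x - V.ρ t x) * dot y fun i => ∑ j, V.ddu j j i t x|
      ≤ N / 2 * (d * (W.ρ t x - V.ρ t x) ^ 2 + dot y y) :=
    abs_mul_dot_le (fun i => abs_sum_le fun j => hddu j j i) _ _
  have h6 : -(bil (fun i j => V.du i j t x) y y + 1 / 2 * dot y y * ∑ j, V.du j j t x
      + (W.ρ t x - V.ρ t x) * dot y fun i => ∑ j, V.ddu j j i t x)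
      ≤ 2 * N * dot y y + N * d / 2 * (W.ρ t x - V.ρ t x) ^ 2 := by
    linarith [neg_abs_le (bil (fun i j => V.du i j t x) y y),
      neg_abs_le (1 / 2 * dot y y * ∑ j, V.du j j t x),
      neg_abs_le ((W.ρ t x - V.ρ t x) * dot y fun i => ∑ j, V.ddu j j i t x)]
  have h7 := mul_le_mul_of_nonneg_left h6 hC.le
  rw [relDensity_eq W V hV, hyy, mul_assoc (1 / 2), ← hw]
  -- Relative to the matching parts of the density the constants are 2N (kinetic), AN (pressure) and
  -- 4N (gradient). Their sum N(6 + A) is a common bound.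
  have h8 : 0 ≤ N * relh h (W.ρ t x) (V.ρ t x) := mul_nonneg hN0 (H.relh_nonneg hρ hV)
  have h9 : 0 ≤ N * w := mul_nonneg hN0 hw0
  have h10 : 0 ≤ N * (C * dot y y) := by positivity
  have h11 : 0 ≤ A * (N * w) := mul_nonneg H.pos.le h9
  have h12 : 0 ≤ A * (N * (C * dot y y)) := mul_nonneg H.pos.le h10
  unfold remainder
  simp only [← hy, ← hζ]
  linarith [neg_abs_le (bil (fun i j => V.du i j t x) ζ ζ / W.ρ t x),
    neg_abs_le ((press h (W.ρ t x) - press h (V.ρ t x)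
        - deriv (press h) (V.ρ t x) * (W.ρ t x - V.ρ t x)) * ∑ j, V.du j j t x)]

end Remainder

/-! ### Stability -/

section Stability

variable {h : ℝ → ℝ} {A C T δ R L : ℝ} {W : WeakFields d} {V : StrongFields d}

/-- The growth rate of the relative energy, when `∫ |ρ - ρ'|²` is at most `M` times the relative
energy. -/
def growthRate (d : ℕ) (A C L M : ℝ) : ℝ := d * L * (6 + A) + C * (d * L) * d / 2 * M

lemma growthRate_nonneg {M : ℝ} (hA : 0 ≤ A) (hC : 0 ≤ C) (hL : 0 ≤ L) (hM : 0 ≤ M) :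
    0 ≤ growthRate d A C L M := by
  unfold growthRate
  positivity

lemma VelocityBound.mono_bound {L' : ℝ} (hV : VelocityBound T L V) (hL : L ≤ L') :
    VelocityBound T L' V := by
  filter_upwards [hV] with z hz i
  exact ⟨(hz i).1.trans hL, (hz i).2.1.trans hL, fun j => ⟨((hz i).2.2 j).1.trans hL,
    fun k => (((hz i).2.2 j).2 k).trans hL⟩⟩

/-- The pressure law that is given separately from the potential. -/
lemma Thermo.of_pressure {p : ℝ → ℝ} (hA : 0 < A) (h_cont : ContinuousOn h (Ici 0))
    (h_smooth : ContDiffOn ℝ 2 h (Ioi 0)) (p_smooth : ContDiffOn ℝ 2 p (Ioi 0))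
    (thermo : ∀ ρ : ℝ, 0 < ρ → ρ * _root_.deriv h ρ = p ρ + h ρ)
    (monotone : ∀ ρ : ℝ, 0 < ρ → 0 < _root_.deriv p ρ)
    (bound : ∀ ρ : ℝ, 0 < ρ →
      |_root_.deriv (_root_.deriv p) ρ| ≤ A * (_root_.deriv p ρ / ρ)) : Thermo h A := by
  have e0 : EqOn (press h) p (Ioi 0) := fun ρ hρ => by
    rw [press, thermo ρ hρ, add_sub_cancel_right]
  have e1 : EqOn (_root_.deriv (press h)) (_root_.deriv p) (Ioi 0) := e0.deriv isOpen_Ioi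
  have e2 := e1.deriv isOpen_Ioi
  exact
    { pos := hA
      cont := h_cont
      smooth := h_smooth
      smooth_press := p_smooth.congr e0
      monotone := fun ρ hρ => by rw [e1 hρ]; exact monotone ρ hρ
      bound := fun ρ hρ => by rw [e1 hρ, e2 hρ]; exact bound ρ hρ }

/-- The control of ∫ (ρ - ρ̄)² by M φ is taken as a hypothesis, so that the two cases of γ share the
rest of the argument. -/
lemma relEnergy_gronwall (H : Thermo h A) (hC : 0 < C) (hT : 0 < T) (hδ : 0 < δ) (hL : 0 ≤ L)
    (hV : HypStrong (constCapillarity d h C) T V) (hVL : VelocityBound T L V)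
    (hmem : ∀ t ∈ Icc 0 T, ∀ x, V.ρ t x ∈ Icc δ R)
    (hW : HypWeak (constCapillarity d h C) T W) {M : ℝ}
    (hM : ∀ t ∈ Icc 0 T, Integrable (fun x => (W.ρ t x - V.ρ t x) ^ 2) (dx d) ∧
      ∫ x, (W.ρ t x - V.ρ t x) ^ 2 ∂(dx d) ≤ M * relEnergy (constCapillarity d h C) W V t)
    {t : ℝ} (ht : t ∈ Icc 0 T) :
    relEnergy (constCapillarity d h C) W V t
      ≤ Real.exp (growthRate d A C L M * t) * relEnergy (constCapillarity d h C) W V 0 := by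
  obtain ⟨hint, hcont⟩ := relEnergy_formula H hC hT hδ hV hmem hW
  refine weak_gronwall hT hcont (fun ε hε hεT θ hθ hnn => ?_) ht
  obtain ⟨hI, h0⟩ := relative_energy_inequality H hC hT hδ hV hmem hW hε hεT hθ hnn
  have hsub : Ioo ε (T - ε) ⊆ Ioo 0 T := Ioo_subset_Ioo hε.le (by linarith)
  -- The velocity bounds hold almost everywhere in space-time; at almost every time they hold for
  -- almost every x, which is what the integrated inequality requires.
  have hbd : ∀ᵐ t ∂(volume.restrict (Ioo ε (T - ε))), ∀ᵐ x ∂(dx d), ∀ i,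
      |V.u t x i| ≤ L ∧ |V.dtu i t x| ≤ L ∧
        ∀ j, |V.du i j t x| ≤ L ∧ ∀ k, |V.ddu i j k t x| ≤ L :=
    ae_mono (Measure.restrict_mono hsub le_rfl) (Measure.ae_ae_of_ae_prod hVL)
  unfold dtdx at hI h0
  rw [integral_prod _ hI] at h0
  refine h0.trans (integral_mono_ae hI.integral_prod_left ?_ ?_)
  · have hc : ContinuousOn (fun t => deriv θ t * relEnergy (constCapillarity d h C) W V t
        + θ t * (growthRate d A C L M * relEnergy (constCapillarity d h C) W V t))
        (Icc ε (T - ε)) := by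
      have h1 := hcont.mono (Icc_subset_Icc hε.le (by linarith : T - ε ≤ T))
      have h2 : Continuous (deriv θ) := hθ.smooth.continuous_deriv (by simp)
      exact (h2.continuousOn.mul h1).add
        (hθ.smooth.continuous.continuousOn.mul (continuousOn_const.mul h1))
    exact (hc.integrableOn_compact isCompact_Icc).mono_set Ioo_subset_Icc_self
  · filter_upwards [hbd, hI.prod_right_ae, ae_restrict_mem measurableSet_Ioo] with t hb hIt ht
    have htT : t ∈ Icc 0 T := Ioo_subset_Icc_self (hsub ht)
    have i1 := hint t htT
    obtain ⟨i2, hle⟩ := hM t htT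
    set K₁ : ℝ := d * L * (6 + A) with hK₁
    set K₂ : ℝ := C * (d * L) * d / 2 with hK₂
    have hK₂0 : 0 ≤ K₂ := by positivity
    have i3 := (i1.const_mul (deriv θ t + θ t * K₁)).add (i2.const_mul (θ t * K₂))
    calc ∫ x, (deriv θ t * relDensity (constCapillarity d h C) W V t x
          + θ t * remainder h C W V t x) ∂(dx d)
        ≤ ∫ x, ((deriv θ t + θ t * K₁) * relDensity (constCapillarity d h C) W V t x
          + θ t * K₂ * (W.ρ t x - V.ρ t x) ^ 2) ∂(dx d) := by
          refine integral_mono_ae hIt i3 ?_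
          filter_upwards [hb, hW.isWeakSolution.nonneg t htT.1] with x hx hρ
          have h1 := mul_le_mul_of_nonneg_left (remainder_le (W := W) H hC hL hρ
            (hδ.trans_le (hmem t htT x).1) (fun i j => ((hx i).2.2 j).1)
            fun i j k => ((hx i).2.2 j).2 k) (hnn t)
          rw [← hK₁, ← hK₂] at h1
          linarith
      _ = (deriv θ t + θ t * K₁) * relEnergy (constCapillarity d h C) W V t
          + θ t * K₂ * ∫ x, (W.ρ t x - V.ρ t x) ^ 2 ∂(dx d) := by
          rw [← integral_const_mul, relEnergy, ← integral_const_mul]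
          exact integral_add (i1.const_mul _) (i2.const_mul _)
      _ ≤ (deriv θ t + θ t * K₁) * relEnergy (constCapillarity d h C) W V t
          + θ t * K₂ * (M * relEnergy (constCapillarity d h C) W V t) := by
          have := mul_le_mul_of_nonneg_left hle (mul_nonneg (hnn t) hK₂0)
          linarith
      _ = _ := by rw [growthRate]; ring

lemma sq_density_le_of_coercive {c : ℝ} (hC : 0 < C) (hT : 0 < T)
    (hδ : 0 < δ) (hc : 0 < c) (hcoer : ∀ ρ, 0 ≤ ρ → ∀ a ∈ Icc δ R, c * (ρ - a) ^ 2 ≤ relh h ρ a)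
    (hV : HypStrong (constCapillarity d h C) T V)
    (hmem : ∀ t ∈ Icc 0 T, ∀ x, V.ρ t x ∈ Icc δ R)
    (hW : IsWeakSolution (constCapillarity d h C) W) {t : ℝ} (ht : t ∈ Icc 0 T)
    (hint : Integrable (relDensity (constCapillarity d h C) W V t) (dx d)) :
    Integrable (fun x => (W.ρ t x - V.ρ t x) ^ 2) (dx d) ∧
      ∫ x, (W.ρ t x - V.ρ t x) ^ 2 ∂(dx d)
        ≤ c⁻¹ * relEnergy (constCapillarity d h C) W V t := by
  have hle : ∀ᵐ x ∂(dx d), (W.ρ t x - V.ρ t x) ^ 2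
      ≤ c⁻¹ * relDensity (constCapillarity d h C) W V t x := by
    filter_upwards [hW.nonneg t ht.1] with x hx
    rw [inv_mul_eq_div, le_div_iff₀ hc, mul_comm]
    exact (hcoer _ hx _ (hmem t ht x)).trans
      (relh_le_relDensity hC hx (hδ.trans_le (hmem t ht x).1))
  have hi : Integrable (fun x => (W.ρ t x - V.ρ t x) ^ 2) (dx d) := by
    refine (hint.const_mul c⁻¹).mono'
      (((hW.cont_ρ.integrable t ht.1).sub (hV.isWeakGrad hT ht).integrable).1.pow 2) ?_
    filter_upwards [hle] with x hx
    rwa [Real.norm_of_nonneg (sq_nonneg _)]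
  refine ⟨hi, ?_⟩
  rw [relEnergy, ← integral_const_mul]
  exact integral_mono_ae hi (hint.const_mul _) hle

/-- Mass conservation for both solutions keeps the mean of ρ - ρ̄ at zero, and the Poincaré
inequality bounds it by its gradient, a part of the relative energy. -/
lemma sq_density_le_of_mean (H : Thermo h A) (hC : 0 < C) (hT : 0 < T) (hδ : 0 < δ)
    (hV : HypStrong (constCapillarity d h C) T V)
    (hmem : ∀ t ∈ Icc 0 T, ∀ x, V.ρ t x ∈ Icc δ R)
    (hW : IsWeakSolution (constCapillarity d h C) W)
    (hmean : ∫ x, (W.ρ 0 x - V.ρ 0 x) ∂(dx d) = 0) {t : ℝ} (ht : t ∈ Icc 0 T)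
    (hint : Integrable (relDensity (constCapillarity d h C) W V t) (dx d)) :
    Integrable (fun x => (W.ρ t x - V.ρ t x) ^ 2) (dx d) ∧
      ∫ x, (W.ρ t x - V.ρ t x) ^ 2 ∂(dx d)
        ≤ 2 / C * relEnergy (constCapillarity d h C) W V t := by
  have h0 : (0 : ℝ) ∈ Icc 0 T := ⟨le_rfl, hT.le⟩
  have hG := (hW.grad t ht.1).sub (hV.isWeakGrad hT ht)
  have hm : ∫ x, (W.ρ t x - V.ρ t x) ∂(dx d) = 0 := by
    rw [← hmean, integral_sub (hW.cont_ρ.integrable t ht.1) (hV.isWeakGrad hT ht).integrable,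
      integral_sub (hW.cont_ρ.integrable 0 le_rfl) (hV.isWeakGrad hT h0).integrable,
      hW.mass_conserved hT ht, hV.mass_conserved hT hδ hmem ht]
  have hle : ∀ᵐ x ∂(dx d), ∑ i, (W.gradρ t x - V.gradρ t x) i * (W.gradρ t x - V.gradρ t x) i
      ≤ 2 / C * relDensity (constCapillarity d h C) W V t x := by
    filter_upwards [hW.nonneg t ht.1] with x hx
    rw [← norm_sq_eq]
    exact norm_sq_grad_le_relDensity H hC hx (hδ.trans_le (hmem t ht x).1)
  have hi : Integrable (fun x => ∑ i, (W.gradρ t x - V.gradρ t x) i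
      * (W.gradρ t x - V.gradρ t x) i) (dx d) := by
    refine (hint.const_mul (2 / C)).mono' (Finset.aestronglyMeasurable_fun_sum _ fun i _ =>
      (hG.integrable_grad i).1.mul (hG.integrable_grad i).1) ?_
    filter_upwards [hle] with x hx
    rwa [Real.norm_of_nonneg (Finset.sum_nonneg fun i _ => mul_self_nonneg _)]
  obtain ⟨k1, k2⟩ := hG.poincare hi hm
  refine ⟨k1, k2.trans ?_⟩
  rw [relEnergy, ← integral_const_mul]
  exact integral_mono_ae hi (hint.const_mul _) hle

lemma relEnergy_nonneg (H : Thermo h A) (hC : 0 < C) (hδ : 0 < δ)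
    (hmem : ∀ t ∈ Icc 0 T, ∀ x, V.ρ t x ∈ Icc δ R)
    (hW : IsWeakSolution (constCapillarity d h C) W) {t : ℝ} (ht : t ∈ Icc 0 T) :
    0 ≤ relEnergy (constCapillarity d h C) W V t := by
  refine integral_nonneg_of_ae ?_
  filter_upwards [hW.nonneg t ht.1] with x hx
  exact relDensity_nonneg H hC hx (hδ.trans_le (hmem t ht x).1)

/-- The density is a sum of non-negative terms, so each vanishes almost everywhere: strict convexity
gives ρ = ρ̄, and then the kinetic term gives m = m̄. -/
lemma coincide_of_relEnergy_eq_zero (H : Thermo h A) (hC : 0 < C) (hδ : 0 < δ)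
    (hmem : ∀ t ∈ Icc 0 T, ∀ x, V.ρ t x ∈ Icc δ R)
    (hW : IsWeakSolution (constCapillarity d h C) W) {t : ℝ} (ht : t ∈ Icc 0 T)
    (hint : Integrable (relDensity (constCapillarity d h C) W V t) (dx d))
    (h0 : relEnergy (constCapillarity d h C) W V t = 0) : Coincide W V t := by
  have hnn : 0 ≤ᵐ[dx d] relDensity (constCapillarity d h C) W V t := by
    filter_upwards [hW.nonneg t ht.1] with x hx
    exact relDensity_nonneg H hC hx (hδ.trans_le (hmem t ht x).1)
  filter_upwards [(integral_eq_zero_iff_of_nonneg_ae hnn hint).1 h0, hW.nonneg t ht.1] with x hz hx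
  have hpos := hδ.trans_le (hmem t ht x).1
  have hz : relDensity (constCapillarity d h C) W V t x = 0 := hz
  have hρ : W.ρ t x = V.ρ t x := H.relh_eq_zero hx hpos
    (le_antisymm ((relh_le_relDensity hC hx hpos).trans hz.le) (H.relh_nonneg hx hpos))
  refine ⟨hρ, ?_⟩
  rw [relDensity_eq W V hpos, hρ, Thermo.relh_self] at hz
  have h1 : 0 ≤ C / 2 * ‖W.gradρ t x - V.gradρ t x‖ ^ 2 := by positivity
  have h2 : 0 ≤ 1 / 2 * V.ρ t x * ‖(V.ρ t x)⁻¹ • W.m t x - V.u t x‖ ^ 2 := by positivity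
  have h3 : 1 / 2 * V.ρ t x * ‖(V.ρ t x)⁻¹ • W.m t x - V.u t x‖ ^ 2 = 0 := by linarith
  have h4 : ‖(V.ρ t x)⁻¹ • W.m t x - V.u t x‖ ^ 2 = 0 :=
    (mul_eq_zero.1 h3).resolve_left (by positivity)
  have h5 := sub_eq_zero.1 (norm_eq_zero.1 (pow_eq_zero_iff two_ne_zero |>.1 h4))
  rw [StrongFields.m, ← h5, smul_smul, mul_inv_cancel₀ hpos.ne', one_smul]

/-- Equality of ρ and m must also give equality of the gradients; this is uniqueness of the weak
gradient at a fixed time. -/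
lemma relEnergy_eq_zero_of_coincide (hT : 0 < T) (hδ : 0 < δ)
    (hV : HypStrong (constCapillarity d h C) T V)
    (hmem : ∀ t ∈ Icc 0 T, ∀ x, V.ρ t x ∈ Icc δ R)
    (hW : IsWeakSolution (constCapillarity d h C) W) {t : ℝ} (ht : t ∈ Icc 0 T)
    (hc : Coincide W V t) : relEnergy (constCapillarity d h C) W V t = 0 := by
  have hg := ((hW.grad t ht.1).congr (hc.mono fun x hx => hx.1)).ae_unique (hV.isWeakGrad hT ht)
  refine integral_eq_zero_of_ae ?_
  filter_upwards [hc, hg] with x hx hgx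
  have hpos := hδ.trans_le (hmem t ht x).1
  rw [relDensity_eq W V hpos, hx.1, hx.2, hgx, Thermo.relh_self, StrongFields.m, smul_smul,
    inv_mul_cancel₀ hpos.ne']
  simp

end Stability

end EulerKorteweg

end

/-! ### Assembly of the stability and uniqueness theorem. -/

theorem mainTheorem2 (d : ℕ) (h p : ℝ → ℝ) (Cκ γ k A : ℝ)
    (hCκ : 0 < Cκ) (hγ : 1 < γ) (hk : 0 < k) (hA : 0 < A)
    (h_cont : ContinuousOn h (Set.Ici 0)) (h_smooth : ContDiffOn ℝ 2 h (Set.Ioi 0))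
    (p_smooth : ContDiffOn ℝ 2 p (Set.Ioi 0))
    (thermo : ∀ ρ : ℝ, 0 < ρ → ρ * deriv h ρ = p ρ + h ρ)
    (monotone : ∀ ρ : ℝ, 0 < ρ → 0 < deriv p ρ)
    (growth : (fun ρ : ℝ => h ρ - k / (γ - 1) * ρ ^ γ) =o[Filter.atTop] fun ρ : ℝ => ρ ^ γ)
    (bound : ∀ ρ : ℝ, 0 < ρ → |deriv (deriv p) ρ| ≤ A * (deriv p ρ / ρ))
    (T δ R L : ℝ) (hT : 0 < T) (hδ : 0 < δ) :
    ∃ C : ℝ, 0 < C ∧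
      ∀ V : StrongFields d, HypStrong (constCapillarity d h Cκ) T V →
        VelocityBound T L V →
        (∀ t ∈ Set.Icc 0 T, ∀ x, V.ρ t x ∈ Set.Icc δ R) →
      ∀ W : WeakFields d, HypWeak (constCapillarity d h Cκ) T W →
        (∀ t ∈ Set.Icc 0 T,
          MeasureTheory.Integrable (relDensity (constCapillarity d h Cκ) W V t) (dx d)) ∧
        ((γ < 2 → ∫ x, (W.ρ 0 x - V.ρ 0 x) ∂(dx d) = 0) →
          ∀ t ∈ Set.Icc 0 T, relEnergy (constCapillarity d h Cκ) W V t
            ≤ C * relEnergy (constCapillarity d h Cκ) W V 0) ∧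
        (relEnergy (constCapillarity d h Cκ) W V 0 = 0 →
          IsLUB (relEnergy (constCapillarity d h Cκ) W V '' Set.Icc 0 T) 0 ∧
            ∀ t ∈ Set.Icc 0 T, Coincide W V t) ∧
        (Coincide W V 0 → ∀ t ∈ Set.Icc 0 T, Coincide W V t) := by
  have H := Thermo.of_pressure hA h_cont h_smooth p_smooth thermo monotone bound
  obtain ⟨c, hc, hcoer⟩ : ∃ c, 0 < c ∧ (2 ≤ γ → ∀ ρ, 0 ≤ ρ → ∀ a ∈ Set.Icc δ R,
      c * (ρ - a) ^ 2 ≤ relh h ρ a) := by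
    by_cases h2 : 2 ≤ γ
    · obtain ⟨c, hc, hcoer⟩ := H.relh_coercive (R := R) h2 hk hδ growth
      exact ⟨c, hc, fun _ => hcoer⟩
    · exact ⟨1, one_pos, fun h => absurd h h2⟩
  -- The maximum covers both cases: c⁻¹ from coercivity and 2/Cκ from Poincaré. |L| replaces L
  -- because the sign of L is not prescribed and the rate has to be non-negative.
  refine ⟨Real.exp (growthRate d A Cκ |L| (max c⁻¹ (2 / Cκ)) * T), Real.exp_pos _,
    fun V hV hVL hmem W hW => ?_⟩
  have hS := hW.isWeakSolution
  have h0T : (0 : ℝ) ∈ Set.Icc 0 T := ⟨le_rfl, hT.le⟩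
  obtain ⟨hint, -⟩ := relEnergy_formula H hCκ hT hδ hV hmem hW
  have hnn : ∀ t ∈ Set.Icc 0 T, 0 ≤ relEnergy (constCapillarity d h Cκ) W V t :=
    fun t ht => relEnergy_nonneg H hCκ hδ hmem hS ht
  have stab : (γ < 2 → ∫ x, (W.ρ 0 x - V.ρ 0 x) ∂(dx d) = 0) →
      ∀ t ∈ Set.Icc 0 T, relEnergy (constCapillarity d h Cκ) W V t
        ≤ Real.exp (growthRate d A Cκ |L| (max c⁻¹ (2 / Cκ)) * T)
          * relEnergy (constCapillarity d h Cκ) W V 0 := by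
    intro hmean t ht
    refine (relEnergy_gronwall H hCκ hT hδ (abs_nonneg L) hV (hVL.mono_bound (le_abs_self L)) hmem
      hW (M := max c⁻¹ (2 / Cκ)) (fun s hs => ?_) ht).trans
      (mul_le_mul_of_nonneg_right (Real.exp_le_exp.2 (mul_le_mul_of_nonneg_left ht.2
        (growthRate_nonneg hA.le hCκ.le (abs_nonneg L) (le_max_of_le_right (by positivity)))))
        (hnn 0 h0T))
    by_cases h2 : 2 ≤ γ
    · obtain ⟨h3, h4⟩ :=
        sq_density_le_of_coercive hCκ hT hδ hc (hcoer h2) hV hmem hS hs (hint s hs)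
      exact ⟨h3, h4.trans (mul_le_mul_of_nonneg_right (le_max_left _ _) (hnn s hs))⟩
    · obtain ⟨h3, h4⟩ :=
        sq_density_le_of_mean H hCκ hT hδ hV hmem hS (hmean (not_le.1 h2)) hs (hint s hs)
      exact ⟨h3, h4.trans (mul_le_mul_of_nonneg_right (le_max_right _ _) (hnn s hs))⟩
  have uniq : relEnergy (constCapillarity d h Cκ) W V 0 = 0 →
      (∀ t ∈ Set.Icc 0 T, relEnergy (constCapillarity d h Cκ) W V t = 0) ∧
        ∀ t ∈ Set.Icc 0 T, Coincide W V t := by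
    intro h0
    have hc0 := coincide_of_relEnergy_eq_zero H hCκ hδ hmem hS h0T (hint 0 h0T) h0
    have hz : ∀ t ∈ Set.Icc 0 T, relEnergy (constCapillarity d h Cκ) W V t = 0 := fun t ht => by
      refine le_antisymm ?_ (hnn t ht)
      -- Vanishing initial relative energy gives ρ = ρ̄ at time 0, so the initial masses agree and
      -- stability applies for γ < 2 as well.
      have := stab (fun _ => integral_eq_zero_of_ae
        (hc0.mono fun x hx => sub_eq_zero.2 hx.1)) t ht
      rwa [h0, mul_zero] at this
    exact ⟨hz, fun t ht => coincide_of_relEnergy_eq_zero H hCκ hδ hmem hS ht (hint t ht) (hz t ht)⟩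
  refine ⟨hint, stab, fun h0 => ⟨?_, (uniq h0).2⟩, fun hc0 =>
    (uniq (relEnergy_eq_zero_of_coincide hT hδ hV hmem hS h0T hc0)).2⟩
  -- The image is the singleton {0}, since [0,T] is nonempty; so the least upper bound is 0.
  have himg : relEnergy (constCapillarity d h Cκ) W V '' Set.Icc 0 T = {0} :=
    (Set.Nonempty.image _ ⟨0, h0T⟩).subset_singleton_iff.1 (by
      rintro _ ⟨t, ht, rfl⟩
      exact (uniq h0).1 t ht)
  rw [himg]
  exact isLUB_singleton
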